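/- **Setting.** Let $\mathcal P$ be a small superalgebra: a finite dimensional real unital $\mathbb Z/2$-graded, graded commutative algebra with a unital algebra projection $\#:\mathcal P\to\mathbb R$ whose kernel is nilpotent. A $\mathcal P$-supermanifold $\mathcal M$ of superdimension $(m,n)$ is glued from superdomains $U^{|n}$, $U\subset\mathbb R^m$ open, with superfunctions $\mathcal P\boxtimes(C^\infty(U)\otimes\bigwedge\mathbb R^n)$, along $\mathcal P$-supermorphisms. Its local super coordinates are $x^i$ (even for $i\le m$, odd for the other $n$ indices; $|i|$ is the parity); a $\mathcal P$-supermorphism is given in coordinates by a tuple of superfunctions of the right parities, and composition with it is defined by Taylor expansion in the nilpotent parts. Repeated indices are summed. Let $g$ be a Riemannian $\mathcal P$-supermetric on $\mathcal M$ (even, graded symmetric, non-degenerate), $g_{ij}=g(\partial_i,\partial_j)$, with inverse $g^{kl}$ defined by $g_{ij}g^{kj}=\delta_i^k$, $g^{ij}g_{ik}=\delta_k^j$. Let $\nabla$ be its Levi-Civita connection (the torsionfree affine $\mathcal P$-connection compatible with $g$), $\nabla_{\partial_i}\partial_j=\Gamma_{ij}^k\partial_k$; let $\mathcal V$ be an even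 superfunction on $\mathcal M$ (the potential) and $X_{g,\mathcal V}=X^k\partial_k$ the even super vectorfield with $d\mathcal V=g(\cdot,X_{g,\mathcal V})$. On the super tangent bundle $\widehat{sT\mathcal M}$, with coordinates $(x^i,\xi^i)$, $\xi^i$ being the component of $\partial_i$, and projection $\Pi$, put $$U=\xi^i\partial_{x^i}-\xi^j\xi^i(\Gamma_{ij}^k\circ\Pi)\,\partial_{\xi^k},\qquad \widetilde{X_{g,\mathcal V}}=(X^k\circ\Pi)\,\partial_{\xi^k},\qquad \mathcal T=\tfrac12\xi^i\xi^j(g_{ji}\circ\Pi),\qquad \mathcal L=\mathcal T-\mathcal V\circ\Pi .$$ On the super cotangent bundle $\widehat{sT^*\mathcal M}$, with coordinates $(x^i,a_i)$, $a_i$ being the components of the covector $a_i\,dx^i$, and projection $\Pi$, let $\omega=d\alpha$ with the Liouville form $\alpha=a_i\,dx^i$. The Legendre map $\widehat\varphi:\widehat{sT\mathcal M}\to\widehat{sT^*\mathcal M}$, induced by $X\mapsto g(\cdot,X)$, is $(x^i,\,(-1)^{|i|+|j|}(g_{ij}\circ\Pi)\xi^j)$, with inverse $(x^l,\,(-1)^{|k|+|l|}(g^{kl}\circ\Pi)a_k)$.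 Let $\mathcal H=\mathcal T\circ\widehat\varphi^{-1}+\mathcal V\circ\Pi$, and let $X_{\omega,\mathcal H}$ be the even super vectorfield with $\omega(\cdot,X_{\omega,\mathcal H})=d\mathcal H$. A $\mathcal P$-curve is a $\mathcal P$-supermorphism $\gamma:I\to\mathcal M$ with $I\subset\mathbb R$ an open interval; its lift is $\dot\gamma=(\gamma^i,\frac{d}{dt}\gamma^i):I\to\widehat{sT\mathcal M}$. A curve $\eta$ is an integral curve to $Z$ if $\dot\eta=\eta^*Z$. Super vectorfields $Z$ and $W$ are related under $\Phi$ if $(d\Phi)Z=\Phi^*W$. **Theorem 5.1.** (i) For every $\mathcal P$-curve $\gamma:I\to\mathcal M$, the lift $\dot\gamma:I\to\widehat{sT\mathcal M}$ is an integral curve to $U-\widetilde{X_{g,\mathcal V}}$ if and only if it fulfills the super Euler–Lagrange equations: in all charts and for all $k$, $$\frac{d}{dt}\bigl((\partial_{\xi^k}\mathcal L)\circ\dot\gamma\bigr)=(\partial_{x^k}\mathcal L)\circ\dot\gamma. \tag{7}$$ (ii) $U-\widetilde{X_{g,\mathcal V}}$ and $X_{\omega,\mathcal H}$ are related under $\widehat\varphi$.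 (iii) Hence the Newton, Lagrange and Hamilton formulations are equivalent: for every $\mathcal P$-curve $\gamma$, Newton's equation $\nabla_{\dot\gamma}\dot\gamma=-\gamma^*X_{g,\mathcal V}$, i.e. $\ddot\gamma^k+\dot\gamma^j\dot\gamma^i(\Gamma_{ij}^k\circ\gamma)=-X^k\circ\gamma$ in all charts and for all $k$, holds if and only if (7) holds, and (7) holds if and only if $\widehat\varphi\circ\dot\gamma$ is an integral curve to $X_{\omega,\mathcal H}$. -/

import Mathlib

open scoped ContDiff

noncomputable section

namespace PSuper

/-! ## Small superalgebras and Grassmann algebras with parameters -/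

/-- The Koszul sign `(-1)^k`, for a parity `k`. -/
def sgn (k : ZMod 2) : ℝ := if k = 0 then 1 else -1

/-- A small superalgebra: a finite dimensional real unital `ℤ/2`-graded, graded commutative algebra
with a unital algebra projection `body` onto `ℝ` whose kernel is nilpotent (a product of
sufficiently many elements of the kernel vanishes). -/
class SmallSuperalgebra (P : Type*) [Ring P] [Algebra ℝ P] where
  gr : ZMod 2 → Submodule ℝ P
  graded : GradedAlgebra gr
  finite : Module.Finite ℝ P
  supercomm : ∀ (i j : ZMod 2) (a b : P), a ∈ gr i → b ∈ gr j → a * b = sgn (i * j) • (b * a)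
  body : P →ₐ[ℝ] ℝ
  nilpotent : ∃ N : ℕ, ∀ l : List P, l.length = N → (∀ a ∈ l, body a = 0) → l.prod = 0

attribute [instance] SmallSuperalgebra.graded SmallSuperalgebra.finite

/-- The exterior algebra `⋀ ℝ^O` on the odd generators labelled by `O`, with its parity grading. -/
abbrev extGr (O : Type*) : ZMod 2 → Submodule ℝ (ExteriorAlgebra ℝ (O → ℝ)) :=
  CliffordAlgebra.evenOdd (0 : QuadraticForm ℝ (O → ℝ))

/-- `P ⊠ ⋀ ℝ^O`, the graded tensor product. -/
abbrev Gr (P : Type*) [Ring P] [Algebra ℝ P] [SmallSuperalgebra P] (O : Type*) :=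
  GradedTensorProduct ℝ (SmallSuperalgebra.gr (P := P)) (extGr O)

section Grassmann

variable (P : Type*) [Ring P] [Algebra ℝ P] [SmallSuperalgebra P]
variable (O : Type*)

/-- The identification of the underlying vector space of `P ⊠ ⋀ ℝ^O` with `P ⊗ ⋀ ℝ^O`. -/
abbrev Gr.equivTensor : Gr P O ≃ₗ[ℝ] TensorProduct ℝ P (ExteriorAlgebra ℝ (O → ℝ)) :=
  (GradedTensorProduct.of ℝ (SmallSuperalgebra.gr (P := P)) (extGr O)).symm

instance extFinite [Finite O] : Module.Finite ℝ (ExteriorAlgebra ℝ (O → ℝ)) := by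
  classical
  have := Fintype.ofFinite O
  exact Module.Finite.of_basis
    ((Pi.basisFun ℝ O).reindex (Fintype.equivFin O)).ExteriorAlgebra

instance Gr.instFinite [Finite O] : Module.Finite ℝ (Gr P O) :=
  Module.Finite.equiv (Gr.equivTensor P O).symm

/-- The finite dimensional space `P ⊠ ⋀ ℝ^O` is normed through a basis; all norms on it being
equivalent, the notions of smoothness and derivative do not depend on this choice. -/
instance Gr.instNormedAddCommGroup [Finite O] : NormedAddCommGroup (Gr P O) :=
  NormedAddCommGroup.induced (Gr P O) (Fin (Module.finrank ℝ (Gr P O)) → ℝ)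
    (Module.finBasis ℝ (Gr P O)).equivFun.toLinearMap
    (Module.finBasis ℝ (Gr P O)).equivFun.injective

instance Gr.instNormedSpace [Finite O] : NormedSpace ℝ (Gr P O) :=
  NormedSpace.induced ℝ (Gr P O) (Fin (Module.finrank ℝ (Gr P O)) → ℝ)
    (Module.finBasis ℝ (Gr P O)).equivFun.toLinearMap

variable {P O}

/-- The homogeneous elements of parity `k` of `P ⊠ ⋀ ℝ^O`. -/
def Gr.par (k : ZMod 2) : Submodule ℝ (Gr P O) :=
  Submodule.span ℝ {z | ∃ i j : ZMod 2, i + j = k ∧ ∃ a ∈ SmallSuperalgebra.gr (P := P) i,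
    ∃ b ∈ extGr O j, z = GradedTensorProduct.tmul ℝ a b}

/-- The body `# : P ⊠ ⋀ ℝ^O → ℝ`. -/
def Gr.body : Gr P O →ₗ[ℝ] ℝ :=
  LinearMap.mul' ℝ ℝ ∘ₗ
    TensorProduct.map (SmallSuperalgebra.body (P := P)).toLinearMap
      (ExteriorAlgebra.algebraMapInv (R := ℝ) (M := O → ℝ)).toLinearMap ∘ₗ
    (Gr.equivTensor P O).toLinearMap

/-- The odd generator `ξ^o`. -/
def Gr.xi [DecidableEq O] (o : O) : Gr P O :=
  GradedTensorProduct.includeRight (SmallSuperalgebra.gr (P := P)) (extGr O)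
    (ExteriorAlgebra.ι ℝ (Pi.single o 1))

/-- The parity involution of `P`: the identity on even, minus the identity on odd elements. -/
def parityInv : P →ₗ[ℝ] P :=
  GradedAlgebra.proj (SmallSuperalgebra.gr (P := P)) 0 -
    GradedAlgebra.proj (SmallSuperalgebra.gr (P := P)) 1

/-- The odd `P`-linear left super derivation `∂/∂ξ^o` of `P ⊠ ⋀ ℝ^O`:
`p ⊗ w ↦ (-1)^|p| p ⊗ ∂w/∂ξ^o`, with `∂/∂ξ^o` on `⋀ ℝ^O` the left contraction with the
`o`-th coordinate functional. -/
def Gr.oddDeriv (o : O) : Gr P O →ₗ[ℝ] Gr P O :=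
  (Gr.equivTensor P O).symm.toLinearMap ∘ₗ
    TensorProduct.map (parityInv (P := P))
      (CliffordAlgebra.contractLeft (Q := (0 : QuadraticForm ℝ (O → ℝ))) (LinearMap.proj o)) ∘ₗ
    (Gr.equivTensor P O).toLinearMap

open Classical in
/-- Substitution of elements `β o` for the odd generators: `p ⊗ ξ^{o₁}⋯ξ^{oₖ} ↦ p β_{o₁}⋯β_{oₖ}`.
It is used for odd `β o` only; these satisfy the condition under which the algebra homomorphism
`⋀ ℝ^{O'} → P ⊠ ⋀ ℝ^O` exists (linear combinations of odd elements have square zero). -/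
def Gr.subst {O' : Type*} [Fintype O'] (β : O' → Gr P O) : Gr P O' →ₗ[ℝ] Gr P O :=
  if h : ∀ v : O' → ℝ, Fintype.linearCombination ℝ β v * Fintype.linearCombination ℝ β v = 0 then
    LinearMap.mul' ℝ (Gr P O) ∘ₗ
      TensorProduct.map
        (GradedTensorProduct.includeLeft (SmallSuperalgebra.gr (P := P)) (extGr O)).toLinearMap
        (ExteriorAlgebra.lift ℝ ⟨Fintype.linearCombination ℝ β, h⟩).toLinearMap ∘ₗ
      (Gr.equivTensor P O').toLinearMap
  else 0

end Grassmann

/-! ## Superdomains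

A superfunction on the superdomain `U^{|O}`, `U ⊆ ℝ^E` open, with parameters in `P`, i.e. a section
of `P ⊠ (C^∞ ⊗ ⋀ ℝ^O)`, is a smooth function `U → P ⊠ ⋀ ℝ^O`. It is represented by a total function
whose values off `U` are irrelevant. The super coordinates are labelled by `E ⊕ O`. -/

/-- Superfunctions in the even coordinates labelled by `E` and the odd ones labelled by `O`. -/
abbrev SFun (P : Type*) [Ring P] [Algebra ℝ P] [SmallSuperalgebra P] (E O : Type*) :=
  (E → ℝ) → Gr P O

/-- The parity of a coordinate. -/
def par {E O : Type*} : E ⊕ O → ZMod 2 := Sum.elim (fun _ => 0) (fun _ => 1)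

section Superdomain

variable {P : Type*} [Ring P] [Algebra ℝ P] [SmallSuperalgebra P]
variable {E O E' O' : Type*} [Fintype E] [DecidableEq E] [Fintype O] [DecidableEq O]
  [Fintype E'] [DecidableEq E'] [Fintype O'] [DecidableEq O']

/-- The coordinate superfunctions. -/
def coord : E ⊕ O → SFun P E O
  | .inl e => fun x => algebraMap ℝ (Gr P O) (x e)
  | .inr o => fun _ => Gr.xi o

/-- The partial derivatives with respect to the even and odd coordinates. -/
def pd : E ⊕ O → SFun P E O → SFun P E O
  | .inl e => fun f x => fderiv ℝ f x (Pi.single e 1)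
  | .inr o => fun f x => Gr.oddDeriv o (f x)

/-- `f` is a superfunction on `U^{|O}`, homogeneous of parity `k`. -/
def IsSFunOn (U : Set (E → ℝ)) (k : ZMod 2) (f : SFun P E O) : Prop :=
  ContDiffOn ℝ ∞ f U ∧ ∀ x ∈ U, f x ∈ Gr.par k

/-- The body map of a tuple of superfunctions. -/
def bodyMap (Φ : E' ⊕ O' → SFun P E O) (x : E → ℝ) : E' → ℝ :=
  fun e => Gr.body (Φ (.inl e) x)

/-- The tuple `Φ` of superfunctions is a `P`-supermorphism from `U^{|O}` to `V^{|O'}`. -/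
def IsSMorOn (U : Set (E → ℝ)) (V : Set (E' → ℝ)) (Φ : E' ⊕ O' → SFun P E O) : Prop :=
  (∀ j, IsSFunOn U (par j) (Φ j)) ∧ Set.MapsTo (bodyMap Φ) U V

/-- The pullback `Φ^* h = h ∘ Φ` of a superfunction `h` under the `P`-supermorphism with coordinate
tuple `Φ = (f, λ)`: the (finite) Taylor expansion `∑_r (1/r!) (∂_r h ∘ f^#) (f - f^#)^r` around the
body `f^#` of the even components, with the odd coordinates of the target replaced by `λ`. The sum
over multi-indices of length `k` is written as a sum over `Fin k → E'`, with factor `1/k!`; it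
vanishes for `k ≥ dim (P ⊠ ⋀ ℝ^O)`, since the elements of body zero form a nilpotent ideal. -/
def pull (Φ : E' ⊕ O' → SFun P E O) (h : SFun P E' O') : SFun P E O := fun x =>
  ∑ k ∈ Finset.range (Module.finrank ℝ (Gr P O)), ((k.factorial : ℝ)⁻¹) •
    ∑ e : Fin k → E',
      (List.ofFn fun i =>
        Φ (.inl (e i)) x - algebraMap ℝ (Gr P O) (bodyMap Φ x (e i))).prod *
      Gr.subst (fun o => Φ (.inr o) x)
        (iteratedFDeriv ℝ k h (bodyMap Φ x) fun i => Pi.single (e i) 1)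

end Superdomain

/-! ## `P`-supermanifolds -/

/-- Data for gluing superdomains of superdimension `(E | O)`: `dom a b` is the part of the body
domain of the chart `a` lying in the chart `b` (so `dom a a` is the whole body domain of the chart
`a`), and `trans a b` is the tuple of the coordinates of the chart `b` as superfunctions of those
of the chart `a`. -/
structure SuperAtlas (P : Type*) [Ring P] [Algebra ℝ P] [SmallSuperalgebra P]
    (E O : Type*) where
  Chart : Type*
  dom : Chart → Chart → Set (E → ℝ)
  trans : Chart → Chart → E ⊕ O → SFun P E O

/-- A `P`-supermanifold of superdimension `(E | O)`, glued from superdomains along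
`P`-superdiffeomorphisms. -/
structure PSupermanifold (P : Type*) [Ring P] [Algebra ℝ P] [SmallSuperalgebra P]
    (E O : Type*) [Fintype E] [DecidableEq E] [Fintype O] [DecidableEq O]
    extends SuperAtlas P E O where
  isOpen_dom : ∀ a b, IsOpen (dom a b)
  dom_subset : ∀ a b, dom a b ⊆ dom a a
  trans_mor : ∀ a b, IsSMorOn (dom a b) (dom b a) (trans a b)
  trans_self : ∀ a, ∀ x ∈ dom a a, ∀ j, trans a a j x = coord j x
  cocycle : ∀ a b c, ∀ x ∈ dom a b, bodyMap (trans a b) x ∈ dom b c →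
    x ∈ dom a c ∧ ∀ j, pull (trans a b) (trans b c j) x = trans a c j x

section Manifold

variable {P : Type*} [Ring P] [Algebra ℝ P] [SmallSuperalgebra P]
variable {E O : Type*} [Fintype E] [DecidableEq E] [Fintype O] [DecidableEq O]

/-- Local representatives, in all charts, of a superfunction. -/
abbrev SuperAtlas.Fun (N : SuperAtlas P E O) := N.Chart → SFun P E O

/-- Local components `X^i`, in all charts, of a super vectorfield `X = X^i ∂_i`. -/
abbrev SuperAtlas.Field (N : SuperAtlas P E O) := N.Chart → E ⊕ O → SFun P E O

/-- `f` is a superfunction of parity `k` on `N`. -/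
def IsSuperFunction (N : SuperAtlas P E O) (k : ZMod 2) (f : N.Fun) : Prop :=
  (∀ a, IsSFunOn (N.dom a a) k (f a)) ∧
  ∀ a b, ∀ x ∈ N.dom a b, pull (N.trans a b) (f b) x = f a x

/-- `X` is an even `P`-super vectorfield on `N`: its components in any two charts are related by
`X'^j ∘ Φ = X^i ∂_i Φ^j`, with `Φ` the change of charts. -/
def IsEvenVectorField (N : SuperAtlas P E O) (X : N.Field) : Prop :=
  (∀ a j, IsSFunOn (N.dom a a) (par j) (X a j)) ∧
  ∀ a b, ∀ x ∈ N.dom a b, ∀ j,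
    pull (N.trans a b) (X b j) x = ∑ i, X a i x * pd i (N.trans a b j) x

/-- Let `Φ : N → N'` be a morphism that maps the chart `a` of `N` into the chart of `N'` with the
same label, where it is given by the tuple `Φ a`. The super vectorfields `X` on `N` and `Y` on `N'`
are `Φ`-related, i.e. `(dΦ) X = Φ^* Y`, where `(dΦ) X = (X Φ^j) Φ^*∂_j`. -/
def Related {E' O' : Type*} [Fintype E'] [DecidableEq E'] [Fintype O'] [DecidableEq O']
    {N : SuperAtlas P E O} {N' : SuperAtlas P E' O'} (lab : N.Chart → N'.Chart)
    (Φ : N.Chart → E' ⊕ O' → SFun P E O) (X : N.Field) (Y : N'.Field) : Prop :=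
  ∀ a, ∀ x ∈ N.dom a a, ∀ j,
    ∑ i, X a i x * pd i (Φ a j) x = pull (Φ a) (Y (lab a) j) x

/-! ### Curves -/

/-- Local data of a curve with parameters in `P`: `pre a` is the set of all times at which the curve
is in the chart `a`, and `tup a` is the tuple of its coordinates in the chart `a`. Time is the
coordinate of the superdomain `ℝ^{1|0}`. -/
structure CurveData (N : SuperAtlas P E O) where
  pre : N.Chart → Set (Fin 1 → ℝ)
  tup : N.Chart → E ⊕ O → SFun P (Fin 1) (Fin 0)

/-- The time derivative. -/
abbrev dt : SFun P (Fin 1) (Fin 0) → SFun P (Fin 1) (Fin 0) := pd (.inl 0)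

/-- `γ` is a `P`-curve `I → N`, i.e. a `P`-supermorphism from `I` to `N`. -/
structure IsPCurve (N : SuperAtlas P E O) (I : Set ℝ) (γ : CurveData N) : Prop where
  isOpen_pre : ∀ a, IsOpen (γ.pre a)
  cover : ⋃ a, γ.pre a = {t | t 0 ∈ I}
  mor : ∀ a, IsSMorOn (γ.pre a) (N.dom a a) (γ.tup a)
  overlap : ∀ a b, ∀ t ∈ γ.pre a, bodyMap (γ.tup a) t ∈ N.dom a b ↔ t ∈ γ.pre b
  compat : ∀ a b, ∀ t ∈ γ.pre a, t ∈ γ.pre b → ∀ j,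
    pull (γ.tup a) (N.trans a b j) t = γ.tup b j t

/-- The differential equation `γ̇ = γ^* X` of the integral curves to `X`. -/
def IsSuperIntegralCurve {N : SuperAtlas P E O} (X : N.Field) (γ : CurveData N) : Prop :=
  ∀ a, ∀ t ∈ γ.pre a, ∀ j, dt (γ.tup a j) t = pull (γ.tup a) (X a j) t

end Manifold

/-! ## Super tangent and cotangent bundle, realised as glued superdomains -/

section Bundles

variable {P : Type*} [Ring P] [Algebra ℝ P] [SmallSuperalgebra P]
variable {E O : Type*} [Fintype E] [DecidableEq E] [Fintype O] [DecidableEq O]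

/-- The label of the base coordinate `x^i` in a bundle chart. -/
def bas : E ⊕ O → (E ⊕ E) ⊕ (O ⊕ O) := Sum.map Sum.inl Sum.inl

/-- The label of the fibre coordinate (`ξ^i` resp. `a_i`) in a bundle chart. -/
def fib : E ⊕ O → (E ⊕ E) ⊕ (O ⊕ O) := Sum.map Sum.inr Sum.inr

/-- The tuple on a bundle chart with given base components `u i` and fibre components `v i`. -/
def bundleTuple {α : Type*} (u v : E ⊕ O → α) : (E ⊕ E) ⊕ (O ⊕ O) → α
  | .inl (.inl e) => u (.inl e)
  | .inl (.inr e) => v (.inl e)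
  | .inr (.inl o) => u (.inr o)
  | .inr (.inr o) => v (.inr o)

/-- `f ∘ Π`, with `Π` the bundle projection. -/
def pullProj (f : SFun P E O) : SFun P (E ⊕ E) (O ⊕ O) := pull (fun i => coord (bas i)) f

/-- The super tangent bundle as a space glued from superdomains: with base coordinates `x^i` and
fibre coordinates `ξ^i` of the same parity, its transition morphisms are the prolongations
`(Φ^j, ξ^i ∂_i Φ^j)` of those of `M`. -/
def tangent (M : SuperAtlas P E O) : SuperAtlas P (E ⊕ E) (O ⊕ O) where
  Chart := M.Chart
  dom a b := {z | (fun e => z (.inl e)) ∈ M.dom a b}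
  trans a b := bundleTuple (fun j => pullProj (M.trans a b j))
    (fun j => ∑ i, coord (fib i) * pullProj (pd i (M.trans a b j)))

/-- The super cotangent bundle as a space glued from superdomains: its fibre coordinates `a_i` are
the components of the covector `a_i dx^i`. In terms of the coordinates `y^k` of another chart
`dx^i = (-1)^(|k| + |i||k|) (∂x^i/∂y^k) dy^k`, which gives the transition morphisms. -/
def cotangent (M : SuperAtlas P E O) : SuperAtlas P (E ⊕ E) (O ⊕ O) where
  Chart := M.Chart
  dom a b := {z | (fun e => z (.inl e)) ∈ M.dom a b}
  trans a b := bundleTuple (fun j => pullProj (M.trans a b j))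
    (fun k => ∑ i, sgn (par k + par i * par k) •
      (coord (fib i) * pullProj (pull (M.trans a b) (pd k (M.trans b a i)))))

/-- The lift `γ̇` of a curve `γ` to the super tangent bundle, in local super coordinates
`(γ^i, dγ^i/dt)`. -/
def CurveData.dot {M : SuperAtlas P E O} (γ : CurveData M) : CurveData (tangent M) where
  pre := γ.pre
  tup a := bundleTuple (γ.tup a) (fun i => dt (γ.tup a i))

/-! ## Metrics and connections -/

/-- A Riemannian `P`-supermetric `g` on `M`, in terms of its local components
`coeff a i j = g_ij = g(∂_i, ∂_j)` in the charts `a`. Being non-degenerate means that there are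
superfunctions `g^kl` with `g_ij g^kj = δ_i^k` and `g^ij g_ik = δ_k^j`. -/
structure RiemannianSupermetric (M : SuperAtlas P E O) where
  coeff : M.Chart → E ⊕ O → E ⊕ O → SFun P E O
  smooth : ∀ a i j, IsSFunOn (M.dom a a) (par i + par j) (coeff a i j)
  symm : ∀ a, ∀ x ∈ M.dom a a, ∀ i j, coeff a j i x = sgn (par i * par j) • coeff a i j x
  nondeg : ∀ a, ∃ h : E ⊕ O → E ⊕ O → SFun P E O,
    (∀ k l, IsSFunOn (M.dom a a) (par k + par l) (h k l)) ∧
    (∀ x ∈ M.dom a a, ∀ i k, ∑ j, coeff a i j x * h k j x = if i = k then 1 else 0) ∧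
    (∀ x ∈ M.dom a a, ∀ j k, ∑ i, h i j x * coeff a i k x = if j = k then 1 else 0)
  tensorial : ∀ a b, ∀ x ∈ M.dom a b, ∀ i j, coeff a i j x =
    ∑ k, ∑ l, sgn (par k * (par j + par l)) •
      (pd i (M.trans a b k) x * pd j (M.trans a b l) x * pull (M.trans a b) (coeff b k l) x)

/-- The components `g^kl` of the inverse of the metric. -/
def RiemannianSupermetric.inv {M : SuperAtlas P E O} (g : RiemannianSupermetric M) (a : M.Chart) :
    E ⊕ O → E ⊕ O → SFun P E O :=
  (g.nondeg a).choose

/-- An affine `P`-connection on `M`, in terms of its Christoffel symbols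
`Γ a i j k = Γ_ij^k`, `∇_{∂_i} ∂_j = Γ_ij^k ∂_k`, and their law of transformation. -/
structure AffineConnection (M : SuperAtlas P E O) where
  Γ : M.Chart → E ⊕ O → E ⊕ O → E ⊕ O → SFun P E O
  smooth : ∀ a i j k, IsSFunOn (M.dom a a) (par i + par j + par k) (Γ a i j k)
  transform : ∀ a b, ∀ x ∈ M.dom a b, ∀ i j l,
    ∑ k, Γ a i j k x * pd k (M.trans a b l) x =
      pd i (pd j (M.trans a b l)) x +
      ∑ k, ∑ r, sgn (par i * (par j + par k)) •
        (pd j (M.trans a b k) x * pd i (M.trans a b r) x * pull (M.trans a b) (Γ b r k l) x)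

/-- `∇` is the Levi-Civita connection of `g`: it is torsionfree,
`∇_{∂_i} ∂_j = (-1)^(|i||j|) ∇_{∂_j} ∂_i`, and compatible with `g`,
`∂_i g(∂_j, ∂_r) = g(∇_{∂_i} ∂_j, ∂_r) + (-1)^(|i||j|) g(∂_j, ∇_{∂_i} ∂_r)`, where
`g(∂_j, Γ_ir^k ∂_k) = (-1)^(|j|(|i|+|r|+|k|)) Γ_ir^k g_jk`. -/
structure IsLeviCivita {M : SuperAtlas P E O} (g : RiemannianSupermetric M)
    (C : AffineConnection M) : Prop where
  torsionfree : ∀ a, ∀ x ∈ M.dom a a, ∀ i j k,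
    C.Γ a i j k x = sgn (par i * par j) • C.Γ a j i k x
  compatible : ∀ a, ∀ x ∈ M.dom a a, ∀ i j r,
    pd i (g.coeff a j r) x = ∑ k, C.Γ a i j k x * g.coeff a k r x +
      sgn (par i * par j) • ∑ k, sgn (par j * (par i + par r + par k)) •
        (C.Γ a i r k x * g.coeff a j k x)

/-- `X` is the super gradient `X_{g,V}` of the even superfunction `V`: the even super vectorfield
with `dV = g(·, X)`, i.e. `∂_i V = g(∂_i, X^k ∂_k) = (-1)^(|i||k|) X^k g_ik`. -/
structure IsSuperGradient {M : SuperAtlas P E O} (g : RiemannianSupermetric M) (V : M.Fun)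
    (X : M.Field) : Prop where
  even : IsEvenVectorField M X
  eq : ∀ a, ∀ x ∈ M.dom a a, ∀ i,
    pd i (V a) x = ∑ k, sgn (par i * par k) • (X a k x * g.coeff a i k x)

/-! ## Newton -/

/-- Newton's equation `∇_γ̇ γ̇ = - γ^* X`, with the covariant derivative along `γ` given in local super
coordinates by `∇_γ̇ S = (dS^k/dt + S^j γ̇^i (Γ_ij^k ∘ γ)) γ^*∂_k`. -/
def NewtonEquation {M : SuperAtlas P E O} (C : AffineConnection M) (X : M.Field)
    (γ : CurveData M) : Prop :=
  ∀ a, ∀ t ∈ γ.pre a, ∀ k,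
    dt (dt (γ.tup a k)) t +
      ∑ i, ∑ j, dt (γ.tup a j) t * dt (γ.tup a i) t * pull (γ.tup a) (C.Γ a i j k) t =
    - pull (γ.tup a) (X a k) t

/-- The generator `U = ξ^i ∂_{x^i} - ξ^j ξ^i (Γ_ij^k ∘ Π) ∂_{ξ^k}` of the geodesic flow, on the super
tangent bundle. -/
def geodesicGenerator {M : SuperAtlas P E O} (C : AffineConnection M) : (tangent M).Field :=
  fun a => bundleTuple (fun i => coord (fib i))
    (fun k => - ∑ i, ∑ j, coord (fib j) * coord (fib i) * pullProj (C.Γ a i j k))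

/-- The vertical lift `X̃ = (X^i ∘ Π) ∂_{ξ^i}` of a super vectorfield `X` to the super tangent
bundle. -/
def verticalLift {M : SuperAtlas P E O} (X : M.Field) : (tangent M).Field :=
  fun a => bundleTuple 0 (fun i => pullProj (X a i))

/-! ## Lagrange -/

/-- The kinetic energy `T = ½ ξ^i ξ^j (g_ji ∘ Π)` on the super tangent bundle. -/
def kinetic {M : SuperAtlas P E O} (g : RiemannianSupermetric M) : (tangent M).Fun :=
  fun a => (1 / 2 : ℝ) • ∑ i, ∑ j, coord (fib i) * coord (fib j) * pullProj (g.coeff a j i)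

/-- The Lagrangian `L = T - V ∘ Π`. -/
def lagrangian {M : SuperAtlas P E O} (g : RiemannianSupermetric M) (V : M.Fun) :
    (tangent M).Fun :=
  fun a => kinetic g a - pullProj (V a)

/-- The super Euler-Lagrange equations `((∂_{ξ^k} L) ∘ γ̇)' = (∂_{x^k} L) ∘ γ̇`, for all `k` and in all
charts. -/
def EulerLagrange {M : SuperAtlas P E O} (L : (tangent M).Fun) (γ : CurveData M) : Prop :=
  ∀ a, ∀ t ∈ γ.pre a, ∀ k,
    dt (pull (γ.dot.tup a) (pd (fib k) (L a))) t = pull (γ.dot.tup a) (pd (bas k) (L a)) t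

/-! ## Hamilton -/

/-- The Legendre map `φ̂` from the super tangent to the super cotangent bundle, induced by
`φ(X) = g(·, X)`; it maps each chart to the chart with the same label, by
`(x^i, (-1)^(|i|+|j|) (g_ij ∘ Π) ξ^j)`. -/
def legendre {M : SuperAtlas P E O} (g : RiemannianSupermetric M) (a : M.Chart) :
    (E ⊕ E) ⊕ (O ⊕ O) → SFun P (E ⊕ E) (O ⊕ O) :=
  bundleTuple (fun i => coord (bas i))
    (fun i => ∑ j, sgn (par i + par j) • (pullProj (g.coeff a i j) * coord (fib j)))

/-- The inverse of the Legendre map, `(x^i, (-1)^(|k|+|l|) (g^kl ∘ Π) a_k)`. -/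
def legendreInv {M : SuperAtlas P E O} (g : RiemannianSupermetric M) (a : M.Chart) :
    (E ⊕ E) ⊕ (O ⊕ O) → SFun P (E ⊕ E) (O ⊕ O) :=
  bundleTuple (fun i => coord (bas i))
    (fun l => ∑ k, sgn (par k + par l) • (pullProj (g.inv a k l) * coord (fib k)))

/-- The Hamilton function `H = T ∘ φ̂⁻¹ + V ∘ Π` on the super cotangent bundle. -/
def hamiltonian {M : SuperAtlas P E O} (g : RiemannianSupermetric M) (V : M.Fun) :
    (cotangent M).Fun :=
  fun a => pull (legendreInv g a) (kinetic g a) + pullProj (V a)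

/-- The Liouville form `α = a_i dx^i` on a chart of the super cotangent bundle, through its values
`⟨∂_I, α⟩` on the coordinate vectorfields: `⟨∂_{x^i}, a_i dx^i⟩ = (-1)^|i| a_i` and
`⟨∂_{a_i}, α⟩ = 0`. -/
def liouville : (E ⊕ E) ⊕ (O ⊕ O) → SFun P (E ⊕ E) (O ⊕ O) :=
  bundleTuple (fun i => sgn (par i) • coord (fib i)) 0

/-- The canonical symplectic form `ω = dα`, with `dα(X, Y) = X⟨Y, α⟩ - (-1)^(|X||Y|) Y⟨X, α⟩` for
(super commuting) coordinate vectorfields `X` and `Y`. -/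
def symplecticForm (I J : (E ⊕ E) ⊕ (O ⊕ O)) : SFun P (E ⊕ E) (O ⊕ O) :=
  pd I (liouville J) - sgn (par I * par J) • pd J (liouville I)

/-- `Y` is the super Hamiltonian vectorfield `X_{ω,f}` of the even superfunction `f` on the super
cotangent bundle: the even super vectorfield with `ω(·, Y) = df`, where
`ω(∂_I, Y^J ∂_J) = (-1)^(|I||J|) Y^J ω(∂_I, ∂_J)`. -/
structure IsHamiltonianField {M : SuperAtlas P E O} (f : (cotangent M).Fun)
    (Y : (cotangent M).Field) : Prop where
  even : IsEvenVectorField (cotangent M) Y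
  eq : ∀ a, ∀ z ∈ (cotangent M).dom a a, ∀ I,
    ∑ J, sgn (par I * par J) • (Y a J z * symplecticForm I J z) = pd I (f a) z

/-- The curve `φ̂ ∘ η` in the super cotangent bundle, for a curve `η` in the super tangent bundle. -/
def CurveData.legendre {M : SuperAtlas P E O} (g : RiemannianSupermetric M)
    (η : CurveData (tangent M)) : CurveData (cotangent M) where
  pre := η.pre
  tup a j := pull (η.tup a) (PSuper.legendre g a j)

end Bundles

end PSuper

end

open PSuper

noncomputable section

set_option linter.unusedSectionVars false

namespace PSuper

/-! ### Signs -/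

/-! All assertions are chartwise and pointwise, so they reduce to identities in finite dimensional
graded commutative algebras `P ⊠ ⋀ ℝ^O`. Two ingredients carry the proof.

Calculus. The truncated Taylor expansion `pull` is an algebra homomorphism because the increments
are even without body, hence central and nilpotent, and a product of as many of them as the
dimension of the algebra vanishes (`Gr.prod_eq_zero`). This gives `pull_mul`, `pull_coord`,
`pull_pullProj` and, along curves, the chain rule `dt_pull`: the time derivative of `f ∘ c` is the
sum of the `ċ^j ((∂_j f) ∘ c)`.

Mechanics. Let `N^l = γ̈^l + γ̇^j γ̇^i Γ_ij^l + X^l` (`newtonDefect`). Metric compatibility and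
torsionfreeness express the base derivatives of the kinetic energy through `Γ`
(`half_sum_metric_derivative`). It follows that the difference of the two sides of the
Euler–Lagrange equation with index `k` is `∑ N^l g_lk` (`eulerLagrange_sub_eq`). The metric being
invertible, the equations for all `k` say `N = 0`, which is Newton's equation. For a lift, the base
half of the integral curve equation of `U - X̃` is a tautology and the fibre half is again `N = 0`.

On the Hamiltonian side the momenta are `(-1)^|k| ∂_{ξ^k} L` (`legendre_fib_apply`). The fibre
derivatives of `H` are the velocities, and its base derivatives correspond to those of `-L`
(`pd_fib_hamiltonian`, `pd_bas_hamiltonian`). As `ω` has constant Darboux coefficients, these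
derivatives determine the components of the Hamiltonian field, and `IsHamiltonianField.pull_eq`
computes their pullbacks. Along `φ̂ ∘ γ̇`, Hamilton's equations are then a tautology together with
signed Euler–Lagrange equations. The same computation on the bundle itself, with the fibre component
of `U - X̃` in place of `γ̈`, shows that the two fields are related. -/

lemma parity_cases (k : ZMod 2) : k = 0 ∨ k = 1 := by
  revert k; decide

@[simp] lemma sgn_zero : sgn 0 = 1 := by simp [sgn]

@[simp] lemma sgn_one : sgn 1 = -1 := by simp [sgn]

lemma sgn_add (a b : ZMod 2) : sgn (a + b) = sgn a * sgn b := by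
  obtain rfl | rfl := parity_cases a <;> obtain rfl | rfl := parity_cases b <;>
    simp [CharTwo.add_self_eq_zero]

lemma sgn_mul_self (a : ZMod 2) : sgn a * sgn a = 1 := by
  rw [← sgn_add, CharTwo.add_self_eq_zero, sgn_zero]

lemma units_pow_smul {M : Type*} [AddCommGroup M] [Module ℝ M] (k : ZMod 2) (x : M) :
    ((-1 : ℤˣ) ^ k) • x = sgn k • x := by
  obtain rfl | rfl := parity_cases k
  · simp
  · simp [Units.smul_def]

/-! ### The exterior algebra -/

section Exterior

variable {O : Type*}

/-- For the zero quadratic form any two vectors are orthogonal, so the sign rule for orthogonal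
Clifford algebras applies with both isometries equal to the identity. -/
lemma extGr_supercomm {i j : ZMod 2} {a b : ExteriorAlgebra ℝ (O → ℝ)} (ha : a ∈ extGr O i)
    (hb : b ∈ extGr O j) : a * b = sgn (i * j) • (b * a) := by
  have h := CliffordAlgebra.map_mul_map_of_isOrtho_of_mem_evenOdd
    (QuadraticMap.Isometry.id (0 : QuadraticForm ℝ (O → ℝ)))
    (QuadraticMap.Isometry.id (0 : QuadraticForm ℝ (O → ℝ)))
    (fun x y => by simp [QuadraticMap.isOrtho_def]) a b ha hb
  simp only [CliffordAlgebra.map_id, AlgHom.id_apply] at h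
  rw [h, units_pow_smul, mul_comm]

/-- The case of one vector is the defining recursion of the contraction. Multiplying by two further
vectors produces two sign changes, so induction in steps of two leaves `sgn i` unchanged. -/
lemma contractLeft_mul (d : Module.Dual ℝ (O → ℝ)) {i : ZMod 2}
    {a : ExteriorAlgebra ℝ (O → ℝ)} (ha : a ∈ extGr O i) (b : ExteriorAlgebra ℝ (O → ℝ)) :
    CliffordAlgebra.contractLeft (Q := (0 : QuadraticForm ℝ (O → ℝ))) d (a * b) =
      CliffordAlgebra.contractLeft (Q := (0 : QuadraticForm ℝ (O → ℝ))) d a * b +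
        sgn i • (a * CliffordAlgebra.contractLeft (Q := (0 : QuadraticForm ℝ (O → ℝ))) d b) := by
  induction a, ha using CliffordAlgebra.evenOdd_induction with
  | range_ι_pow v h =>
    obtain rfl | rfl := parity_cases i
    · obtain ⟨r, rfl⟩ := Submodule.mem_one.mp h
      rw [CliffordAlgebra.contractLeft_algebraMap_mul, CliffordAlgebra.contractLeft_algebraMap]
      simp
    · obtain ⟨w, rfl⟩ := (pow_one (LinearMap.range (CliffordAlgebra.ι
        (0 : QuadraticForm ℝ (O → ℝ))))) ▸ h
      rw [CliffordAlgebra.contractLeft_ι_mul, CliffordAlgebra.contractLeft_ι, Algebra.smul_def]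
      simp [sub_eq_add_neg]
  | add x y hx hy ihx ihy =>
    rw [add_mul, map_add, ihx, ihy, map_add, add_mul, add_mul, smul_add]; abel
  | ι_mul_ι_mul m₁ m₂ x hx ih =>
    simp only [mul_assoc, CliffordAlgebra.contractLeft_ι_mul, ih, smul_mul_assoc, sub_mul, mul_add,
      mul_sub, mul_smul_comm]
    abel

lemma contractLeft_mem (d : Module.Dual ℝ (O → ℝ)) {i : ZMod 2}
    {a : ExteriorAlgebra ℝ (O → ℝ)} (ha : a ∈ extGr O i) :
    CliffordAlgebra.contractLeft (Q := (0 : QuadraticForm ℝ (O → ℝ))) d a ∈ extGr O (i + 1) := by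
  induction a, ha using CliffordAlgebra.evenOdd_induction with
  | range_ι_pow v h =>
    obtain rfl | rfl := parity_cases i
    · obtain ⟨r, rfl⟩ := Submodule.mem_one.mp h
      rw [CliffordAlgebra.contractLeft_algebraMap]
      exact zero_mem _
    · obtain ⟨w, rfl⟩ := (pow_one (LinearMap.range (CliffordAlgebra.ι
        (0 : QuadraticForm ℝ (O → ℝ))))) ▸ h
      rw [CliffordAlgebra.contractLeft_ι]
      exact SetLike.algebraMap_mem_graded
        (CliffordAlgebra.evenOdd (0 : QuadraticForm ℝ (O → ℝ))) _
  | add x y hx hy ihx ihy => rw [map_add]; exact add_mem ihx ihy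
  | ι_mul_ι_mul m₁ m₂ x hx ih =>
    rw [mul_assoc, CliffordAlgebra.contractLeft_ι_mul, CliffordAlgebra.contractLeft_ι_mul]
    have h1 : ∀ m, CliffordAlgebra.ι (0 : QuadraticForm ℝ (O → ℝ)) m * x ∈ extGr O (i + 1) :=
      fun m => add_comm (1 : ZMod 2) i ▸
        SetLike.mul_mem_graded (CliffordAlgebra.ι_mem_evenOdd_one _ m) hx
    have h2 : ∀ m, ∀ y ∈ extGr O (i + 1),
        CliffordAlgebra.ι (0 : QuadraticForm ℝ (O → ℝ)) m * y ∈ extGr O i := fun m y hy => by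
      have := SetLike.mul_mem_graded (CliffordAlgebra.ι_mem_evenOdd_one _ m) hy
      rwa [add_left_comm, CharTwo.add_self_eq_zero, add_zero] at this
    have h3 : ∀ m, ∀ y ∈ extGr O i,
        CliffordAlgebra.ι (0 : QuadraticForm ℝ (O → ℝ)) m * y ∈ extGr O (i + 1) := fun m y hy =>
      add_comm (1 : ZMod 2) i ▸
        SetLike.mul_mem_graded (CliffordAlgebra.ι_mem_evenOdd_one _ m) hy
    exact sub_mem (Submodule.smul_mem _ _ (h1 _))
      (h3 _ _ (sub_mem (Submodule.smul_mem _ _ hx) (h2 _ _ ih)))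

end Exterior

/-! ### The graded tensor product `P ⊠ ⋀ ℝ^O` -/

namespace Gr

variable {P : Type*} [Ring P] [Algebra ℝ P] [SmallSuperalgebra P] {O : Type*}

open PSuper.SmallSuperalgebra (gr)

/-- The pure tensor `a ⊗ b`. -/
abbrev tm (a : P) (b : ExteriorAlgebra ℝ (O → ℝ)) : Gr P O :=
  GradedTensorProduct.tmul ℝ a b

lemma tm_mul_tm {i j : ZMod 2} (a : P) {b : ExteriorAlgebra ℝ (O → ℝ)} (hb : b ∈ extGr O j)
    {c : P} (hc : c ∈ gr i) (d : ExteriorAlgebra ℝ (O → ℝ)) :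
    (tm a b * tm c d : Gr P O) = sgn (j * i) • tm (a * c) (b * d) := by
  have := GradedTensorProduct.tmul_coe_mul_coe_tmul (R := ℝ) (gr (P := P)) (extGr O) a
    (⟨b, hb⟩ : extGr O j) (⟨c, hc⟩ : gr (P := P) i) d
  rw [units_pow_smul] at this
  exact this

lemma tm_add (a : P) (b c : ExteriorAlgebra ℝ (O → ℝ)) :
    (tm a (b + c) : Gr P O) = tm a b + tm a c := by
  exact (congrArg _ (TensorProduct.tmul_add a b c)).trans (map_add (GradedTensorProduct.of ℝ _ _) _ _)

lemma add_tm (a b : P) (c : ExteriorAlgebra ℝ (O → ℝ)) :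
    (tm (a + b) c : Gr P O) = tm a c + tm b c := by
  exact (congrArg _ (TensorProduct.add_tmul a b c)).trans (map_add (GradedTensorProduct.of ℝ _ _) _ _)

lemma smul_tm (r : ℝ) (a : P) (c : ExteriorAlgebra ℝ (O → ℝ)) :
    (tm (r • a) c : Gr P O) = r • tm a c := by
  exact (congrArg _ (TensorProduct.smul_tmul' r a c).symm).trans
    (map_smul (GradedTensorProduct.of ℝ _ _) _ _)

lemma tm_smul (r : ℝ) (a : P) (c : ExteriorAlgebra ℝ (O → ℝ)) :
    (tm a (r • c) : Gr P O) = r • tm a c := by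
  exact (congrArg _ (TensorProduct.tmul_smul r a c)).trans
    (map_smul (GradedTensorProduct.of ℝ _ _) _ _)

@[elab_as_elim]
-- Signs are only known for homogeneous elements; this reduces additive statements to tensors with
-- both factors homogeneous.
lemma induction_tm {motive : Gr P O → Prop} (z : Gr P O) (zero : motive 0)
    (add : ∀ x y, motive x → motive y → motive (x + y))
    (tm : ∀ (i j : ZMod 2) (a : P) (b : ExteriorAlgebra ℝ (O → ℝ)), a ∈ gr i → b ∈ extGr O j →
      motive (tm a b)) : motive z := by
  have key : ∀ (a : P) (b : ExteriorAlgebra ℝ (O → ℝ)), motive (Gr.tm a b) := by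
    intro a b
    induction a using DirectSum.Decomposition.inductionOn (gr (P := P)) with
    | zero => simpa [Gr.tm, GradedTensorProduct.tmul] using zero
    | add x y hx hy => rw [add_tm]; exact add _ _ hx hy
    | homogeneous a =>
      induction b using DirectSum.Decomposition.inductionOn (extGr O) with
      | zero => simpa [Gr.tm, GradedTensorProduct.tmul] using zero
      | add x y hx hy => rw [tm_add]; exact add _ _ hx hy
      | homogeneous b => exact tm _ _ _ _ a.2 b.2
  have := TensorProduct.induction_on (motive := fun t => motive
    (GradedTensorProduct.of ℝ (gr (P := P)) (extGr O) t)) (Gr.equivTensor P O z)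
    (by simpa using zero) key (fun x y hx hy => by rw [map_add]; exact add _ _ hx hy)
  simpa using this

lemma tm_mem_par {i j k : ZMod 2} {a : P} {b : ExteriorAlgebra ℝ (O → ℝ)} (ha : a ∈ gr i)
    (hb : b ∈ extGr O j) (h : i + j = k) : (tm a b : Gr P O) ∈ par k :=
  Submodule.subset_span ⟨i, j, h, a, ha, b, hb, rfl⟩

@[elab_as_elim]
lemma par_induction {k : ZMod 2} {motive : ∀ z : Gr P O, z ∈ par k → Prop}
    (zero : motive 0 (zero_mem _))
    (add : ∀ x y hx hy, motive x hx → motive y hy → motive (x + y) (add_mem hx hy))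
    (smul : ∀ (r : ℝ) x hx, motive x hx → motive (r • x) (Submodule.smul_mem _ r hx))
    (tm : ∀ (i j : ZMod 2) (a : P) (b : ExteriorAlgebra ℝ (O → ℝ)) (h : i + j = k) (ha : a ∈ gr i)
      (hb : b ∈ extGr O j), motive (tm a b) (tm_mem_par ha hb h))
    (z : Gr P O) (hz : z ∈ par k) : motive z hz := by
  induction hz using Submodule.span_induction with
  | mem x h => obtain ⟨i, j, h, a, ha, b, hb, rfl⟩ := h; exact tm i j a b h ha hb
  | zero => exact zero
  | add x y hx hy h1 h2 => exact add x y hx hy h1 h2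
  | smul r x hx h => exact smul r x hx h

lemma one_mem_par : (1 : Gr P O) ∈ par 0 :=
  tm_mem_par (i := 0) (j := 0) (SetLike.one_mem_graded _) (SetLike.one_mem_graded _) (add_zero _)

lemma algebraMap_mem_par (r : ℝ) : algebraMap ℝ (Gr P O) r ∈ par 0 := by
  rw [Algebra.algebraMap_eq_smul_one]
  exact Submodule.smul_mem _ _ one_mem_par

lemma mul_mem_par {i j k : ZMod 2} {x y : Gr P O} (hx : x ∈ par i) (hy : y ∈ par j)
    (h : i + j = k) : x * y ∈ par k := by
  subst h
  induction x, hx using par_induction with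
  | zero => rw [zero_mul]; exact zero_mem _
  | add x x' _ _ h1 h2 => rw [add_mul]; exact add_mem h1 h2
  | smul r x _ h => rw [smul_mul_assoc]; exact Submodule.smul_mem _ _ h
  | tm i₁ i₂ a b hi ha hb =>
    induction y, hy using par_induction with
    | zero => rw [mul_zero]; exact zero_mem _
    | add x x' _ _ h1 h2 => rw [mul_add]; exact add_mem h1 h2
    | smul r x _ h => rw [mul_smul_comm]; exact Submodule.smul_mem _ _ h
    | tm j₁ j₂ c d hj hc hd =>
      rw [tm_mul_tm a hb hc d]
      refine Submodule.smul_mem _ _ (tm_mem_par (SetLike.mul_mem_graded ha hc)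
        (SetLike.mul_mem_graded hb hd) ?_)
      rw [← hi, ← hj]; abel

lemma supercomm {i j : ZMod 2} {x y : Gr P O} (hx : x ∈ par i) (hy : y ∈ par j) :
    x * y = sgn (i * j) • (y * x) := by
  induction x, hx using par_induction with
  | zero => simp
  | add x x' _ _ h1 h2 => rw [add_mul, mul_add, h1, h2, smul_add]
  | smul r x _ h => rw [smul_mul_assoc, mul_smul_comm, h, smul_comm]
  | tm i₁ i₂ a b hi ha hb =>
    induction y, hy using par_induction with
    | zero => simp
    | add x x' _ _ h1 h2 => rw [add_mul, mul_add, h1, h2, smul_add]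
    | smul r x _ h => rw [smul_mul_assoc, mul_smul_comm, h, smul_comm]
    | tm j₁ j₂ c d hj hc hd =>
      rw [tm_mul_tm a hb hc d, tm_mul_tm c hd ha b, SmallSuperalgebra.supercomm _ _ _ _ ha hc,
        extGr_supercomm hb hd, smul_tm, tm_smul, smul_smul, smul_smul, smul_smul,
        ← sgn_add, ← sgn_add, ← sgn_add]
      subst hi hj
      congr 2
      have : ∀ i₁ i₂ j₁ j₂ : ZMod 2,
        i₂ * j₁ + i₁ * j₁ + i₂ * j₂ = (i₁ + i₂) * (j₁ + j₂) + j₂ * i₁ := by decide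
      exact this _ _ _ _

lemma even_commute {x : Gr P O} (hx : x ∈ par 0) (y : Gr P O) : Commute x y := by
  induction y using induction_tm with
  | zero => exact Commute.zero_right _
  | add y z hy hz => exact hy.add_right hz
  | tm i j a b ha hb =>
    have := supercomm hx (tm_mem_par ha hb rfl)
    rwa [zero_mul, sgn_zero, one_smul] at this

lemma odd_sq {x : Gr P O} (hx : x ∈ par 1) : x * x = 0 := by
  have h := supercomm hx hx
  rw [mul_one, sgn_one, neg_one_smul] at h
  have : (2 : ℝ) • (x * x) = 0 := by rw [two_smul]; nth_rewrite 1 [h]; simp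
  exact (smul_eq_zero.mp this).resolve_left two_ne_zero

/-! #### Nilpotency of the even elements without body -/

@[simp] lemma body_tm (a : P) (b : ExteriorAlgebra ℝ (O → ℝ)) :
    body (tm a b : Gr P O) = SmallSuperalgebra.body a * ExteriorAlgebra.algebraMapInv b := by
  simp [body]

@[simp] lemma body_one : body (1 : Gr P O) = 1 := by
  change body (tm 1 1 : Gr P O) = 1
  rw [body_tm, map_one, map_one, one_mul]

@[simp] lemma body_algebraMap (r : ℝ) : body (algebraMap ℝ (Gr P O) r) = r := by
  rw [Algebra.algebraMap_eq_smul_one, map_smul, body_one, smul_eq_mul, mul_one]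

instance instNontrivial : Nontrivial (Gr P O) :=
  ⟨⟨1, 0, fun h => by simpa using congrArg body h⟩⟩

/-- An odd element has square zero, and `ℝ` has no nilpotents. -/
lemma body_odd_left {a : P} (ha : a ∈ gr (P := P) 1) : SmallSuperalgebra.body a = 0 := by
  have h := SmallSuperalgebra.supercomm _ _ _ _ ha ha
  rw [mul_one, sgn_one, neg_one_smul] at h
  have h2 : a * a = 0 := by
    have : (2 : ℝ) • (a * a) = 0 := by rw [two_smul]; nth_rewrite 1 [h]; simp
    exact (smul_eq_zero.mp this).resolve_left two_ne_zero
  have := congrArg (SmallSuperalgebra.body (P := P)) h2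
  rw [map_mul, map_zero] at this
  exact mul_self_eq_zero.mp this

lemma isNilpotent_sub_body_left (a : P) :
    IsNilpotent (a - algebraMap ℝ P (SmallSuperalgebra.body a)) := by
  obtain ⟨N, hN⟩ := SmallSuperalgebra.nilpotent (P := P)
  refine ⟨N, ?_⟩
  rw [← List.prod_replicate]
  refine hN _ (by simp) fun c hc => ?_
  rw [List.eq_of_mem_replicate hc]
  simp

/-- Even elements are generated from scalars by sums and by multiplication with pairs of vectors. A
product of two vectors commutes with even elements and has square zero, and commuting nilpotents may
be added. -/
lemma isNilpotent_sub_body_right {b : ExteriorAlgebra ℝ (O → ℝ)} (hb : b ∈ extGr O 0) :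
    IsNilpotent (b - algebraMap ℝ _ (ExteriorAlgebra.algebraMapInv b)) := by
  induction b, hb using CliffordAlgebra.even_induction with
  | algebraMap r =>
    have : ExteriorAlgebra.algebraMapInv (algebraMap ℝ (ExteriorAlgebra ℝ (O → ℝ)) r) = r := by simp
    change IsNilpotent (algebraMap ℝ (ExteriorAlgebra ℝ (O → ℝ)) r - algebraMap ℝ _
      (ExteriorAlgebra.algebraMapInv (algebraMap ℝ (ExteriorAlgebra ℝ (O → ℝ)) r)))
    rw [this, sub_self]
    exact IsNilpotent.zero
  | add x y hx hy h1 h2 =>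
    rw [map_add, map_add, add_sub_add_comm]
    refine Commute.isNilpotent_add ?_ h1 h2
    have hxy : Commute x y := by
      have := extGr_supercomm hx hy
      rwa [zero_mul, sgn_zero, one_smul] at this
    refine Commute.sub_left (Commute.sub_right hxy ?_) (Commute.sub_right ?_ ?_)
    · exact (Algebra.commutes _ _).symm
    · exact Algebra.commutes _ _
    · exact Algebra.commutes _ _
  | ι_mul_ι_mul m₁ m₂ x hx ih =>
    have hz : ∀ m : O → ℝ, ExteriorAlgebra.algebraMapInv
        (CliffordAlgebra.ι (0 : QuadraticForm ℝ (O → ℝ)) m) = (0 : ℝ) := fun m => by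
      have := ExteriorAlgebra.lift_ι_apply ℝ (A := ℝ) (0 : (O → ℝ) →ₗ[ℝ] ℝ) (by simp) m
      exact this
    rw [map_mul, map_mul ExteriorAlgebra.algebraMapInv, hz, zero_mul, zero_mul, map_zero, sub_zero]
    have hc : Commute (CliffordAlgebra.ι (0 : QuadraticForm ℝ (O → ℝ)) m₁ *
        CliffordAlgebra.ι 0 m₂) x := by
      have := extGr_supercomm (CliffordAlgebra.ι_mul_ι_mem_evenOdd_zero 0 m₁ m₂) hx
      rwa [zero_mul, sgn_zero, one_smul] at this
    refine hc.isNilpotent_mul_right ⟨2, ?_⟩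
    have h := extGr_supercomm (CliffordAlgebra.ι_mem_evenOdd_one (0 : QuadraticForm ℝ (O → ℝ)) m₂)
      (CliffordAlgebra.ι_mem_evenOdd_one 0 m₁)
    have h1 : CliffordAlgebra.ι (0 : QuadraticForm ℝ (O → ℝ)) m₁ * CliffordAlgebra.ι 0 m₁ = 0 := by
      simp
    rw [pow_two, mul_assoc, ← mul_assoc (CliffordAlgebra.ι _ m₂), h, smul_mul_assoc, mul_smul_comm,
      mul_assoc, ← mul_assoc (CliffordAlgebra.ι _ m₁), h1, zero_mul, smul_zero]

end Gr

/-! ### Products of commuting nilpotent elements -/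

section Nilpotent

variable {A : Type*} [Ring A] [Algebra ℝ A] [Module.Finite ℝ A]

/-- Each further central nilpotent factor strictly shrinks the right ideal generated by the product,
so the dimension drops at least by one as long as the product is nonzero. This yields the explicit
bound on the order of Taylor terms that `pull` is built on. -/
lemma finrank_range_mulLeft_add_length (l : List A)
    (hl : ∀ d ∈ l, (∀ y, Commute d y) ∧ IsNilpotent d) (h : l.prod ≠ 0) :
    Module.finrank ℝ (LinearMap.range (LinearMap.mulLeft ℝ l.prod)) + l.length ≤
      Module.finrank ℝ A := by
  induction l with
  | nil => exact Submodule.finrank_le _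
  | cons d l ih =>
    obtain ⟨hd, n, hn⟩ := hl d (by simp)
    rw [List.prod_cons] at h ⊢
    have hp : l.prod ≠ 0 := fun h0 => h (by rw [h0, mul_zero])
    have ih := ih (fun c hc => hl c (by simp [hc])) hp
    have hlt : LinearMap.range (LinearMap.mulLeft ℝ (d * l.prod)) <
        LinearMap.range (LinearMap.mulLeft ℝ l.prod) := by
      refine lt_of_le_of_ne ?_ fun heq => hp ?_
      · rintro _ ⟨a, rfl⟩
        exact ⟨d * a, by simp only [LinearMap.mulLeft_apply]; rw [← mul_assoc, (hd l.prod).eq]⟩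
      -- If the ideal did not shrink, then `p = d p a` for some `a`; iterating gives `p = d ^ k * p
      -- * a ^ k`, which vanishes for large `k`.
      · obtain ⟨a, ha⟩ : l.prod ∈ LinearMap.range (LinearMap.mulLeft ℝ (d * l.prod)) :=
          heq ▸ ⟨1, by simp⟩
        rw [LinearMap.mulLeft_apply] at ha
        have : ∀ k : ℕ, l.prod = d ^ k * l.prod * a ^ k := by
          intro k
          induction k with
          | zero => simp
          | succ k ih =>
            calc l.prod = d ^ k * l.prod * a ^ k := ih
              _ = d ^ k * (d * l.prod * a) * a ^ k := by rw [ha]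
              _ = _ := by rw [pow_succ d, pow_succ' a]; simp only [mul_assoc]
        rw [this n, hn, zero_mul, zero_mul]
    have := Submodule.finrank_lt_finrank_of_lt hlt
    rw [List.length_cons]
    omega

lemma prod_eq_zero_of_finrank_le_length (l : List A)
    (hl : ∀ d ∈ l, (∀ y, Commute d y) ∧ IsNilpotent d) (h : Module.finrank ℝ A ≤ l.length) :
    l.prod = 0 := by
  by_contra hp
  have h1 := finrank_range_mulLeft_add_length l hl hp
  have h2 : LinearMap.range (LinearMap.mulLeft ℝ l.prod) = ⊥ :=
    Submodule.finrank_eq_zero.mp (by omega)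
  exact hp (by simpa using LinearMap.congr_fun (LinearMap.range_eq_bot.mp h2) 1)

end Nilpotent

/-! ### Nilpotency of the bodyless even part, odd derivatives and substitution -/

namespace Gr

variable {P : Type*} [Ring P] [Algebra ℝ P] [SmallSuperalgebra P] {O O' : Type*}

open PSuper.SmallSuperalgebra (gr)

lemma tm_one_mul_one_tm (a : P) (b : ExteriorAlgebra ℝ (O → ℝ)) :
    (tm a 1 * tm 1 b : Gr P O) = tm a b :=
  GradedTensorProduct.tmul_one_mul_one_tmul _ _ a b

/-- An even pure tensor is either even ⊗ even or odd ⊗ odd. The first kind is treated by `ab - a₀b₀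
= (a - a₀) b + a₀ (b - b₀)`, a sum of commuting nilpotents. The second kind has no body, and its
square vanishes because `a * a = 0`. -/
lemma isNilpotent_sub_body {z : Gr P O} (hz : z ∈ par 0) :
    IsNilpotent (z - algebraMap ℝ (Gr P O) (body z)) := by
  induction z, hz using par_induction with
  | zero => simp
  | add x y hx hy h1 h2 =>
    rw [map_add, map_add, add_sub_add_comm]
    exact Commute.isNilpotent_add
      (even_commute (sub_mem hx (algebraMap_mem_par _)) _) h1 h2
  | smul r x hx h =>
    rw [map_smul, smul_eq_mul, map_mul, ← Algebra.smul_def, ← smul_sub]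
    exact h.smul r
  | tm i j a b hij ha hb =>
    rw [body_tm]
    obtain rfl | rfl := parity_cases i
    · rw [zero_add] at hij
      subst hij
      have hL := (isNilpotent_sub_body_left a).map
        (GradedTensorProduct.includeLeft (gr (P := P)) (extGr O))
      have hR := (isNilpotent_sub_body_right hb).map
        (GradedTensorProduct.includeRight (gr (P := P)) (extGr O))
      rw [map_sub, AlgHom.commutes] at hL hR
      have hLe : (GradedTensorProduct.includeLeft (gr (P := P)) (extGr O)) a -
          algebraMap ℝ (Gr P O) (SmallSuperalgebra.body a) ∈ par 0 :=
        sub_mem (tm_mem_par ha (SetLike.one_mem_graded _) (add_zero 0)) (algebraMap_mem_par _)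
      have key : (tm a b : Gr P O) - algebraMap ℝ (Gr P O)
            (SmallSuperalgebra.body a * ExteriorAlgebra.algebraMapInv b) =
          ((GradedTensorProduct.includeLeft (gr (P := P)) (extGr O)) a -
            algebraMap ℝ (Gr P O) (SmallSuperalgebra.body a)) *
            (GradedTensorProduct.includeRight (gr (P := P)) (extGr O)) b +
          SmallSuperalgebra.body a •
            ((GradedTensorProduct.includeRight (gr (P := P)) (extGr O)) b -
              algebraMap ℝ (Gr P O) (ExteriorAlgebra.algebraMapInv b)) := by
        rw [sub_mul, smul_sub, Algebra.smul_def, Algebra.smul_def, map_mul,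
          ← tm_one_mul_one_tm]
        simp
      rw [key]
      exact Commute.isNilpotent_add
        ((even_commute (Submodule.smul_mem _ _ (sub_mem (tm_mem_par (SetLike.one_mem_graded _) hb
          (add_zero 0)) (algebraMap_mem_par _))) _).symm)
        ((even_commute hLe _).isNilpotent_mul_right hL) (hR.smul _)
    · obtain rfl : j = 1 := by revert hij; clear hb; revert j; decide
      rw [body_odd_left ha, zero_mul, map_zero, sub_zero]
      refine ⟨2, ?_⟩
      have h := SmallSuperalgebra.supercomm _ _ _ _ ha ha
      have h2 : a * a = 0 := by
        rw [mul_one, sgn_one, neg_one_smul] at h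
        have : (2 : ℝ) • (a * a) = 0 := by rw [two_smul]; nth_rewrite 1 [h]; simp
        exact (smul_eq_zero.mp this).resolve_left two_ne_zero
      rw [pow_two, tm_mul_tm a hb ha b, h2, ← zero_smul ℝ (0 : P), smul_tm, zero_smul, smul_zero]

lemma prod_eq_zero [Finite O] (l : List (Gr P O)) (hl : ∀ d ∈ l, d ∈ par 0 ∧ body d = 0)
    (h : Module.finrank ℝ (Gr P O) ≤ l.length) : l.prod = 0 :=
  prod_eq_zero_of_finrank_le_length l (fun d hd => ⟨even_commute (hl d hd).1, by
    simpa [(hl d hd).2] using isNilpotent_sub_body (hl d hd).1⟩) h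

/-! #### Odd derivatives -/

lemma parityInv_apply {i : ZMod 2} {a : P} (ha : a ∈ gr i) : parityInv a = sgn i • a := by
  obtain rfl | rfl := parity_cases i
  · have h1 := DirectSum.decompose_of_mem_ne (gr (P := P)) ha (zero_ne_one)
    have h0 := DirectSum.decompose_of_mem_same (gr (P := P)) ha
    simp [parityInv, GradedAlgebra.proj_apply, h1, h0]
  · have h0 := DirectSum.decompose_of_mem_ne (gr (P := P)) ha (one_ne_zero)
    have h1 := DirectSum.decompose_of_mem_same (gr (P := P)) ha
    simp [parityInv, GradedAlgebra.proj_apply, h1, h0]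

lemma oddDeriv_tm (o : O) {i : ZMod 2} {a : P} (ha : a ∈ gr i)
    (b : ExteriorAlgebra ℝ (O → ℝ)) :
    oddDeriv o (tm a b : Gr P O) = sgn i • tm a (CliffordAlgebra.contractLeft
      (Q := (0 : QuadraticForm ℝ (O → ℝ))) (LinearMap.proj o) b) := by
  rw [← smul_tm, ← parityInv_apply ha]
  rfl

/-- The parity involution on `P` supplies the sign of the `P`-factor and the contraction that of the
exterior factor; together they give the sign of the total parity. -/
lemma oddDeriv_mul (o : O) {k : ZMod 2} {x : Gr P O} (hx : x ∈ par k) (y : Gr P O) :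
    oddDeriv o (x * y) = oddDeriv o x * y + sgn k • (x * oddDeriv o y) := by
  induction x, hx using par_induction with
  | zero => simp
  | add x x' _ _ h1 h2 =>
    rw [add_mul, map_add, h1, h2, map_add, add_mul, add_mul, smul_add]; abel
  | smul r x _ h =>
    rw [smul_mul_assoc, map_smul, h, map_smul, smul_mul_assoc, smul_mul_assoc, smul_add,
      smul_comm r]
  | tm i j a b hij ha hb =>
    induction y using induction_tm with
    | zero => simp
    | add y z h1 h2 =>
      rw [mul_add, map_add, h1, h2, map_add, mul_add, mul_add, smul_add]; abel
    | tm i' j' c d hc hd =>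
      rw [tm_mul_tm a hb hc d, map_smul, oddDeriv_tm o (SetLike.mul_mem_graded ha hc),
        contractLeft_mul _ hb, tm_add, tm_smul, oddDeriv_tm o ha, oddDeriv_tm o hc, mul_smul_comm,
        smul_mul_assoc, tm_mul_tm a (contractLeft_mem _ hb) hc d, tm_mul_tm a hb hc]
      subst hij
      have e1 : sgn (j * i') * sgn (i + i') = sgn i * sgn ((j + 1) * i') := by
        rw [← sgn_add, ← sgn_add]; congr 1; ring
      have e2 : sgn i * sgn ((j + 1) * i') * sgn j = sgn (i + j) * sgn i' * sgn (j * i') := by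
        rw [← sgn_add, ← sgn_add, ← sgn_add, ← sgn_add]; congr 1; ring
      rw [smul_add, smul_add, smul_smul, smul_smul, smul_smul, smul_smul, smul_smul, smul_smul, e1, e2]

lemma oddDeriv_mem (o : O) {k : ZMod 2} {x : Gr P O} (hx : x ∈ par k) :
    oddDeriv o x ∈ par (k + 1) := by
  induction x, hx using par_induction with
  | zero => simp
  | add x y _ _ h1 h2 => rw [map_add]; exact add_mem h1 h2
  | smul r x _ h => rw [map_smul]; exact Submodule.smul_mem _ _ h
  | tm i j a b hij ha hb =>
    rw [oddDeriv_tm o ha]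
    exact Submodule.smul_mem _ _ (tm_mem_par ha (contractLeft_mem _ hb) (by rw [← hij, add_assoc]))

lemma xi_mem [DecidableEq O] (o : O) : (xi o : Gr P O) ∈ par 1 :=
  tm_mem_par (SetLike.one_mem_graded _) (CliffordAlgebra.ι_mem_evenOdd_one _ _) (zero_add 1)

lemma oddDeriv_xi [DecidableEq O] (o o' : O) :
    oddDeriv o (xi o' : Gr P O) = if o' = o then 1 else 0 := by
  change oddDeriv o (tm 1 (CliffordAlgebra.ι (0 : QuadraticForm ℝ (O → ℝ)) (Pi.single o' 1)) :
    Gr P O) = _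
  rw [oddDeriv_tm o (SetLike.one_mem_graded _), CliffordAlgebra.contractLeft_ι,
    Algebra.algebraMap_eq_smul_one, tm_smul]
  rcases eq_or_ne o' o with rfl | h
  · simp; rfl
  · simp [h]

lemma oddDeriv_left (o : O) (a : P) : oddDeriv o (tm a 1 : Gr P O) = 0 := by
  have : oddDeriv o (tm a 1 : Gr P O) = tm (parityInv a) (CliffordAlgebra.contractLeft
      (Q := (0 : QuadraticForm ℝ (O → ℝ))) (LinearMap.proj o) 1) := rfl
  rw [this, CliffordAlgebra.contractLeft_one, ← zero_smul ℝ (0 : ExteriorAlgebra ℝ (O → ℝ)),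
    tm_smul, zero_smul]

lemma oddDeriv_algebraMap (o : O) (r : ℝ) : oddDeriv o (algebraMap ℝ (Gr P O) r) = 0 :=
  oddDeriv_left o (algebraMap ℝ P r)

/-! #### Substitution of odd elements -/

section Subst

variable [Fintype O'] {β : O' → Gr P O} (hβ : ∀ o, β o ∈ par 1)

include hβ in
lemma linearCombination_mem (v : O' → ℝ) : Fintype.linearCombination ℝ β v ∈ par 1 := by
  rw [Fintype.linearCombination_apply]
  exact Submodule.sum_mem _ fun o _ => Submodule.smul_mem _ _ (hβ o)

/-- The algebra homomorphism `⋀ ℝ^{O'} → P ⊠ ⋀ ℝ^O` that maps `ξ^o` to the odd element `β o`. -/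
def extLift : ExteriorAlgebra ℝ (O' → ℝ) →ₐ[ℝ] Gr P O :=
  ExteriorAlgebra.lift ℝ ⟨Fintype.linearCombination ℝ β, fun v =>
    odd_sq (linearCombination_mem hβ v)⟩

lemma extLift_ι (v : O' → ℝ) :
    extLift hβ (CliffordAlgebra.ι (0 : QuadraticForm ℝ (O' → ℝ)) v) =
      Fintype.linearCombination ℝ β v :=
  ExteriorAlgebra.lift_ι_apply ℝ _ _ v

lemma extLift_mem {i : ZMod 2} {b : ExteriorAlgebra ℝ (O' → ℝ)} (hb : b ∈ extGr O' i) :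
    extLift hβ b ∈ par i := by
  induction b, hb using CliffordAlgebra.evenOdd_induction with
  | range_ι_pow v h =>
    obtain rfl | rfl := parity_cases i
    · obtain ⟨r, rfl⟩ := Submodule.mem_one.mp h
      have := (extLift hβ).commutes r
      exact this ▸ algebraMap_mem_par r
    · obtain ⟨w, rfl⟩ := (pow_one (LinearMap.range (CliffordAlgebra.ι
        (0 : QuadraticForm ℝ (O' → ℝ))))) ▸ h
      rw [extLift_ι]
      exact linearCombination_mem hβ w
  | add x y hx hy ihx ihy => rw [map_add]; exact add_mem ihx ihy
  | ι_mul_ι_mul m₁ m₂ x hx ih =>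
    rw [map_mul, map_mul, extLift_ι, extLift_ι]
    exact mul_mem_par (mul_mem_par (linearCombination_mem hβ m₁) (linearCombination_mem hβ m₂)
      (CharTwo.add_self_eq_zero 1)) ih (zero_add i)

/-- Substitution of odd elements as an algebra homomorphism. -/
def substHom : Gr P O' →ₐ[ℝ] Gr P O :=
  GradedTensorProduct.lift (gr (P := P)) (extGr O')
    (GradedTensorProduct.includeLeft (gr (P := P)) (extGr O)) (extLift hβ) fun i j a b => by
      rw [units_pow_smul, mul_comm j i]
      exact supercomm (tm_mem_par a.2 (SetLike.one_mem_graded _) (add_zero i))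
        (extLift_mem hβ b.2)

/-- Linear combinations of odd elements are odd and hence of square zero, so for odd `β` the default
branch `0` in `Gr.subst` does not occur. -/
lemma subst_eq (z : Gr P O') : subst β z = substHom hβ z := by
  rw [subst, dif_pos fun v => odd_sq (linearCombination_mem hβ v)]
  rfl

lemma substHom_tm (a : P) (b : ExteriorAlgebra ℝ (O' → ℝ)) :
    substHom hβ (tm a b) = tm a 1 * extLift hβ b :=
  rfl

lemma substHom_xi [DecidableEq O'] (o : O') : substHom hβ (xi o) = β o := by
  refine (substHom_tm hβ 1 _).trans ?_
  rw [extLift_ι]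
  have : (tm 1 1 : Gr P O) = 1 := rfl
  rw [this, one_mul, Fintype.linearCombination_apply_single, one_smul]

lemma substHom_mem {k : ZMod 2} {z : Gr P O'} (hz : z ∈ par k) : substHom hβ z ∈ par k := by
  induction z, hz using par_induction with
  | zero => simp
  | add x y _ _ h1 h2 => rw [map_add]; exact add_mem h1 h2
  | smul r x _ h => rw [map_smul]; exact Submodule.smul_mem _ _ h
  | tm i j a b hij ha hb =>
    rw [substHom_tm]
    exact mul_mem_par (tm_mem_par ha (SetLike.one_mem_graded _) (add_zero i))
      (extLift_mem hβ hb) hij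

/-- The chain rule for odd derivatives and substitution. -/
lemma oddDeriv_substHom (o : O) (z : Gr P O') :
    oddDeriv o (substHom hβ z) = ∑ o', oddDeriv o (β o') * substHom hβ (oddDeriv o' z) := by
  have heven : ∀ o', oddDeriv o (β o') ∈ par 0 := fun o' =>
    (CharTwo.add_self_eq_zero (1 : ZMod 2)) ▸ oddDeriv_mem o (hβ o')
  -- The rule is first shown on the exterior factor, word by word. The coefficients `oddDeriv o (β
  -- o')` are even, so they move freely past the other factors.
  have key : ∀ b : ExteriorAlgebra ℝ (O' → ℝ), oddDeriv o (extLift hβ b) =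
      ∑ o', oddDeriv o (β o') * extLift hβ (CliffordAlgebra.contractLeft
        (Q := (0 : QuadraticForm ℝ (O' → ℝ))) (LinearMap.proj o') b) := by
    intro b
    induction b using CliffordAlgebra.left_induction with
    | algebraMap r =>
      simp only [CliffordAlgebra.contractLeft_algebraMap, map_zero, mul_zero,
        Finset.sum_const_zero]
      exact (congrArg _ ((extLift hβ).commutes r)).trans (oddDeriv_algebraMap o r)
    | add x y hx hy => simp only [map_add, mul_add, Finset.sum_add_distrib, hx, hy]
    | ι_mul x m h =>
      rw [map_mul, extLift_ι, oddDeriv_mul o (linearCombination_mem hβ m), h,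
        Fintype.linearCombination_apply, map_sum, Finset.sum_mul, Finset.mul_sum, Finset.smul_sum,
        ← Finset.sum_add_distrib]
      refine Finset.sum_congr rfl fun o' _ => ?_
      rw [CliffordAlgebra.contractLeft_ι_mul, map_sub, map_mul, map_smul, map_smul, extLift_ι,
        Fintype.linearCombination_apply, mul_sub, mul_smul_comm, ← mul_assoc, ← mul_assoc,
        (even_commute (heven o') (∑ i, m i • β i)).eq, sgn_one, neg_one_smul, sub_eq_add_neg,
        smul_mul_assoc]
      rfl
  induction z using induction_tm with
  | zero => simp
  | add x y hx hy => simp only [map_add, mul_add, Finset.sum_add_distrib, hx, hy]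
  | tm i j a b ha hb =>
    have haL : (tm a 1 : Gr P O) ∈ par i :=
      tm_mem_par ha (SetLike.one_mem_graded _) (add_zero i)
    rw [substHom_tm, oddDeriv_mul o haL, oddDeriv_left, zero_mul, zero_add, key, Finset.mul_sum,
      Finset.smul_sum]
    refine Finset.sum_congr rfl fun o' _ => ?_
    rw [oddDeriv_tm o' ha, map_smul, substHom_tm, mul_smul_comm, ← mul_assoc, ← mul_assoc,
      (even_commute (heven o') _).eq]

end Subst

end Gr

/-! ### Calculus with values in `P ⊠ ⋀ ℝ^O` -/

section Calculus

variable {P : Type*} [Ring P] [Algebra ℝ P] [SmallSuperalgebra P] {O : Type*} [Finite O]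

/-- Multiplication as a continuous bilinear map. -/
def Gr.mulL : Gr P O →L[ℝ] Gr P O →L[ℝ] Gr P O :=
  LinearMap.toContinuousLinearMap
    ((LinearMap.toContinuousLinearMap (𝕜 := ℝ) (E := Gr P O) (F' := Gr P O)).toLinearMap ∘ₗ
      LinearMap.mul ℝ (Gr P O))

lemma Gr.mulL_apply (x y : Gr P O) : Gr.mulL x y = x * y := rfl

variable {X : Type*} [NormedAddCommGroup X] [NormedSpace ℝ X]

/-- The norm comes from a basis and need not be submultiplicative; the product rule therefore goes
through the continuous bilinear map `Gr.mulL`. -/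
lemma HasFDerivAt.gr_mul {f g : X → Gr P O} {f' g' : X →L[ℝ] Gr P O} {x : X}
    (hf : HasFDerivAt f f' x) (hg : HasFDerivAt g g' x) :
    HasFDerivAt (fun y => f y * g y)
      (Gr.mulL.precompR X (f x) g' + Gr.mulL.precompL X f' (g x)) x :=
  Gr.mulL.hasFDerivAt_of_bilinear hf hg

lemma fderiv_gr_mul {f g : X → Gr P O} {x : X} (hf : DifferentiableAt ℝ f x)
    (hg : DifferentiableAt ℝ g x) (v : X) :
    fderiv ℝ (fun y => f y * g y) x v = fderiv ℝ f x v * g x + f x * fderiv ℝ g x v := by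
  rw [(HasFDerivAt.gr_mul hf.hasFDerivAt hg.hasFDerivAt).fderiv, add_comm]
  rfl

lemma HasDerivAt.gr_mul {f g : ℝ → Gr P O} {f' g' : Gr P O} {t : ℝ}
    (hf : HasDerivAt f f' t) (hg : HasDerivAt g g' t) :
    HasDerivAt (fun s => f s * g s) (f' * g t + f t * g') t := by
  have := (HasFDerivAt.gr_mul hf.hasFDerivAt hg.hasFDerivAt).hasDerivAt
  rw [add_comm] at this
  simpa [Gr.mulL_apply] using this

lemma ContDiffOn.gr_mul {f g : X → Gr P O} {U : Set X} {n : WithTop ℕ∞}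
    (hf : ContDiffOn ℝ n f U) (hg : ContDiffOn ℝ n g U) :
    ContDiffOn ℝ n (fun y => f y * g y) U :=
  (ContDiffOn.clm_apply (contDiff_const (c := Gr.mulL).contDiffOn.clm_apply hf) hg).congr
    fun _ _ => (Gr.mulL_apply _ _).symm

lemma contDiff_linear {O' : Type*} [Finite O'] (L : Gr P O →ₗ[ℝ] Gr P O') {n : WithTop ℕ∞} :
    ContDiff ℝ n L :=
  (LinearMap.toContinuousLinearMap L).contDiff

lemma fderiv_linear_comp {O' : Type*} [Finite O'] (L : Gr P O →ₗ[ℝ] Gr P O') {f : X → Gr P O}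
    {x : X} (hf : DifferentiableAt ℝ f x) (v : X) :
    fderiv ℝ (fun y => L (f y)) x v = L (fderiv ℝ f x v) := by
  have := (LinearMap.toContinuousLinearMap L).hasFDerivAt.comp x hf.hasFDerivAt
  exact congrArg (· v) this.fderiv

open Filter Topology in
/-- A derivative of a function with values in a subspace lies in that subspace. -/
lemma fderiv_mem {F : Type*} [NormedAddCommGroup F] [NormedSpace ℝ F] [FiniteDimensional ℝ F]
    (p : Submodule ℝ F) {f : X → F} {x : X} (hf : ∀ᶠ y in 𝓝 x, f y ∈ p) (v : X) :
    fderiv ℝ f x v ∈ p := by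
  by_cases hd : DifferentiableAt ℝ f x
  -- The subspace is the common kernel of its annihilating functionals, and each of these is
  -- constantly zero along `f` near `x`.
  · rw [← Subspace.forall_mem_dualAnnihilator_apply_eq_zero_iff]
    intro φ hφ
    have h1 := (LinearMap.toContinuousLinearMap φ).hasFDerivAt.comp x hd.hasFDerivAt
    have h2 : (LinearMap.toContinuousLinearMap φ) ∘ f =ᶠ[𝓝 x] fun _ => (0 : ℝ) :=
      hf.mono fun y hy => (Submodule.mem_dualAnnihilator φ).mp hφ _ hy
    have h3 := (h2.hasFDerivAt_iff.mp h1).unique (hasFDerivAt_const (0 : ℝ) x)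
    exact congrArg (· v) h3
  · rw [fderiv_zero_of_not_differentiableAt hd]
    exact zero_mem p

end Calculus

/-! ### Superfunctions on open sets -/

section Superfunctions

open Filter Topology

variable {P : Type*} [Ring P] [Algebra ℝ P] [SmallSuperalgebra P]
variable {E O : Type*} [Fintype E] [Fintype O]
variable {U : Set (E → ℝ)} {f g : SFun P E O} {x : E → ℝ} {k l : ZMod 2}

lemma ContDiffOn.differentiableAt_of_isOpen (hf : ContDiffOn ℝ ∞ f U) (hU : IsOpen U)
    (hx : x ∈ U) : DifferentiableAt ℝ f x :=
  (hf.contDiffAt (hU.mem_nhds hx)).differentiableAt (by simp)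

lemma IsSFunOn.differentiableAt (hf : IsSFunOn U k f) (hU : IsOpen U) (hx : x ∈ U) :
    DifferentiableAt ℝ f x :=
  ContDiffOn.differentiableAt_of_isOpen hf.1 hU hx

lemma IsSFunOn.mul (hf : IsSFunOn U k f) (hg : IsSFunOn U l g) : IsSFunOn U (k + l) (f * g) :=
  ⟨ContDiffOn.gr_mul hf.1 hg.1, fun x hx => Gr.mul_mem_par (hf.2 x hx) (hg.2 x hx) rfl⟩

lemma IsSFunOn.sub (hf : IsSFunOn U k f) (hg : IsSFunOn U k g) : IsSFunOn U k (f - g) :=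
  ⟨hf.1.sub hg.1, fun x hx => sub_mem (hf.2 x hx) (hg.2 x hx)⟩

lemma IsSFunOn.smul (r : ℝ) (hf : IsSFunOn U k f) : IsSFunOn U k (r • f) :=
  ⟨contDiffOn_const.smul hf.1, fun x hx => Submodule.smul_mem _ r (hf.2 x hx)⟩

lemma IsSFunOn.sum {ι : Type*} {s : Finset ι} {F : ι → SFun P E O}
    (hF : ∀ i ∈ s, IsSFunOn U k (F i)) : IsSFunOn U k (∑ i ∈ s, F i) := by
  refine ⟨?_, fun x hx => ?_⟩
  · have := ContDiffOn.sum fun i hi => (hF i hi).1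
    convert this using 1
    ext x
    simp
  · rw [Finset.sum_apply]
    exact Submodule.sum_mem _ fun i hi => (hF i hi).2 x hx

lemma IsSFunOn.of_eq (hf : IsSFunOn U k f) (h : k = l) : IsSFunOn U l f := h ▸ hf

lemma IsSFunOn.congr (hf : IsSFunOn U k f) (h : ∀ x ∈ U, g x = f x) : IsSFunOn U k g :=
  ⟨hf.1.congr h, fun x hx => h x hx ▸ hf.2 x hx⟩

variable [DecidableEq E]

lemma pd_inl (e : E) (f : SFun P E O) (x : E → ℝ) :
    pd (.inl e) f x = fderiv ℝ f x (Pi.single e 1) := rfl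

lemma pd_inr (o : O) (f : SFun P E O) (x : E → ℝ) :
    pd (.inr o) f x = Gr.oddDeriv o (f x) := rfl

lemma contDiffOn_pd (i : E ⊕ O) (hf : ContDiffOn ℝ ∞ f U) (hU : IsOpen U) :
    ContDiffOn ℝ ∞ (pd i f) U := by
  cases i with
  | inl e => exact (hf.fderiv_of_isOpen hU (by simp)).clm_apply contDiffOn_const
  | inr o => exact (contDiff_linear (Gr.oddDeriv o)).comp_contDiffOn hf

lemma IsSFunOn.pd (hf : IsSFunOn U k f) (hU : IsOpen U) (i : E ⊕ O) :
    IsSFunOn U (par i + k) (PSuper.pd i f) := by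
  refine ⟨contDiffOn_pd i hf.1 hU, fun x hx => ?_⟩
  cases i with
  | inl e =>
    simp only [par, Sum.elim_inl, zero_add]
    exact fderiv_mem _ (eventually_of_mem (hU.mem_nhds hx) hf.2) _
  | inr o =>
    simp only [par, Sum.elim_inr]
    rw [add_comm]
    exact Gr.oddDeriv_mem o (hf.2 x hx)

lemma pd_congr (i : E ⊕ O) (h : f =ᶠ[𝓝 x] g) : pd i f x = pd i g x := by
  cases i with
  | inl e => rw [pd_inl, pd_inl, h.fderiv_eq]
  | inr o => rw [pd_inr, pd_inr, h.eq_of_nhds]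

lemma pd_congr_of_isOpen (i : E ⊕ O) (hU : IsOpen U) (h : ∀ y ∈ U, f y = g y) (hx : x ∈ U) :
    pd i f x = pd i g x :=
  pd_congr i (eventually_of_mem (hU.mem_nhds hx) h)

lemma pd_add (i : E ⊕ O) (hf : DifferentiableAt ℝ f x) (hg : DifferentiableAt ℝ g x) :
    pd i (f + g) x = pd i f x + pd i g x := by
  cases i with
  | inl e => rw [pd_inl, fderiv_add hf hg]; rfl
  | inr o => exact map_add _ _ _

lemma pd_sub (i : E ⊕ O) (hf : DifferentiableAt ℝ f x) (hg : DifferentiableAt ℝ g x) :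
    pd i (f - g) x = pd i f x - pd i g x := by
  cases i with
  | inl e => rw [pd_inl, fderiv_sub hf hg]; rfl
  | inr o => exact map_sub _ _ _

lemma pd_smul (i : E ⊕ O) (r : ℝ) (hf : DifferentiableAt ℝ f x) :
    pd i (r • f) x = r • pd i f x := by
  cases i with
  | inl e => rw [pd_inl, fderiv_const_smul hf r]; rfl
  | inr o => exact map_smul (Gr.oddDeriv o) _ _

lemma pd_sum (i : E ⊕ O) {ι : Type*} {s : Finset ι} {F : ι → SFun P E O}
    (hF : ∀ j ∈ s, DifferentiableAt ℝ (F j) x) :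
    pd i (∑ j ∈ s, F j) x = ∑ j ∈ s, pd i (F j) x := by
  cases i with
  | inl e =>
    rw [pd_inl, fderiv_sum hF, sum_apply]
    rfl
  | inr o =>
    change Gr.oddDeriv o ((∑ j ∈ s, F j) x) = _
    rw [Finset.sum_apply, map_sum]
    rfl

/-- The super Leibniz rule. -/
lemma IsSFunOn.pd_mul (hU : IsOpen U) (hx : x ∈ U) (hf : IsSFunOn U k f)
    (hg : DifferentiableAt ℝ g x) (i : E ⊕ O) :
    PSuper.pd i (f * g) x =
      PSuper.pd i f x * g x + sgn (par i * k) • (f x * PSuper.pd i g x) := by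
  cases i with
  | inl e =>
    simp only [par, Sum.elim_inl, zero_mul, sgn_zero, one_smul]
    exact fderiv_gr_mul (hf.differentiableAt hU hx) hg _
  | inr o =>
    simp only [par, Sum.elim_inr, one_mul]
    exact Gr.oddDeriv_mul o (hf.2 x hx) _

lemma isSFunOn_coord [DecidableEq O] (U : Set (E → ℝ)) (i : E ⊕ O) :
    IsSFunOn U (par i) (coord (P := P) i) := by
  cases i with
  | inl e =>
    refine ⟨ContDiff.contDiffOn ?_, fun x _ => Gr.algebraMap_mem_par _⟩
    have : (coord (P := P) (O := O) (.inl e) : SFun P E O) = fun x => x e • (1 : Gr P O) := by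
      ext x; exact Algebra.algebraMap_eq_smul_one _
    rw [this]
    have h1 : ContDiff ℝ ∞ (fun x : E → ℝ => x e) := contDiff_apply ℝ ℝ e
    exact h1.smul (contDiff_const (c := (1 : Gr P O)))
  | inr o => exact ⟨contDiffOn_const, fun x _ => Gr.xi_mem o⟩

lemma pd_coord [DecidableEq O] (i j : E ⊕ O) (x : E → ℝ) :
    pd i (coord (P := P) j) x = if j = i then 1 else 0 := by
  cases i with
  | inl e =>
    cases j with
    | inl e' =>
      have h : (coord (P := P) (O := O) (.inl e') : SFun P E O) =
          fun x => x e' • (1 : Gr P O) := by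
        ext x; exact Algebra.algebraMap_eq_smul_one _
      have hd := ((ContinuousLinearMap.proj (R := ℝ) (φ := fun _ : E => ℝ) e').hasFDerivAt
        (x := x)).smul_const (1 : Gr P O)
      have hd' : fderiv ℝ (fun x : E → ℝ => x e' • (1 : Gr P O)) x = _ := hd.fderiv
      rw [h, pd_inl, hd']
      by_cases he : e' = e
      · subst he; simp
      · simp [he]
    | inr o =>
      have h : (coord (P := P) (E := E) (.inr o) : SFun P E O) = fun _ => Gr.xi o := rfl
      rw [h, pd_inl, fderiv_const_apply]
      simp
  | inr o =>
    cases j with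
    | inl e => exact (Gr.oddDeriv_algebraMap o _).trans (by simp)
    | inr o' =>
      refine (Gr.oddDeriv_xi o o').trans ?_
      simp

/-- Partial derivatives in even directions commute with all partial derivatives. -/
lemma pd_inl_comm (hU : IsOpen U) (hf : ContDiffOn ℝ ∞ f U) (hx : x ∈ U) (e : E) (i : E ⊕ O) :
    pd (.inl e) (pd i f) x = pd i (pd (.inl e) f) x := by
  have hd : DifferentiableAt ℝ (fderiv ℝ f) x :=
    ((hf.fderiv_of_isOpen hU (m := ∞) (by simp)).contDiffAt (hU.mem_nhds hx)).differentiableAt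
      (by simp)
  cases i with
  | inl e' =>
    have hs : IsSymmSndFDerivAt ℝ f x :=
      (hf.contDiffAt (hU.mem_nhds hx)).isSymmSndFDerivAt
        (by simpa using WithTop.coe_le_coe.mpr (le_top : (2 : ℕ∞) ≤ ⊤))
    have h : ∀ v w : E → ℝ, fderiv ℝ (fun y => fderiv ℝ f y v) x w = fderiv ℝ (fderiv ℝ f) x w v :=
      fun v w => by
        have := (ContinuousLinearMap.apply ℝ (Gr P O) v).hasFDerivAt.comp x hd.hasFDerivAt
        exact congrArg (· w) this.fderiv
    exact (h _ _).trans ((hs.eq _ _).trans (h _ _).symm)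
  | inr o =>
    exact fderiv_linear_comp _ (ContDiffOn.differentiableAt_of_isOpen hf hU hx) _

end Superfunctions

/-! ### Taylor expansion in nilpotent directions -/

section Taylor

variable {P : Type*} [Ring P] [Algebra ℝ P] [SmallSuperalgebra P]
variable {E O O' : Type*} [Fintype E] [DecidableEq E] [Fintype O] [Fintype O']

/-- The term of order `k` of the Taylor expansion of `f` at `y` with increment `δ`, with values
mapped by `S`, without the factor `1/k!`. -/
def taylorTerm (δ : E → Gr P O) (S : Gr P O' →ₗ[ℝ] Gr P O) :
    ℕ → SFun P E O' → (E → ℝ) → Gr P O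
  | 0, f, y => S (f y)
  | k + 1, f, y => ∑ e, δ e * taylorTerm δ S k (pd (.inl e) f) y

variable {δ : E → Gr P O} {S : Gr P O' →ₗ[ℝ] Gr P O} {U : Set (E → ℝ)} {f g : SFun P E O'}
  {y : E → ℝ}

lemma taylorTerm_congr (hU : IsOpen U) (h : ∀ z ∈ U, f z = g z) (hy : y ∈ U) (k : ℕ) :
    taylorTerm δ S k f y = taylorTerm δ S k g y := by
  induction k generalizing f g with
  | zero => exact congrArg S (h y hy)
  | succ k ih =>
    exact Finset.sum_congr rfl fun e _ => congrArg _ <|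
      ih fun z hz => pd_congr_of_isOpen _ hU h hz

lemma taylorTerm_add (hU : IsOpen U) (hf : ContDiffOn ℝ ∞ f U) (hg : ContDiffOn ℝ ∞ g U)
    (hy : y ∈ U) (k : ℕ) :
    taylorTerm δ S k (f + g) y = taylorTerm δ S k f y + taylorTerm δ S k g y := by
  induction k generalizing f g with
  | zero => exact map_add _ _ _
  | succ k ih =>
    simp only [taylorTerm]
    rw [← Finset.sum_add_distrib]
    refine Finset.sum_congr rfl fun e _ => ?_
    rw [← mul_add, ← ih (contDiffOn_pd _ hf hU) (contDiffOn_pd _ hg hU)]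
    exact congrArg _ (taylorTerm_congr hU (fun z hz => pd_add _
      (ContDiffOn.differentiableAt_of_isOpen hf hU hz)
      (ContDiffOn.differentiableAt_of_isOpen hg hU hz)) hy k)

lemma taylorTerm_smul (hU : IsOpen U) (hf : ContDiffOn ℝ ∞ f U) (hy : y ∈ U) (r : ℝ) (k : ℕ) :
    taylorTerm δ S k (r • f) y = r • taylorTerm δ S k f y := by
  induction k generalizing f with
  | zero => exact map_smul S _ _
  | succ k ih =>
    simp only [taylorTerm]
    rw [Finset.smul_sum]
    refine Finset.sum_congr rfl fun e _ => ?_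
    rw [← mul_smul_comm, ← ih (contDiffOn_pd _ hf hU)]
    exact congrArg _ (taylorTerm_congr hU (fun z hz => pd_smul _ r
      (ContDiffOn.differentiableAt_of_isOpen hf hU hz)) hy k)

lemma taylorTerm_zero (k : ℕ) : taylorTerm δ S k (0 : SFun P E O') y = 0 := by
  simpa using taylorTerm_smul (δ := δ) (S := S) (y := y) (f := (0 : SFun P E O')) isOpen_univ
    contDiffOn_const (Set.mem_univ y) 0 k

lemma taylorTerm_const (c : Gr P O') (k : ℕ) :
    taylorTerm δ S (k + 1) (fun _ => c) y = 0 := by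
  refine Finset.sum_eq_zero fun e _ => ?_
  have : pd (.inl e) (fun _ => c : SFun P E O') = 0 := by
    ext y : 1
    rw [pd_inl, fderiv_const_apply]
    rfl
  rw [this, taylorTerm_zero, mul_zero]

/-- The recursion of `taylorTerm` agrees with the sum over multi-indices in `pull`. It is the form
suited to inductions over the order. -/
lemma taylorTerm_eq_sum (hδ : ∀ e, δ e ∈ Gr.par 0) (hU : IsOpen U) (hf : ContDiffOn ℝ ∞ f U)
    (hy : y ∈ U) (k : ℕ) :
    taylorTerm δ S k f y = ∑ e : Fin k → E, (List.ofFn fun i => δ (e i)).prod *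
      S (iteratedFDeriv ℝ k f y fun i => Pi.single (e i) 1) := by
  induction k generalizing f with
  | zero => simp [taylorTerm]
  | succ k ih =>
    -- The last index is split off because `iteratedFDeriv_succ_apply_right` applies the innermost
    -- derivative in the last direction; the corresponding even increment is commuted to the front.
    rw [← (Fin.snocEquiv fun _ => E).sum_comp, Fintype.sum_prod_type]
    refine Finset.sum_congr rfl fun e _ => ?_
    rw [ih (contDiffOn_pd _ hf hU), Finset.mul_sum]
    refine Finset.sum_congr rfl fun e' _ => ?_
    rw [← mul_assoc, (Gr.even_commute (hδ e) _).eq, List.ofFn_succ', List.prod_concat]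
    simp only [Fin.snocEquiv_apply, Fin.snoc_castSucc, Fin.snoc_last]
    rw [iteratedFDeriv_succ_apply_right]
    have hd : ContDiffAt ℝ ∞ (fderiv ℝ f) y :=
      (hf.fderiv_of_isOpen hU (m := ∞) (by simp)).contDiffAt (hU.mem_nhds hy)
    have := (ContinuousLinearMap.apply ℝ (Gr P O') (Pi.single e (1 : ℝ))).iteratedFDeriv_comp_left
      hd (i := k) (by exact_mod_cast le_top)
    have h2 := congrArg (· fun i => Pi.single (e' i) 1) this
    refine congrArg _ (congrArg S (h2.trans ?_))
    simp only [ContinuousLinearMap.compContinuousMultilinearMap_coe, Function.comp_apply,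
      ContinuousLinearMap.apply_apply, Fin.snoc_last]
    congr 2
    ext i : 1
    simp [Fin.init]

/-- Taylor terms with many even factors of body zero vanish. -/
lemma prod_mul_taylorTerm_eq_zero (hδ : ∀ e, δ e ∈ Gr.par 0 ∧ Gr.body (δ e) = 0) (k : ℕ)
    (l : List (Gr P O)) (hl : ∀ d ∈ l, d ∈ Gr.par 0 ∧ Gr.body d = 0)
    (h : Module.finrank ℝ (Gr P O) ≤ l.length + k) : l.prod * taylorTerm δ S k f y = 0 := by
  induction k generalizing f l with
  | zero => rw [Gr.prod_eq_zero l hl (by simpa using h), zero_mul]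
  | succ k ih =>
    simp only [taylorTerm]
    rw [Finset.mul_sum]
    refine Finset.sum_eq_zero fun e _ => ?_
    have := ih (f := pd (.inl e) f) (l.concat (δ e))
      (fun d hd => by
        rw [List.concat_eq_append, List.mem_append, List.mem_singleton] at hd
        rcases hd with hd | rfl
        exacts [hl d hd, hδ e])
      (by rw [List.length_concat]; omega)
    rwa [List.prod_concat, mul_assoc] at this

/-- A term of order `i` carries `i` increments, so the product carries at least as many as the
dimension. The increments of the first factor are moved one by one into a list `l` of prefactors,
which is why `key` is stated for arbitrary `l`. -/
lemma taylorTerm_mul_taylorTerm_eq_zero (hδ : ∀ e, δ e ∈ Gr.par 0 ∧ Gr.body (δ e) = 0) (i j : ℕ)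
    (h : Module.finrank ℝ (Gr P O) ≤ i + j) :
    taylorTerm δ S i f y * taylorTerm δ S j g y = 0 := by
  have key : ∀ (i : ℕ) (f : SFun P E O') (l : List (Gr P O)),
      (∀ d ∈ l, d ∈ Gr.par 0 ∧ Gr.body d = 0) → Module.finrank ℝ (Gr P O) ≤ l.length + i + j →
      l.prod * (taylorTerm δ S i f y * taylorTerm δ S j g y) = 0 := by
    intro i
    induction i with
    | zero =>
      intro f l hl h
      have hc : Commute l.prod (taylorTerm δ S 0 f y) :=
        Commute.list_prod_left _ _ fun d hd => Gr.even_commute (hl d hd).1 _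
      rw [← mul_assoc, hc.eq, mul_assoc, prod_mul_taylorTerm_eq_zero hδ j l hl (by simpa using h),
        mul_zero]
    | succ i ih =>
      intro f l hl h
      simp only [taylorTerm]
      rw [Finset.sum_mul, Finset.mul_sum]
      refine Finset.sum_eq_zero fun e _ => ?_
      have := ih (pd (.inl e) f) (l.concat (δ e))
        (fun d hd => by
          rw [List.concat_eq_append, List.mem_append, List.mem_singleton] at hd
          rcases hd with hd | rfl
          exacts [hl d hd, hδ e])
        (by rw [List.length_concat]; omega)
      rwa [List.prod_concat, mul_assoc, ← mul_assoc (δ e)] at this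
  simpa using key i f [] (by simp) (by simpa using h)

/-- The Leibniz rule for Taylor terms. -/
lemma taylorTerm_mul (hδ : ∀ e, δ e ∈ Gr.par 0) (hS : ∀ a b, S (a * b) = S a * S b)
    (hU : IsOpen U) (hf : ContDiffOn ℝ ∞ f U) (hg : ContDiffOn ℝ ∞ g U) (hy : y ∈ U) (k : ℕ) :
    taylorTerm δ S k (f * g) y = ∑ ij ∈ Finset.HasAntidiagonal.antidiagonal k, k.choose ij.1 •
      (taylorTerm δ S ij.1 f y * taylorTerm δ S ij.2 g y) := by
  induction k generalizing f g with
  | zero => simp [taylorTerm, hS]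
  | succ k ih =>
    have hpd : ∀ e, taylorTerm δ S k (pd (.inl e) (f * g)) y =
        taylorTerm δ S k (pd (.inl e) f * g) y + taylorTerm δ S k (f * pd (.inl e) g) y := by
      intro e
      rw [← taylorTerm_add (f := pd (.inl e) f * g) (g := f * pd (.inl e) g) hU
        (ContDiffOn.gr_mul (contDiffOn_pd _ hf hU) hg)
        (ContDiffOn.gr_mul hf (contDiffOn_pd _ hg hU)) hy]
      exact taylorTerm_congr hU (fun z hz => fderiv_gr_mul
        (ContDiffOn.differentiableAt_of_isOpen hf hU hz)
        (ContDiffOn.differentiableAt_of_isOpen hg hU hz) _) hy k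
    -- Pascal's rule splits the sum of order `k + 1` according to which of the two factors receives
    -- the additional derivative.
    rw [Finset.sum_antidiagonal_choose_succ_nsmul
      (fun i j => taylorTerm δ S i f y * taylorTerm δ S j g y)]
    have h1 : taylorTerm δ S (k + 1) (f * g) y = ∑ e, δ e * taylorTerm δ S k (pd (.inl e) (f * g)) y :=
      rfl
    rw [h1]
    simp_rw [hpd, mul_add]
    rw [Finset.sum_add_distrib, add_comm]
    congr 1
    · simp_rw [ih hf (contDiffOn_pd _ hg hU), Finset.mul_sum]
      rw [Finset.sum_comm]
      refine Finset.sum_congr rfl fun ij _ => ?_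
      simp only [taylorTerm, Finset.mul_sum, Finset.smul_sum]
      refine Finset.sum_congr rfl fun e _ => ?_
      rw [mul_smul_comm, ← mul_assoc, (Gr.even_commute (hδ e) _).eq, mul_assoc]
    · simp_rw [ih (contDiffOn_pd _ hf hU) hg, Finset.mul_sum]
      rw [Finset.sum_comm]
      refine Finset.sum_congr rfl fun ij hij => ?_
      rw [← Nat.choose_symm_of_eq_add (Finset.HasAntidiagonal.mem_antidiagonal.mp hij).symm]
      simp only [taylorTerm, Finset.sum_mul, Finset.smul_sum]
      refine Finset.sum_congr rfl fun e _ => ?_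
      rw [mul_smul_comm, mul_assoc]

end Taylor

/-! ### Pullback of superfunctions -/

section Pull

open Finset (HasAntidiagonal.antidiagonal HasAntidiagonal.mem_antidiagonal)

variable {P : Type*} [Ring P] [Algebra ℝ P] [SmallSuperalgebra P]
variable {E O E' O' : Type*} [Fintype E] [DecidableEq E] [Fintype O] [DecidableEq O]
  [Fintype E'] [DecidableEq E'] [Fintype O'] [DecidableEq O']

/-- The nilpotent part of the even components of a tuple of superfunctions at a point. -/
def increment (Φ : E' ⊕ O' → SFun P E O) (x : E → ℝ) (e : E') : Gr P O :=
  Φ (.inl e) x - algebraMap ℝ (Gr P O) (bodyMap Φ x e)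

variable {Φ : E' ⊕ O' → SFun P E O} {x : E → ℝ} {V : Set (E' → ℝ)} {f g : SFun P E' O'}

lemma increment_mem (hΦ : ∀ j, Φ j x ∈ Gr.par (par j)) (e : E') :
    increment Φ x e ∈ Gr.par 0 ∧ Gr.body (increment Φ x e) = 0 := by
  refine ⟨sub_mem (hΦ (.inl e)) (Gr.algebraMap_mem_par _), ?_⟩
  rw [increment, map_sub, Gr.body_algebraMap]
  exact sub_self _

/-- Terms beyond the dimension vanish, so the order of truncation `N` is free. The freedom is needed
below, where coordinates require orders zero and one and time derivatives shift the order. -/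
lemma pull_eq_sum_taylorTerm (hΦ : ∀ j, Φ j x ∈ Gr.par (par j)) (hV : IsOpen V)
    (hf : ContDiffOn ℝ ∞ f V) (hx : bodyMap Φ x ∈ V) {N : ℕ}
    (hN : Module.finrank ℝ (Gr P O) ≤ N) :
    pull Φ f x = ∑ k ∈ Finset.range N, ((k.factorial : ℝ)⁻¹) •
      taylorTerm (increment Φ x) (Gr.subst fun o => Φ (.inr o) x) k f (bodyMap Φ x) := by
  rw [← Finset.sum_subset (Finset.range_mono hN)]
  · exact Finset.sum_congr rfl fun k _ => congrArg _
      (taylorTerm_eq_sum (fun e => (increment_mem hΦ e).1) hV hf hx k).symm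
  · intro k _ hk
    have := prod_mul_taylorTerm_eq_zero (S := Gr.subst fun o => Φ (.inr o) x) (f := f)
      (y := bodyMap Φ x) (increment_mem hΦ) k [] (by simp) (by simpa using hk)
    rw [List.prod_nil, one_mul] at this
    rw [this, smul_zero]

lemma pull_congr (hΦ : ∀ j, Φ j x ∈ Gr.par (par j)) (hV : IsOpen V)
    (hf : ContDiffOn ℝ ∞ f V) (hx : bodyMap Φ x ∈ V) (h : ∀ z ∈ V, g z = f z) :
    pull Φ g x = pull Φ f x := by
  rw [pull_eq_sum_taylorTerm hΦ hV hf hx le_rfl,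
    pull_eq_sum_taylorTerm hΦ hV (hf.congr h) hx le_rfl]
  exact Finset.sum_congr rfl fun k _ => by rw [taylorTerm_congr hV h hx]

lemma pull_add (hΦ : ∀ j, Φ j x ∈ Gr.par (par j)) (hV : IsOpen V)
    (hf : ContDiffOn ℝ ∞ f V) (hg : ContDiffOn ℝ ∞ g V) (hx : bodyMap Φ x ∈ V) :
    pull Φ (f + g) x = pull Φ f x + pull Φ g x := by
  rw [pull_eq_sum_taylorTerm hΦ hV hf hx le_rfl, pull_eq_sum_taylorTerm hΦ hV hg hx le_rfl,
    pull_eq_sum_taylorTerm (f := f + g) hΦ hV (hf.add hg) hx le_rfl, ← Finset.sum_add_distrib]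
  exact Finset.sum_congr rfl fun k _ => by rw [taylorTerm_add hV hf hg hx, smul_add]

lemma pull_smul (hΦ : ∀ j, Φ j x ∈ Gr.par (par j)) (hV : IsOpen V)
    (hf : ContDiffOn ℝ ∞ f V) (hx : bodyMap Φ x ∈ V) (r : ℝ) :
    pull Φ (r • f) x = r • pull Φ f x := by
  rw [pull_eq_sum_taylorTerm hΦ hV hf hx le_rfl,
    pull_eq_sum_taylorTerm (f := r • f) hΦ hV (contDiffOn_const.smul hf) hx le_rfl, Finset.smul_sum]
  exact Finset.sum_congr rfl fun k _ => by rw [taylorTerm_smul hV hf hx, smul_comm]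

lemma pull_neg (hΦ : ∀ j, Φ j x ∈ Gr.par (par j)) (hV : IsOpen V)
    (hf : ContDiffOn ℝ ∞ f V) (hx : bodyMap Φ x ∈ V) :
    pull Φ (-f) x = -pull Φ f x := by
  rw [← neg_one_smul ℝ f, pull_smul hΦ hV hf hx, neg_one_smul]

lemma pull_sub (hΦ : ∀ j, Φ j x ∈ Gr.par (par j)) (hV : IsOpen V)
    (hf : ContDiffOn ℝ ∞ f V) (hg : ContDiffOn ℝ ∞ g V) (hx : bodyMap Φ x ∈ V) :
    pull Φ (f - g) x = pull Φ f x - pull Φ g x := by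
  rw [sub_eq_add_neg, pull_add (g := -g) hΦ hV hf hg.neg hx, pull_neg hΦ hV hg hx, ← sub_eq_add_neg]

lemma pull_zero (hΦ : ∀ j, Φ j x ∈ Gr.par (par j)) : pull Φ 0 x = 0 := by
  simpa using pull_smul (f := (0 : SFun P E' O')) hΦ isOpen_univ contDiffOn_const
    (Set.mem_univ _) 0

lemma pull_sum (hΦ : ∀ j, Φ j x ∈ Gr.par (par j)) (hV : IsOpen V) {ι : Type*} {s : Finset ι}
    {F : ι → SFun P E' O'} (hF : ∀ i ∈ s, ContDiffOn ℝ ∞ (F i) V) (hx : bodyMap Φ x ∈ V) :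
    pull Φ (∑ i ∈ s, F i) x = ∑ i ∈ s, pull Φ (F i) x := by
  classical
  induction s using Finset.induction_on with
  | empty => simpa using pull_zero hΦ
  | insert i s hi ih =>
    have hs : ContDiffOn ℝ ∞ (∑ i ∈ s, F i) V := by
      have := ContDiffOn.sum fun j (hj : j ∈ s) => hF j (Finset.mem_insert_of_mem hj)
      convert this using 1
      ext y
      simp
    rw [Finset.sum_insert hi, Finset.sum_insert hi,
      pull_add hΦ hV (hF i (Finset.mem_insert_self i s)) hs hx,
      ih fun j hj => hF j (Finset.mem_insert_of_mem hj)]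

/-- The Leibniz rule turns the expansion of `f * g` into a sum over the triangle `i + j < N`,
whereas the product of the two expansions runs over the square `i, j < N`. The surplus terms contain
at least `N` increments and vanish. -/
lemma pull_mul (hΦ : ∀ j, Φ j x ∈ Gr.par (par j)) (hV : IsOpen V)
    (hf : ContDiffOn ℝ ∞ f V) (hg : ContDiffOn ℝ ∞ g V) (hx : bodyMap Φ x ∈ V) :
    pull Φ (f * g) x = pull Φ f x * pull Φ g x := by
  set N := Module.finrank ℝ (Gr P O) with hN
  set τ : ℕ → SFun P E' O' → Gr P O := fun k f =>
    taylorTerm (increment Φ x) (Gr.subst fun o => Φ (.inr o) x) k f (bodyMap Φ x) with hτ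
  have hS : ∀ a b : Gr P O', Gr.subst (fun o => Φ (.inr o) x) (a * b) =
      Gr.subst (fun o => Φ (.inr o) x) a * Gr.subst (fun o => Φ (.inr o) x) b := fun a b => by
    simp only [Gr.subst_eq fun o => hΦ (.inr o), map_mul]
  have hmul : ∀ k, ((k.factorial : ℝ)⁻¹) • τ k (f * g) =
      ∑ ij ∈ HasAntidiagonal.antidiagonal k, (((ij.1.factorial : ℝ)⁻¹) • τ ij.1 f) *
        (((ij.2.factorial : ℝ)⁻¹) • τ ij.2 g) := by
    intro k
    rw [hτ]
    simp only []
    rw [taylorTerm_mul (fun e => (increment_mem hΦ e).1) hS hV hf hg hx, Finset.smul_sum]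
    refine Finset.sum_congr rfl fun ij hij => ?_
    rw [smul_mul_assoc, mul_smul_comm, smul_smul, ← Nat.cast_smul_eq_nsmul ℝ, smul_smul]
    congr 1
    have h1 := Nat.choose_mul_factorial_mul_factorial (n := k) (k := ij.1)
      (by have := HasAntidiagonal.mem_antidiagonal.mp hij; omega)
    rw [Nat.sub_eq_of_eq_add' (HasAntidiagonal.mem_antidiagonal.mp hij).symm] at h1
    have h2 : ((k.choose ij.1 : ℝ) * ij.1.factorial * ij.2.factorial) = k.factorial := by
      exact_mod_cast h1
    have h3 : (ij.1.factorial : ℝ) ≠ 0 := by positivity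
    have h4 : (ij.2.factorial : ℝ) ≠ 0 := by positivity
    have h5 : (k.factorial : ℝ) ≠ 0 := by positivity
    field_simp
    linarith
  have hvan : ∀ i j, N ≤ i + j → τ i f * τ j g = 0 := fun i j h =>
    taylorTerm_mul_taylorTerm_eq_zero (increment_mem hΦ) i j h
  rw [pull_eq_sum_taylorTerm hΦ hV hf hx le_rfl, pull_eq_sum_taylorTerm hΦ hV hg hx le_rfl,
    pull_eq_sum_taylorTerm (f := f * g) hΦ hV (ContDiffOn.gr_mul hf hg) hx le_rfl, Finset.sum_mul_sum,
    ← Finset.sum_product']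
  change ∑ k ∈ Finset.range N, ((k.factorial : ℝ)⁻¹) • τ k (f * g) =
    ∑ p ∈ Finset.range N ×ˢ Finset.range N, (((p.1.factorial : ℝ)⁻¹) • τ p.1 f) *
      (((p.2.factorial : ℝ)⁻¹) • τ p.2 g)
  simp_rw [hmul]
  rw [Finset.sum_sigma']
  refine Finset.sum_of_injOn (fun p => p.2) ?_ ?_ ?_ ?_
  · rintro ⟨k, ij⟩ hp ⟨k', ij'⟩ hp' h
    simp only [Finset.coe_sigma, Set.mem_sigma_iff, Finset.mem_coe,
      HasAntidiagonal.mem_antidiagonal] at hp hp' h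
    obtain rfl := h
    obtain rfl : k = k' := hp.2.symm.trans hp'.2
    rfl
  · rintro ⟨k, i, j⟩ hp
    simp only [Finset.coe_sigma, Set.mem_sigma_iff, Finset.mem_coe, Finset.mem_range,
      HasAntidiagonal.mem_antidiagonal, Finset.coe_product, Set.mem_prod] at hp ⊢
    omega
  · rintro ⟨i, j⟩ _ hp
    rw [smul_mul_assoc, mul_smul_comm, hvan, smul_zero, smul_zero]
    by_contra hlt
    exact hp ⟨⟨i + j, i, j⟩, by simpa using hlt, rfl⟩
  · rintro ⟨k, ij⟩ _
    rfl

lemma pull_coord (hΦ : ∀ j, Φ j x ∈ Gr.par (par j)) (j : E' ⊕ O') :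
    pull Φ (coord j) x = Φ j x := by
  -- Two extra orders ensure that the terms of order zero and one can be split off; all higher ones
  -- vanish for a coordinate.
  have hc := pull_eq_sum_taylorTerm (f := coord j) hΦ isOpen_univ (isSFunOn_coord _ j).1
    (Set.mem_univ _) (N := Module.finrank ℝ (Gr P O) + 2) (by omega)
  rw [hc, Finset.sum_range_succ', Finset.sum_range_succ']
  cases j with
  | inr o =>
    have h : ∀ k, taylorTerm (increment Φ x) (Gr.subst fun o => Φ (.inr o) x) (k + 1)
        (coord (.inr o)) (bodyMap Φ x) = 0 := taylorTerm_const _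
    simp only [h, smul_zero, Finset.sum_const_zero, zero_add, Nat.factorial_zero, Nat.cast_one,
      inv_one, one_smul]
    exact (Gr.subst_eq (fun o => hΦ (.inr o)) _).trans (Gr.substHom_xi _ o)
  | inl e =>
    have hpd : ∀ e', pd (.inl e') (coord (P := P) (O := O') (.inl e)) =
        fun _ => if e = e' then 1 else 0 := fun e' => by
      ext y : 1
      rw [pd_coord]
      simp
    have h1 : taylorTerm (increment Φ x) (Gr.subst fun o => Φ (.inr o) x) 1
        (coord (.inl e)) (bodyMap Φ x) = increment Φ x e := by
      simp only [taylorTerm, hpd, Gr.subst_eq fun o => hΦ (.inr o)]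
      rw [Finset.sum_eq_single e]
      · simp
      · intro e' _ he
        simp [he.symm]
      · simp
    have h2 : ∀ k, taylorTerm (increment Φ x) (Gr.subst fun o => Φ (.inr o) x) (k + 1 + 1)
        (coord (.inl e)) (bodyMap Φ x) = 0 := fun k => by
      refine Finset.sum_eq_zero fun e' _ => ?_
      rw [hpd, taylorTerm_const, mul_zero]
    have h0 : taylorTerm (increment Φ x) (Gr.subst fun o => Φ (.inr o) x) 0
        (coord (.inl e)) (bodyMap Φ x) = algebraMap ℝ (Gr P O) (bodyMap Φ x e) := by
      simp only [taylorTerm, Gr.subst_eq fun o => hΦ (.inr o)]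
      exact AlgHom.commutes _ _
    rw [h1, h0]
    simp [h2, increment]

end Pull

/-! ### Pullback along the bundle projection -/

section Projection

variable {P : Type*} [Ring P] [Algebra ℝ P] [SmallSuperalgebra P]
variable {E O : Type*} [Fintype E] [DecidableEq E] [Fintype O] [DecidableEq O]

lemma Gr.xi_inl_mem (o : O) : (Gr.xi (.inl o : O ⊕ O) : Gr P (O ⊕ O)) ∈ Gr.par 1 :=
  Gr.xi_mem _

/-- The inclusion of `P ⊠ ⋀ ℝ^O` into `P ⊠ ⋀ ℝ^(O ⊕ O)`. -/
def Gr.incl : Gr P O →ₐ[ℝ] Gr P (O ⊕ O) :=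
  Gr.substHom (β := fun o : O => (Gr.xi (.inl o : O ⊕ O) : Gr P (O ⊕ O))) Gr.xi_inl_mem

/-- The bundle projection on points. -/
def projL (E : Type*) : (E ⊕ E → ℝ) →L[ℝ] (E → ℝ) :=
  ContinuousLinearMap.pi fun e => ContinuousLinearMap.proj (.inl e)

lemma projL_apply (z : E ⊕ E → ℝ) (e : E) : projL E z e = z (.inl e) := rfl

/-- The base coordinates have zero increment, so only the order zero term of the Taylor expansion
survives. -/
lemma pullProj_apply (f : SFun P E O) (z : E ⊕ E → ℝ) :
    pullProj f z = Gr.incl (f (projL E z)) := by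
  have hb : bodyMap (fun i => coord (P := P) (bas i : (E ⊕ E) ⊕ (O ⊕ O))) z = projL E z := by
    ext e
    exact Gr.body_algebraMap _
  have hz : ∀ e : E, coord (P := P) (bas (.inl e) : (E ⊕ E) ⊕ (O ⊕ O)) z -
      algebraMap ℝ (Gr P (O ⊕ O)) (projL E z e) = 0 := fun e => sub_self _
  rw [pullProj, pull, hb]
  -- The algebra is nontrivial, so the truncated sum does contain the order zero term.
  have hr : Module.finrank ℝ (Gr P (O ⊕ O)) = Module.finrank ℝ (Gr P (O ⊕ O)) - 1 + 1 :=
    (Nat.succ_pred_eq_of_pos Module.finrank_pos).symm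
  rw [hr, Finset.sum_range_succ', Finset.sum_eq_zero, zero_add]
  · simp only [Nat.factorial_zero, Nat.cast_one, inv_one, one_smul, List.ofFn_zero, List.prod_nil,
      one_mul, iteratedFDeriv_zero_apply, Finset.univ_unique, Finset.sum_singleton]
    exact Gr.subst_eq Gr.xi_inl_mem _
  · intro k _
    rw [Finset.sum_eq_zero, smul_zero]
    intro e _
    simp only [hz, List.ofFn_succ, List.prod_cons, zero_mul]

variable {f : SFun P E O} {U : Set (E → ℝ)} {k : ZMod 2} {z : E ⊕ E → ℝ}

lemma IsSFunOn.pullProj (hf : IsSFunOn U k f) :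
    IsSFunOn (projL E ⁻¹' U) k (PSuper.pullProj f) := by
  refine IsSFunOn.congr (f := fun z => Gr.incl (f (projL E z))) ⟨?_, fun z hz => ?_⟩
    fun z _ => pullProj_apply f z
  · exact (contDiff_linear (Gr.incl (P := P) (O := O)).toLinearMap).comp_contDiffOn
      (hf.1.comp (projL E).contDiff.contDiffOn fun _ h => h)
  · exact Gr.substHom_mem _ (hf.2 _ hz)

lemma fderiv_pullProj (hf : DifferentiableAt ℝ f (projL E z)) (v : E ⊕ E → ℝ) :
    fderiv ℝ (pullProj f) z v = Gr.incl (fderiv ℝ f (projL E z) (projL E v)) := by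
  have h : pullProj f = fun z => (Gr.incl (P := P) (O := O)).toLinearMap (f (projL E z)) :=
    funext fun z => pullProj_apply f z
  have hc := hf.hasFDerivAt.comp z (projL E).hasFDerivAt
  rw [h]
  refine (fderiv_linear_comp (f := fun z => f (projL E z)) _ hc.differentiableAt v).trans ?_
  exact congrArg _ (congrArg (· v) hc.fderiv)

lemma pd_bas_pullProj (hf : DifferentiableAt ℝ f (projL E z)) (i : E ⊕ O) :
    pd (bas i) (pullProj f) z = pullProj (pd i f) z := by
  rw [pullProj_apply]
  cases i with
  | inl e =>
    refine (fderiv_pullProj hf _).trans ?_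
    rw [pd_inl]
    congr 2
    ext e'
    simp [projL_apply, Pi.single_apply]
  | inr o =>
    change Gr.oddDeriv (.inl o) (pullProj f z) = _
    rw [pullProj_apply, Gr.incl, Gr.oddDeriv_substHom]
    simp only [Gr.oddDeriv_xi]
    rw [Finset.sum_eq_single o]
    · simp [pd_inr]
    · intro o' _ ho
      simp [ho]
    · simp

lemma pd_fib_pullProj (hf : DifferentiableAt ℝ f (projL E z)) (i : E ⊕ O) :
    pd (fib i) (pullProj f) z = 0 := by
  cases i with
  | inl e =>
    refine (fderiv_pullProj hf _).trans ?_
    have : projL E (Pi.single (.inr e) 1) = 0 := by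
      ext e'
      simp [projL_apply]
    rw [this, map_zero, map_zero]
  | inr o =>
    change Gr.oddDeriv (.inr o) (pullProj f z) = _
    rw [pullProj_apply, Gr.incl, Gr.oddDeriv_substHom]
    simp [Gr.oddDeriv_xi]

lemma isOpen_projL_preimage (hU : IsOpen U) : IsOpen (projL E ⁻¹' U) :=
  hU.preimage (projL E).continuous

variable {E' O' : Type*} [Fintype E'] [DecidableEq E'] [Fintype O'] [DecidableEq O']

/-- Fibre derivatives of `f ∘ Π` vanish and base derivatives commute with the projection, so the
recursion only sees the base increments. -/
lemma taylorTerm_pullProj (hU : IsOpen U) (hf : ContDiffOn ℝ ∞ f U) (hz : projL E z ∈ U)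
    (δ : E ⊕ E → Gr P O') (S : Gr P (O ⊕ O) →ₗ[ℝ] Gr P O') (k : ℕ) :
    taylorTerm δ S k (pullProj f) z =
      taylorTerm (fun e => δ (.inl e)) (S ∘ₗ (Gr.incl (P := P) (O := O)).toLinearMap) k f
        (projL E z) := by
  induction k generalizing f with
  | zero => exact congrArg S (pullProj_apply f z)
  | succ k ih =>
    have hd : ∀ w ∈ projL E ⁻¹' U, DifferentiableAt ℝ f (projL E w) := fun w hw =>
      ContDiffOn.differentiableAt_of_isOpen hf hU hw
    simp only [taylorTerm]
    rw [Fintype.sum_sum_type]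
    have h1 : ∀ e, taylorTerm δ S k (pd (.inl (.inl e)) (pullProj f)) z =
        taylorTerm δ S k (pullProj (pd (.inl e) f)) z := fun e =>
      taylorTerm_congr (isOpen_projL_preimage hU)
        (fun w hw => pd_bas_pullProj (hd w hw) (.inl e)) hz k
    have h2 : ∀ e, taylorTerm δ S k (pd (.inl (.inr e)) (pullProj f)) z = 0 := fun e =>
      (taylorTerm_congr (isOpen_projL_preimage hU)
        (fun w hw => pd_fib_pullProj (hd w hw) (.inl e)) hz k).trans (taylorTerm_zero k)
    simp only [h1, h2, mul_zero, Finset.sum_const_zero, add_zero]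
    exact Finset.sum_congr rfl fun e _ => by rw [ih (contDiffOn_pd _ hf hU)]

/-- Both sides are homomorphisms that fix `P`, so agreement on the odd generators suffices. -/
lemma Gr.substHom_substHom {O₁ O₂ O₃ : Type*} [Fintype O₁] [Fintype O₂]
    {β : O₂ → Gr P O₃} {γ : O₁ → Gr P O₂} {ε : O₁ → Gr P O₃} (hβ : ∀ o, β o ∈ Gr.par 1)
    (hγ : ∀ o, γ o ∈ Gr.par 1) (hε : ∀ o, ε o ∈ Gr.par 1)
    (h : ∀ o, Gr.substHom hβ (γ o) = ε o) (z : Gr P O₁) :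
    Gr.substHom hβ (Gr.substHom hγ z) = Gr.substHom hε z := by
  have key : (Gr.substHom hβ).comp (Gr.extLift hγ) = Gr.extLift hε := by
    refine ExteriorAlgebra.hom_ext (LinearMap.ext fun v => ?_)
    change Gr.substHom hβ (Gr.extLift hγ (CliffordAlgebra.ι (0 : QuadraticForm ℝ (O₁ → ℝ)) v)) =
      Gr.extLift hε (CliffordAlgebra.ι (0 : QuadraticForm ℝ (O₁ → ℝ)) v)
    rw [Gr.extLift_ι, Gr.extLift_ι, Fintype.linearCombination_apply,
      Fintype.linearCombination_apply, map_sum]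
    exact Finset.sum_congr rfl fun o _ => by rw [map_smul, h]
  induction z using Gr.induction_tm with
  | zero => simp
  | add x y hx hy => rw [map_add, map_add, map_add, hx, hy]
  | tm i j a b ha hb =>
    rw [Gr.substHom_tm, Gr.substHom_tm, map_mul, Gr.substHom_tm, map_one, mul_one, ← key]
    rfl

/-- Functoriality of the pullback for the bundle projection. -/
lemma pull_pullProj {Ψ : (E ⊕ E) ⊕ (O ⊕ O) → SFun P E' O'} {x : E' → ℝ}
    (hΨ : ∀ j, Ψ j x ∈ Gr.par (par j)) (hU : IsOpen U) (hf : ContDiffOn ℝ ∞ f U)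
    (hx : projL E (bodyMap Ψ x) ∈ U) :
    pull Ψ (pullProj f) x = pull (fun i => Ψ (bas i)) f x := by
  have hΨ' : ∀ i : E ⊕ O, Ψ (bas i) x ∈ Gr.par (par i) := fun i => by
    have := hΨ (bas i)
    cases i <;> exact this
  have hp : ContDiffOn ℝ ∞ (pullProj f) (projL E ⁻¹' U) :=
    ((contDiff_linear (Gr.incl (P := P) (O := O)).toLinearMap).comp_contDiffOn
      (hf.comp (projL E).contDiff.contDiffOn fun _ h => h)).congr fun z _ => pullProj_apply f z
  rw [pull_eq_sum_taylorTerm hΨ (isOpen_projL_preimage hU) hp hx le_rfl,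
    pull_eq_sum_taylorTerm hΨ' hU hf hx le_rfl]
  refine Finset.sum_congr rfl fun k _ => ?_
  rw [taylorTerm_pullProj hU hf hx]
  have hS : (Gr.subst fun o => Ψ (.inr o) x) ∘ₗ (Gr.incl (P := P) (O := O)).toLinearMap =
      Gr.subst fun o => Ψ (bas (.inr o)) x := by
    refine LinearMap.ext fun w => ?_
    rw [LinearMap.comp_apply, AlgHom.toLinearMap_apply, Gr.subst_eq fun o => hΨ (.inr o), Gr.subst_eq fun o => hΨ' (.inr o)]
    exact Gr.substHom_substHom _ _ _ (fun o => Gr.substHom_xi _ _) w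
  rw [hS]
  rfl

end Projection

/-! ### The chain rule along curves -/

section ChainRule

open Filter Topology

variable {P : Type*} [Ring P] [Algebra ℝ P] [SmallSuperalgebra P]
variable {E O O' : Type*} [Fintype E] [DecidableEq E] [Fintype O] [Fintype O']

namespace Gr

lemma subst_tm {β : O' → Gr P O} (hβ : ∀ o, β o ∈ par 1) (a : P)
    (b : ExteriorAlgebra ℝ (O' → ℝ)) : subst β (tm a b) = tm a 1 * subst β (tm 1 b) := by
  rw [subst_eq hβ, subst_eq hβ, substHom_tm, substHom_tm]
  exact congrArg _ (one_mul _).symm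

lemma subst_tm_ι_mul {β : O' → Gr P O} (hβ : ∀ o, β o ∈ par 1) (m : O' → ℝ)
    (b : ExteriorAlgebra ℝ (O' → ℝ)) :
    subst β (tm 1 (CliffordAlgebra.ι (0 : QuadraticForm ℝ (O' → ℝ)) m * b)) =
      Fintype.linearCombination ℝ β m * subst β (tm 1 b) := by
  have h1 : (tm 1 1 : Gr P O) = 1 := rfl
  rw [subst_eq hβ, subst_eq hβ, substHom_tm, substHom_tm, map_mul, extLift_ι, h1, one_mul, one_mul]

lemma subst_tm_algebraMap {β : O' → Gr P O} (hβ : ∀ o, β o ∈ par 1) (r : ℝ) :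
    subst β (tm 1 (algebraMap ℝ (ExteriorAlgebra ℝ (O' → ℝ)) r)) = algebraMap ℝ (Gr P O) r := by
  have h1 : (tm 1 1 : Gr P O) = 1 := rfl
  rw [subst_eq hβ, substHom_tm, AlgHom.commutes, h1, one_mul]

variable {β : ℝ → O' → Gr P O} {β' : O' → Gr P O} {t : ℝ}

/-- Induction on the length of words in the generators. Moving the odd velocity `β' o` to the left
past a further odd factor gives a sign, which is the one in the recursion for the contraction. -/
lemma hasDerivAt_subst_tm_one (hodd : ∀ᶠ s in 𝓝 t, ∀ o, β s o ∈ par 1)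
    (hβ : ∀ o, HasDerivAt (fun s => β s o) (β' o) t) (hβ' : ∀ o, β' o ∈ par 1)
    (b : ExteriorAlgebra ℝ (O' → ℝ)) :
    HasDerivAt (fun s => subst (β s) (tm 1 b))
      (∑ o, β' o * subst (β t) (oddDeriv o (tm 1 b))) t := by
  have hD : ∀ (o : O') (b : ExteriorAlgebra ℝ (O' → ℝ)), oddDeriv o (tm 1 b : Gr P O') =
      tm 1 (CliffordAlgebra.contractLeft (Q := (0 : QuadraticForm ℝ (O' → ℝ)))
        (LinearMap.proj o) b) := fun o b => by
    rw [oddDeriv_tm o (SetLike.one_mem_graded _), sgn_zero, one_smul]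
  have ht : ∀ o, β t o ∈ par 1 := hodd.self_of_nhds
  induction b using CliffordAlgebra.left_induction with
  | algebraMap r =>
    have h0 : ∀ o, oddDeriv o (tm 1 (algebraMap ℝ (CliffordAlgebra (0 : QuadraticForm ℝ (O' → ℝ))) r)
        : Gr P O') = 0 := fun o => by
      rw [hD, CliffordAlgebra.contractLeft_algebraMap, ← zero_smul ℝ (0 : ExteriorAlgebra ℝ _),
        tm_smul, zero_smul]
    simp only [h0, map_zero, mul_zero, Finset.sum_const_zero]
    exact (hasDerivAt_const t (algebraMap ℝ (Gr P O) r)).congr_of_eventuallyEq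
      (hodd.mono fun s hs => subst_tm_algebraMap hs r)
  | add x y hx hy =>
    simp only [tm_add, map_add, mul_add, Finset.sum_add_distrib]
    exact hx.add hy
  | ι_mul x m ih =>
    have hlc : HasDerivAt (fun s => Fintype.linearCombination ℝ (β s) m)
        (Fintype.linearCombination ℝ β' m) t := by
      simp only [Fintype.linearCombination_apply]
      exact HasDerivAt.fun_sum fun o _ => (hβ o).const_smul (m o)
    refine ((HasDerivAt.gr_mul hlc ih).congr_of_eventuallyEq
      (hodd.mono fun s hs => subst_tm_ι_mul hs m x)).congr_deriv ?_
    rw [Fintype.linearCombination_apply, Finset.sum_mul, Finset.mul_sum, ← Finset.sum_add_distrib]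
    refine Finset.sum_congr rfl fun o _ => ?_
    rw [hD, hD, CliffordAlgebra.contractLeft_ι_mul, sub_eq_add_neg, tm_add, ← neg_one_smul ℝ
      (CliffordAlgebra.ι (0 : QuadraticForm ℝ (O' → ℝ)) m * _), tm_smul, tm_smul, map_add, map_smul,
      map_smul, subst_tm_ι_mul ht, mul_add, ← mul_assoc,
      supercomm (linearCombination_mem ht m) (hβ' o), mul_one, sgn_one, smul_mul_assoc,
      smul_mul_assoc, mul_smul_comm, mul_smul_comm, mul_assoc]
    rfl

lemma hasDerivAt_subst_const (hodd : ∀ᶠ s in 𝓝 t, ∀ o, β s o ∈ par 1)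
    (hβ : ∀ o, HasDerivAt (fun s => β s o) (β' o) t) (hβ' : ∀ o, β' o ∈ par 1) (z : Gr P O') :
    HasDerivAt (fun s => subst (β s) z) (∑ o, β' o * subst (β t) (oddDeriv o z)) t := by
  have ht : ∀ o, β t o ∈ par 1 := hodd.self_of_nhds
  induction z using induction_tm with
  | zero =>
    simp only [map_zero, mul_zero, Finset.sum_const_zero]
    exact hasDerivAt_const t 0
  | add x y hx hy =>
    simp only [map_add, mul_add, Finset.sum_add_distrib]
    exact hx.add hy
  | tm i j a b ha hb =>
    refine ((HasDerivAt.gr_mul (hasDerivAt_const t (tm a 1 : Gr P O))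
      (hasDerivAt_subst_tm_one hodd hβ hβ' b)).congr_of_eventuallyEq
      (hodd.mono fun s hs => subst_tm hs a b)).congr_deriv ?_
    rw [zero_mul, zero_add, Finset.mul_sum]
    refine Finset.sum_congr rfl fun o _ => ?_
    rw [oddDeriv_tm o ha, oddDeriv_tm o (SetLike.one_mem_graded _), sgn_zero, one_smul, map_smul,
      subst_tm ht a, ← mul_assoc, supercomm (tm_mem_par ha (SetLike.one_mem_graded _) (add_zero i))
      (hβ' o), mul_one, smul_mul_assoc, mul_smul_comm, mul_assoc]

/-- Expanding `z` in a basis with scalar coefficients separates its time dependence from that of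
`β`, and the ordinary product rule applies to each summand. -/
lemma hasDerivAt_subst (hodd : ∀ᶠ s in 𝓝 t, ∀ o, β s o ∈ par 1)
    (hβ : ∀ o, HasDerivAt (fun s => β s o) (β' o) t) (hβ' : ∀ o, β' o ∈ par 1)
    {z : ℝ → Gr P O'} {z' : Gr P O'} (hz : HasDerivAt z z' t) :
    HasDerivAt (fun s => subst (β s) (z s))
      (subst (β t) z' + ∑ o, β' o * subst (β t) (oddDeriv o (z t))) t := by
  set bs := Module.finBasis ℝ (Gr P O')
  have hexp : ∀ (L : Gr P O' →ₗ[ℝ] Gr P O) (w : Gr P O'),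
      L w = ∑ i, bs.coord i w • L (bs i) := fun L w => by
    conv_lhs => rw [← bs.sum_repr w]
    rw [map_sum]
    exact Finset.sum_congr rfl fun i _ => map_smul L _ _
  have hc : ∀ i, HasDerivAt (fun s => bs.coord i (z s)) (bs.coord i z') t := fun i =>
    (LinearMap.toContinuousLinearMap (bs.coord i)).hasFDerivAt.comp_hasDerivAt t hz
  have h := HasDerivAt.fun_sum (u := Finset.univ) fun i _ =>
    (hc i).smul (hasDerivAt_subst_const hodd hβ hβ' (bs i))
  refine (h.congr_of_eventuallyEq (Eventually.of_forall fun s => hexp _ _)).congr_deriv ?_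
  -- The terms in which `β` was differentiated reassemble by linearity in `z t`.
  have h2 := hexp (∑ o, LinearMap.mulLeft ℝ (β' o) ∘ₗ subst (β t) ∘ₗ oddDeriv o) (z t)
  simp only [LinearMap.sum_apply, LinearMap.comp_apply, LinearMap.mulLeft_apply] at h2
  rw [h2, hexp (subst (β t)) z', Finset.sum_add_distrib, add_comm]

end Gr

variable {U : Set (E → ℝ)} {f : SFun P E O'}
  {y : ℝ → E → ℝ} {y' : E → ℝ} {δ : ℝ → E → Gr P O} {δ' : E → Gr P O}
  {β : ℝ → O' → Gr P O} {β' : O' → Gr P O} {t : ℝ}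

/-- The three sums come from the motion of the nilpotent increment, of the body and of the odd
coordinates. The `k` increments in a term commute with everything, so they contribute equally, with
factor `k` and order lowered by one. For `k = 0` the truncated `k - 1` is harmless since its
coefficient is zero. -/
lemma hasDerivAt_taylorTerm (hU : IsOpen U) (hf : ContDiffOn ℝ ∞ f U) (hy : HasDerivAt y y' t)
    (hyU : y t ∈ U) (hδ : ∀ e, HasDerivAt (fun s => δ s e) (δ' e) t)
    (hδt : ∀ e, δ t e ∈ Gr.par 0)
    (hodd : ∀ᶠ s in 𝓝 t, ∀ o, β s o ∈ Gr.par 1)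
    (hβ : ∀ o, HasDerivAt (fun s => β s o) (β' o) t) (hβ' : ∀ o, β' o ∈ Gr.par 1) (k : ℕ) :
    HasDerivAt (fun s => taylorTerm (δ s) (Gr.subst (β s)) k f (y s))
      ((k : ℝ) • ∑ e, δ' e * taylorTerm (δ t) (Gr.subst (β t)) (k - 1) (pd (.inl e) f) (y t) +
        ∑ e, y' e • taylorTerm (δ t) (Gr.subst (β t)) k (pd (.inl e) f) (y t) +
        ∑ o, β' o * taylorTerm (δ t) (Gr.subst (β t)) k (pd (.inr o) f) (y t)) t := by
  set τ : ℕ → SFun P E O' → Gr P O := fun k f => taylorTerm (δ t) (Gr.subst (β t)) k f (y t) with hτ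
  change HasDerivAt _ ((k : ℝ) • ∑ e, δ' e * τ (k - 1) (pd (.inl e) f) +
    ∑ e, y' e • τ k (pd (.inl e) f) + ∑ o, β' o * τ k (pd (.inr o) f)) t
  have hsucc : ∀ k f, τ (k + 1) f = ∑ e, δ t e * τ k (pd (.inl e) f) := fun _ _ => rfl
  have hcomm : ∀ (f : SFun P E O'), ContDiffOn ℝ ∞ f U → ∀ k e i,
      τ k (pd (.inl e) (pd i f)) = τ k (pd i (pd (.inl e) f)) := fun f hf k e i =>
    taylorTerm_congr hU (fun z hz => pd_inl_comm hU hf hz e i) hyU k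
  induction k generalizing f with
  | zero =>
    have hd := (ContDiffOn.differentiableAt_of_isOpen hf hU hyU).hasFDerivAt.comp_hasDerivAt t hy
    refine (Gr.hasDerivAt_subst hodd hβ hβ' hd).congr_deriv ?_
    rw [Nat.cast_zero, zero_smul, zero_add]
    congr 1
    have : fderiv ℝ f (y t) y' = ∑ e, y' e • pd (.inl e) f (y t) := by
      conv_lhs => rw [pi_eq_sum_univ' y']
      rw [map_sum]
      refine Finset.sum_congr rfl fun e _ => ?_
      rw [pd_inl, map_smul]
    rw [this, map_sum]
    exact Finset.sum_congr rfl fun e _ => map_smul _ _ _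
  | succ k ih =>
    have h := HasDerivAt.fun_sum (u := Finset.univ) fun e _ =>
      HasDerivAt.gr_mul (hδ e) (ih (contDiffOn_pd (.inl e) hf hU))
    refine h.congr_deriv ?_
    change ∑ e, (δ' e * τ k (pd (.inl e) f) + δ t e * _) = _
    rw [Finset.sum_add_distrib, Nat.cast_succ, Nat.add_sub_cancel, add_smul, one_smul,
      add_comm (_ • _) (∑ e, _), add_assoc, add_assoc]
    congr 1
    simp only [mul_add, Finset.sum_add_distrib]
    rw [add_assoc]
    congr 1
    · rcases k with _ | k
      · simp
      · simp only [hsucc, Nat.add_sub_cancel, mul_smul_comm, ← Finset.smul_sum, Finset.mul_sum]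
        congr 1
        rw [Finset.sum_comm]
        refine Finset.sum_congr rfl fun e _ => Finset.sum_congr rfl fun e' _ => ?_
        rw [← mul_assoc, ← mul_assoc, (Gr.even_commute (hδt e') _).eq, hcomm f hf]
    · simp only [hsucc, Finset.mul_sum, Finset.smul_sum]
      congr 1
      · rw [Finset.sum_comm]
        refine Finset.sum_congr rfl fun e _ => Finset.sum_congr rfl fun e' _ => ?_
        rw [mul_smul_comm, hcomm f hf]
      · rw [Finset.sum_comm]
        refine Finset.sum_congr rfl fun o _ => Finset.sum_congr rfl fun e' _ => ?_
        rw [← mul_assoc, ← mul_assoc, (Gr.even_commute (hδt e') _).eq, hcomm f hf]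

end ChainRule

/-! ### Time derivatives and the chain rule for pullbacks along curves -/

section Curves

open Filter Topology

variable {P : Type*} [Ring P] [Algebra ℝ P] [SmallSuperalgebra P]

lemma hasDerivAt_of_differentiableAt {F : SFun P (Fin 1) (Fin 0)} {t : Fin 1 → ℝ}
    (hF : DifferentiableAt ℝ F t) :
    HasDerivAt (fun s : ℝ => F fun _ => s) (dt F t) (t 0) := by
  have ht : (fun _ => t 0 : Fin 1 → ℝ) = t := by ext i; rw [Subsingleton.elim i 0]
  have h1 : HasDerivAt (fun s : ℝ => (fun _ => s : Fin 1 → ℝ)) (Pi.single 0 1) (t 0) := by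
    rw [hasDerivAt_pi]
    intro i
    rw [Subsingleton.elim i 0, Pi.single_eq_same]
    exact hasDerivAt_id _
  have h2 : HasFDerivAt F (fderiv ℝ F t) (fun _ => t 0) := ht.symm ▸ hF.hasFDerivAt
  exact h2.comp_hasDerivAt (t 0) h1

lemma dt_eq_of_hasDerivAt {F : SFun P (Fin 1) (Fin 0)} {t : Fin 1 → ℝ} {d : Gr P (Fin 0)}
    (hF : HasDerivAt (fun s : ℝ => F fun _ => s) d (t 0)) :
    DifferentiableAt ℝ F t ∧ dt F t = d := by
  have hc : F = (fun s : ℝ => F fun _ => s) ∘ fun x : Fin 1 → ℝ => x 0 := by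
    ext x
    exact congrArg F (by ext i; rw [Subsingleton.elim i 0])
  have hd : DifferentiableAt ℝ F t := by
    rw [hc]
    exact hF.differentiableAt.comp t (differentiableAt_apply 0 t)
  exact ⟨hd, (hasDerivAt_of_differentiableAt hd).unique hF⟩

variable {E' O' : Type*} [Fintype E'] [DecidableEq E'] [Fintype O'] [DecidableEq O']
  {W : Set (Fin 1 → ℝ)} {Φ : E' ⊕ O' → SFun P (Fin 1) (Fin 0)} {t : Fin 1 → ℝ}
  {V : Set (E' → ℝ)} {f : SFun P E' O'}

/-- The chain rule for the pullback along a curve. -/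
lemma dt_pull (hW : IsOpen W) (hΦ : ∀ j, IsSFunOn W (par j) (Φ j)) (ht : t ∈ W) (hV : IsOpen V)
    (hf : ContDiffOn ℝ ∞ f V) (htV : bodyMap Φ t ∈ V) :
    DifferentiableAt ℝ (pull Φ f) t ∧
      dt (pull Φ f) t = ∑ j, dt (Φ j) t * pull Φ (pd j f) t := by
  refine dt_eq_of_hasDerivAt ?_
  set c : ℝ → Fin 1 → ℝ := fun s _ => s with hc
  have hct : c (t 0) = t := by ext i; rw [Subsingleton.elim i 0]
  have hcc : Continuous c := continuous_pi fun _ => continuous_id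
  have hcW : ∀ᶠ s in 𝓝 (t 0), c s ∈ W :=
    hcc.continuousAt.eventually_mem (hW.mem_nhds (hct.symm ▸ ht))
  have hpar : ∀ s, c s ∈ W → ∀ j, Φ j (c s) ∈ Gr.par (par j) := fun s hs j => (hΦ j).2 _ hs
  have hd : ∀ j, HasDerivAt (fun s => Φ j (c s)) (dt (Φ j) t) (t 0) := fun j =>
    hasDerivAt_of_differentiableAt ((hΦ j).differentiableAt hW ht)
  have hdpar : ∀ j, dt (Φ j) t ∈ Gr.par (par j) := fun j => by
    simpa [par] using ((hΦ j).pd hW (.inl 0)).2 t ht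
  have hy : HasDerivAt (fun s => bodyMap Φ (c s)) (fun e => Gr.body (dt (Φ (.inl e)) t)) (t 0) := by
    rw [hasDerivAt_pi]
    exact fun e => (LinearMap.toContinuousLinearMap (Gr.body (P := P) (O := Fin 0))).hasFDerivAt
      |>.comp_hasDerivAt _ (hd (.inl e))
  have hyV : ∀ᶠ s in 𝓝 (t 0), bodyMap Φ (c s) ∈ V :=
    hy.continuousAt.eventually_mem (hV.mem_nhds (by simpa only [hct] using htV))
  have hδ : ∀ e, HasDerivAt (fun s => increment Φ (c s) e)
      (dt (Φ (.inl e)) t - algebraMap ℝ _ (Gr.body (dt (Φ (.inl e)) t))) (t 0) := fun e => by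
    simp only [increment, Algebra.algebraMap_eq_smul_one]
    exact (hd (.inl e)).sub ((hasDerivAt_pi.mp hy e).smul_const 1)
  set N := Module.finrank ℝ (Gr P (Fin 0))
  -- Truncation at `N + 1` leaves exactly the orders below `N` after the first sum has been shifted
  -- down by one.
  have hsum := HasDerivAt.fun_sum (u := Finset.range (N + 1)) fun k _ =>
    (hasDerivAt_taylorTerm (δ := fun s => increment Φ (c s)) (β := fun s o => Φ (.inr o) (c s))
      hV hf hy (by rw [hct]; exact htV) hδ
      (fun e => (increment_mem (hpar _ (hct.symm ▸ ht)) e).1)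
      (hcW.mono fun s hs o => hpar s hs (.inr o)) (fun o => hd (.inr o))
      (fun o => hdpar (.inr o)) k).const_smul ((k.factorial : ℝ)⁻¹)
  refine (hsum.congr_of_eventuallyEq ?_).congr_deriv ?_
  · filter_upwards [hcW, hyV] with s hs hs'
    exact pull_eq_sum_taylorTerm (hpar s hs) hV hf hs' (Nat.le_succ N)
  simp only [hct, smul_add, Finset.sum_add_distrib]
  have ht' : ∀ j, Φ j t ∈ Gr.par (par j) := fun j => (hΦ j).2 t ht
  rw [Fintype.sum_sum_type]
  have hpull : ∀ (j) (M : ℕ), N ≤ M → pull Φ (pd j f) t = ∑ k ∈ Finset.range M,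
      ((k.factorial : ℝ)⁻¹) • taylorTerm (increment Φ t) (Gr.subst fun o => Φ (.inr o) t) k
        (pd j f) (bodyMap Φ t) := fun j M hM =>
    pull_eq_sum_taylorTerm ht' hV (contDiffOn_pd j hf hV) htV hM
  congr 1
  -- The even velocity is its nilpotent part plus its body. The former matches the differentiated
  -- increments, where `(k + 1) / (k + 1)! = 1 / k!`; the latter matches the motion of the expansion
  -- point.
  · have hsplit : ∀ e, dt (Φ (.inl e)) t * pull Φ (pd (.inl e) f) t =
        (dt (Φ (.inl e)) t - algebraMap ℝ _ (Gr.body (dt (Φ (.inl e)) t))) *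
          pull Φ (pd (.inl e) f) t +
        Gr.body (dt (Φ (.inl e)) t) • pull Φ (pd (.inl e) f) t := fun e => by
      rw [sub_mul, Algebra.smul_def, sub_add_cancel]
    simp only [hsplit, Finset.sum_add_distrib]
    congr 1
    · rw [Finset.sum_range_succ']
      simp only [Nat.cast_zero, zero_smul, smul_zero, add_zero, Nat.add_sub_cancel]
      simp only [hpull _ N le_rfl, Finset.mul_sum, Finset.smul_sum]
      rw [Finset.sum_comm]
      refine Finset.sum_congr rfl fun e _ => Finset.sum_congr rfl fun k _ => ?_
      rw [smul_smul, mul_smul_comm]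
      congr 1
      rw [Nat.factorial_succ, Nat.cast_mul]
      have h3 : (k.factorial : ℝ) ≠ 0 := by positivity
      have h4 : ((k + 1 : ℕ) : ℝ) ≠ 0 := by positivity
      field_simp
    · simp only [hpull _ (N + 1) (Nat.le_succ N), Finset.smul_sum]
      rw [Finset.sum_comm]
      exact Finset.sum_congr rfl fun e _ => Finset.sum_congr rfl fun k _ => smul_comm _ _ _
  · simp only [hpull _ (N + 1) (Nat.le_succ N), Finset.mul_sum, Finset.smul_sum]
    rw [Finset.sum_comm]
    exact Finset.sum_congr rfl fun e _ => Finset.sum_congr rfl fun k _ => (mul_smul_comm _ _ _).symm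

end Curves

/-! ### Algebraic identities for metrics and Christoffel symbols -/

section Algebra

variable {P : Type*} [Ring P] [Algebra ℝ P] [SmallSuperalgebra P] {O : Type*} {ι : Type*}
  [Fintype ι] {p : ι → ZMod 2} {ξ : ι → Gr P O} {g : ι → ι → Gr P O}

lemma sgn_smul_sgn_smul {M : Type*} [AddCommGroup M] [Module ℝ M] {a b c : ZMod 2}
    (h : a + b = c) (x : M) : sgn a • sgn b • x = sgn c • x := by
  rw [smul_smul, ← sgn_add, h]

lemma sgn_smul_sgn_smul_self {M : Type*} [AddCommGroup M] [Module ℝ M] (a : ZMod 2) (x : M) :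
    sgn a • sgn a • x = x := by
  rw [smul_smul, sgn_mul_self, one_smul]

lemma sgn_smul_injective {M : Type*} [AddCommGroup M] [Module ℝ M] (a : ZMod 2) :
    Function.Injective (fun x : M => sgn a • x) := fun x y h => by
  rw [← sgn_smul_sgn_smul_self a x, ← sgn_smul_sgn_smul_self a y]
  exact congrArg (sgn a • ·) h

/-- The metric terms of the Euler-Lagrange equations in terms of the Christoffel symbols. -/
lemma half_sum_metric_derivative (hξ : ∀ i, ξ i ∈ Gr.par (p i))
    (hsymm : ∀ i j, g j i = sgn (p i * p j) • g i j) {dg Γ : ι → ι → ι → Gr P O}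
    (htors : ∀ i j k, Γ i j k = sgn (p i * p j) • Γ j i k)
    (hcomp : ∀ i j r, dg i j r = ∑ k, Γ i j k * g k r +
      sgn (p i * p j) • ∑ k, sgn (p j * (p i + p r + p k)) • (Γ i r k * g j k)) (k : ι) :
    (1 / 2 : ℝ) • ∑ i, ∑ j, sgn (p k * (p i + p j)) • (ξ i * ξ j * dg k j i) =
      ∑ i, ∑ j, ξ j * ξ i * dg i j k -
        ∑ l, (∑ i, ∑ j, ξ j * ξ i * Γ i j l) * g l k := by
  -- `G` are the Christoffel symbols with lowered index. In terms of them, graded symmetry of `g`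
  -- turns compatibility into the two-term formula `hdg` for the derivatives of the metric.
  set G : ι → ι → ι → Gr P O := fun i j r => ∑ l, Γ i j l * g l r with hG
  have hGt : ∀ i j r, G i j r = sgn (p i * p j) • G j i r := fun i j r => by
    simp only [hG]
    rw [Finset.smul_sum]
    exact Finset.sum_congr rfl fun l _ => by rw [htors i j l, smul_mul_assoc]
  have hdg : ∀ i j r, dg i j r = G i j r + sgn (p j * p r) • G i r j := fun i j r => by
    rw [hcomp i j r]
    congr 1
    simp only [hG]
    rw [Finset.smul_sum, Finset.smul_sum]
    refine Finset.sum_congr rfl fun l _ => ?_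
    rw [hsymm l j, mul_smul_comm, smul_smul, smul_smul, ← sgn_add, ← sgn_add]
    congr 2
    have : ∀ a b c d : ZMod 2, a * b + b * (a + c + d) + d * b = b * c := by decide
    exact this _ _ _ _
  have hsw : ∀ i j, ξ i * ξ j = sgn (p i * p j) • (ξ j * ξ i) := fun i j =>
    Gr.supercomm (hξ i) (hξ j)
  set R : Gr P O := ∑ i, ∑ j, sgn (p j * p k) • (ξ j * ξ i * G i k j) with hR
  have h1 : ∑ i, ∑ j, ξ j * ξ i * dg i j k =
      ∑ l, (∑ i, ∑ j, ξ j * ξ i * Γ i j l) * g l k + R := by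
    simp only [hdg, mul_add, mul_smul_comm, Finset.sum_add_distrib, ← hR]
    congr 1
    simp only [hG, Finset.sum_mul, Finset.mul_sum]
    rw [Finset.sum_comm' (t' := Finset.univ) (s' := fun _ => Finset.univ) (by simp)]
    rw [Finset.sum_comm]
    conv_rhs => rw [Finset.sum_comm]
    refine Finset.sum_congr rfl fun i _ => ?_
    conv_rhs => rw [Finset.sum_comm]
    exact Finset.sum_congr rfl fun j _ => Finset.sum_congr rfl fun l _ => (mul_assoc _ _ _).symm
  -- Both halves of `hdg` give `R` by torsionfreeness: the first after exchanging the summation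
  -- indices, the second after supercommuting `ξ i` and `ξ j`.
  have h2 : ∑ i, ∑ j, sgn (p k * (p i + p j)) • (ξ i * ξ j * dg k j i) = R + R := by
    simp only [hdg, mul_add, mul_smul_comm, smul_add, Finset.sum_add_distrib, hR]
    congr 1
    · rw [Finset.sum_comm]
      refine Finset.sum_congr rfl fun i _ => Finset.sum_congr rfl fun j _ => ?_
      rw [hGt k i j, mul_smul_comm]
      refine sgn_smul_sgn_smul ?_ _
      have : ∀ a b c : ZMod 2, a * b + a * c + a * c = b * a := by decide
      exact this _ _ _
    · refine Finset.sum_congr rfl fun i _ => Finset.sum_congr rfl fun j _ => ?_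
      rw [hGt k i j, mul_smul_comm, hsw i j, smul_mul_assoc]
      rw [smul_smul, smul_smul, smul_smul, ← sgn_add, ← sgn_add, ← sgn_add]
      congr 2
      have : ∀ a b c : ZMod 2, c * a + c * b + b * a + c * a + a * b = b * c := by decide
      exact this _ _ _
  rw [h2, h1, add_sub_cancel_left, ← two_smul ℝ R, smul_smul]
  norm_num

/-- Contracting with the inverse metric after lowering an index. -/
lemma raise_lower {h : ι → ι → Gr P O} [DecidableEq ι]
    (hinv : ∀ j k, ∑ i, h i j * g i k = if j = k then 1 else 0) (k : ι) :
    ∑ m, sgn (p m + p k) • (h m k * ∑ j, sgn (p m + p j) • (g m j * ξ j)) = ξ k := by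
  have h1 : ∀ m, sgn (p m + p k) • (h m k * ∑ j, sgn (p m + p j) • (g m j * ξ j)) =
      ∑ j, sgn (p k + p j) • (h m k * g m j * ξ j) := fun m => by
    rw [Finset.mul_sum, Finset.smul_sum]
    refine Finset.sum_congr rfl fun j _ => ?_
    rw [mul_smul_comm, mul_assoc]
    refine sgn_smul_sgn_smul ?_ _
    have : ∀ a b c : ZMod 2, a + b + (a + c) = b + c := by decide
    exact this _ _ _
  simp only [h1]
  rw [Finset.sum_comm]
  simp only [← Finset.smul_sum, ← Finset.sum_mul, hinv, ite_mul, one_mul, zero_mul, smul_ite,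
    smul_zero, Finset.sum_ite_eq, Finset.mem_univ, if_true]
  rw [CharTwo.add_self_eq_zero, sgn_zero, one_smul]

/-- Lowering an index after contracting with the inverse metric. -/
lemma lower_raise {h : ι → ι → Gr P O} {a : ι → Gr P O} [DecidableEq ι]
    (hg : ∀ i j, g i j ∈ Gr.par (p i + p j))
    (hsymm : ∀ i j, g j i = sgn (p i * p j) • g i j)
    (hinv : ∀ i k, ∑ j, g i j * h k j = if i = k then 1 else 0)
    {η : ι → Gr P O} (hηp : ∀ l, η l ∈ Gr.par (p l))
    (hη : ∀ l, η l = ∑ m, sgn (p m + p l) • (h m l * a m)) (i : ι) :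
    ∑ j, η j * g j i = sgn (p i) • a i := by
  have h1 : ∀ j, η j * g j i = ∑ m, sgn (p m) • (g i j * h m j * a m) := fun j => by
    rw [Gr.supercomm (hηp j) (hg j i), hsymm i j, hη j, smul_mul_assoc, Finset.mul_sum,
      Finset.smul_sum, Finset.smul_sum]
    refine Finset.sum_congr rfl fun m _ => ?_
    rw [mul_smul_comm, mul_assoc, smul_smul, smul_smul, ← sgn_add, ← sgn_add]
    congr 2
    have : ∀ a b c : ZMod 2, b * (b + a) + a * b + (c + b) = c := by decide
    exact this _ _ _
  simp only [h1]
  rw [Finset.sum_comm]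
  simp only [← Finset.smul_sum, ← Finset.sum_mul, hinv, ite_mul, one_mul, zero_mul, smul_ite,
    smul_zero, Finset.sum_ite_eq, Finset.mem_univ, if_true]

/-- The two index orders in the definition of the Legendre map. -/
lemma lower_comm (hξ : ∀ i, ξ i ∈ Gr.par (p i)) (hg : ∀ i j, g i j ∈ Gr.par (p i + p j))
    (hsymm : ∀ i j, g j i = sgn (p i * p j) • g i j) (k : ι) :
    ∑ j, sgn (p k + p j) • (g k j * ξ j) = sgn (p k) • ∑ j, ξ j * g j k := by
  rw [Finset.smul_sum]
  refine Finset.sum_congr rfl fun j _ => ?_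
  rw [Gr.supercomm (hξ j) (hg j k), hsymm k j, smul_mul_assoc, smul_smul, smul_smul, ← sgn_add,
    ← sgn_add]
  congr 2
  have : ∀ a b : ZMod 2, b + a = b + a * (a + b) + b * a := by decide
  exact this _ _

/-- Multiplying by the inverse metric on the right recovers `w`; this is how nondegeneracy enters
the passage from the Euler–Lagrange equations to Newton's. -/
lemma eq_zero_of_forall_sum_mul_eq_zero {h : ι → ι → Gr P O} {w : ι → Gr P O} [DecidableEq ι]
    (hinv : ∀ i k, ∑ j, g i j * h k j = if i = k then 1 else 0)
    (hw : ∀ k, ∑ l, w l * g l k = 0) (m : ι) : w m = 0 := by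
  have h1 : ∑ k, (∑ l, w l * g l k) * h m k = w m := by
    simp only [Finset.sum_mul, mul_assoc]
    rw [Finset.sum_comm]
    simp only [← Finset.mul_sum, hinv, mul_ite, mul_one, mul_zero, Finset.sum_ite_eq',
      Finset.mem_univ, if_true]
  rw [← h1]
  simp [hw]

end Algebra

/-! ### Derivatives of quadratic superfunctions -/

section Quadratic

variable {P : Type*} [Ring P] [Algebra ℝ P] [SmallSuperalgebra P]
variable {E O : Type*} [Fintype E] [DecidableEq E] [Fintype O] [DecidableEq O] {ι : Type*}
  [Fintype ι] {p : ι → ZMod 2} {W : Set (E → ℝ)} {z : E → ℝ} {ζ : ι → SFun P E O}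
  {G : ι → ι → SFun P E O}

lemma isSFunOn_quadratic (hζ : ∀ i, IsSFunOn W (p i) (ζ i))
    (hG : ∀ i j, IsSFunOn W (p i + p j) (G i j)) (i j : ι) :
    IsSFunOn W 0 (ζ i * ζ j * G j i) :=
  (((hζ i).mul (hζ j)).mul (hG j i)).of_eq (by
    rw [add_comm (p j), CharTwo.add_self_eq_zero])

/-- By graded symmetry of `G`, differentiating the first or the second linear factor gives the same
sum, which absorbs the factor one half. It is applied both to the velocities `ξ^i` and to the fibre
components of the inverse Legendre map. -/
lemma pd_quadratic (hW : IsOpen W) (hz : z ∈ W) (hζ : ∀ i, IsSFunOn W (p i) (ζ i))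
    (hG : ∀ i j, IsSFunOn W (p i + p j) (G i j))
    (hsymm : ∀ i j, G j i z = sgn (p i * p j) • G i j z) (I : E ⊕ O) :
    pd I ((1 / 2 : ℝ) • ∑ i, ∑ j, ζ i * ζ j * G j i) z =
      ∑ i, pd I (ζ i) z * ∑ j, ζ j z * G j i z +
        (1 / 2 : ℝ) • ∑ i, ∑ j, sgn (par I * (p i + p j)) • (ζ i z * ζ j z * pd I (G j i) z) := by
  have hq := isSFunOn_quadratic hζ hG
  have hprod : ∀ i j, pd I (ζ i * ζ j * G j i) z = pd I (ζ i) z * (ζ j z * G j i z) +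
      sgn (par I * p i) • (ζ i z * pd I (ζ j) z * G j i z) +
      sgn (par I * (p i + p j)) • (ζ i z * ζ j z * pd I (G j i) z) := fun i j => by
    rw [IsSFunOn.pd_mul hW hz ((hζ i).mul (hζ j)) ((hG j i).differentiableAt hW hz),
      IsSFunOn.pd_mul hW hz (hζ i) ((hζ j).differentiableAt hW hz), add_mul, smul_mul_assoc,
      mul_assoc]
    rfl
  have hswap : ∑ i, ∑ j, sgn (par I * p i) • (ζ i z * pd I (ζ j) z * G j i z) =
      ∑ i, ∑ j, pd I (ζ i) z * (ζ j z * G j i z) := by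
    rw [Finset.sum_comm]
    refine Finset.sum_congr rfl fun i _ => Finset.sum_congr rfl fun j _ => ?_
    rw [Gr.supercomm ((hζ j).2 z hz) (((hζ i).pd hW I).2 z hz), hsymm j i, smul_mul_assoc,
      mul_smul_comm, mul_assoc, smul_smul, smul_smul, ← sgn_add, ← sgn_add]
    have : ∀ a b c : ZMod 2, a * b + b * (a + c) + b * c = 0 := by decide
    rw [this, sgn_zero, one_smul]
  rw [pd_smul I _ ((IsSFunOn.sum fun i _ => IsSFunOn.sum fun j _ => hq i j).differentiableAt hW hz),
    pd_sum I fun i _ => (IsSFunOn.sum fun j _ => hq i j).differentiableAt hW hz]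
  have hin : ∀ i, pd I (∑ j, ζ i * ζ j * G j i) z = ∑ j, pd I (ζ i * ζ j * G j i) z := fun i =>
    pd_sum I fun j _ => (hq i j).differentiableAt hW hz
  simp only [hin, hprod, Finset.sum_add_distrib, hswap, ← Finset.mul_sum]
  rw [smul_add, ← two_smul ℝ, smul_smul]
  norm_num

end Quadratic

/-! ### Further properties of the pullback -/

section PullMore

variable {P : Type*} [Ring P] [Algebra ℝ P] [SmallSuperalgebra P]
variable {E O E' O' : Type*} [Fintype E] [DecidableEq E] [Fintype O] [DecidableEq O]
  [Fintype E'] [DecidableEq E'] [Fintype O'] [DecidableEq O']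
variable {Φ : E' ⊕ O' → SFun P E O} {x : E → ℝ} {V : Set (E' → ℝ)} {f : SFun P E' O'}

/-- The increments are even, so each Taylor term keeps the parity of the superfunction. -/
lemma taylorTerm_mem {δ : E' → Gr P O} {S : Gr P O' →ₗ[ℝ] Gr P O} {y : E' → ℝ} {k : ZMod 2}
    (hδ : ∀ e, δ e ∈ Gr.par 0) (hS : ∀ z ∈ Gr.par k, S z ∈ Gr.par k) (hV : IsOpen V)
    (hf : IsSFunOn V k f) (hy : y ∈ V) (n : ℕ) : taylorTerm δ S n f y ∈ Gr.par k := by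
  induction n generalizing f with
  | zero => exact hS _ (hf.2 y hy)
  | succ n ih =>
    exact Submodule.sum_mem _ fun e _ => Gr.mul_mem_par (hδ e)
      (ih ((hf.pd hV (.inl e)).of_eq (zero_add k))) (zero_add k)

lemma pull_mem (hΦ : ∀ j, Φ j x ∈ Gr.par (par j)) (hV : IsOpen V) {k : ZMod 2}
    (hf : IsSFunOn V k f) (hx : bodyMap Φ x ∈ V) : pull Φ f x ∈ Gr.par k := by
  rw [pull_eq_sum_taylorTerm hΦ hV hf.1 hx le_rfl]
  refine Submodule.sum_mem _ fun n _ => Submodule.smul_mem _ _ (taylorTerm_mem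
    (fun e => (increment_mem hΦ e).1) (fun z hz => ?_) hV hf hx n)
  rw [Gr.subst_eq fun o => hΦ (.inr o)]
  exact Gr.substHom_mem _ hz

lemma pull_one (hΦ : ∀ j, Φ j x ∈ Gr.par (par j)) : pull Φ 1 x = 1 := by
  have h := pull_eq_sum_taylorTerm (f := 1) hΦ isOpen_univ contDiffOn_const
    (Set.mem_univ _) (Nat.le_succ _)
  have h0 : ∀ k, taylorTerm (increment Φ x) (Gr.subst fun o => Φ (.inr o) x) (k + 1)
      (1 : SFun P E' O') (bodyMap Φ x) = 0 := taylorTerm_const 1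
  rw [h, Finset.sum_range_succ', Finset.sum_eq_zero fun k _ => by rw [h0, smul_zero], zero_add,
    Nat.factorial_zero, Nat.cast_one, inv_one, one_smul]
  exact (Gr.subst_eq (fun o => hΦ (.inr o)) _).trans (map_one _)

/-- Pullback of a relation between two families of superfunctions that are inverse to each other. -/
lemma pull_sum_mul_eq_ite (hΦ : ∀ j, Φ j x ∈ Gr.par (par j)) (hV : IsOpen V)
    (hx : bodyMap Φ x ∈ V) {ι : Type*} [Fintype ι] {F G : ι → SFun P E' O'}
    (hF : ∀ i, ContDiffOn ℝ ∞ (F i) V) (hG : ∀ i, ContDiffOn ℝ ∞ (G i) V) {c : Prop} [Decidable c]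
    (h : ∀ y ∈ V, ∑ i, F i y * G i y = if c then 1 else 0) :
    ∑ i, pull Φ (F i) x * pull Φ (G i) x = if c then 1 else 0 := by
  have h1 : ∑ i, pull Φ (F i) x * pull Φ (G i) x = pull Φ (∑ i, F i * G i) x := by
    rw [pull_sum (F := fun i => F i * G i) hΦ hV (fun i _ => ContDiffOn.gr_mul (hF i) (hG i)) hx]
    exact Finset.sum_congr rfl fun i _ => (pull_mul hΦ hV (hF i) (hG i) hx).symm
  rw [h1]
  split_ifs with hc
  · rw [pull_congr (f := 1) hΦ hV contDiffOn_const hx fun y hy => by simpa [hc] using h y hy]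
    exact pull_one hΦ
  · rw [pull_congr (f := 0) hΦ hV contDiffOn_const hx fun y hy => by simpa [hc] using h y hy]
    exact pull_zero hΦ

end PullMore

/-! ### Bundle charts -/

section BundleCharts

variable {P : Type*} [Ring P] [Algebra ℝ P] [SmallSuperalgebra P]
variable {E O : Type*} [Fintype E] [DecidableEq E] [Fintype O] [DecidableEq O]

@[simp] lemma par_bas (i : E ⊕ O) : par (bas i) = par i := by cases i <;> rfl

@[simp] lemma par_fib (i : E ⊕ O) : par (fib i) = par i := by cases i <;> rfl

@[simp] lemma bundleTuple_bas {α : Type*} (u v : E ⊕ O → α) (i : E ⊕ O) :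
    bundleTuple u v (bas i) = u i := by cases i <;> rfl

@[simp] lemma bundleTuple_fib {α : Type*} (u v : E ⊕ O → α) (i : E ⊕ O) :
    bundleTuple u v (fib i) = v i := by cases i <;> rfl

lemma bas_or_fib (J : (E ⊕ E) ⊕ (O ⊕ O)) : (∃ i, J = bas i) ∨ ∃ i, J = fib i := by
  rcases J with (e | e) | (o | o)
  exacts [.inl ⟨.inl e, rfl⟩, .inr ⟨.inl e, rfl⟩, .inl ⟨.inr o, rfl⟩, .inr ⟨.inr o, rfl⟩]

lemma forall_bundle {q : (E ⊕ E) ⊕ (O ⊕ O) → Prop} :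
    (∀ J, q J) ↔ (∀ i, q (bas i)) ∧ ∀ i, q (fib i) := by
  refine ⟨fun h => ⟨fun i => h _, fun i => h _⟩, fun h J => ?_⟩
  obtain ⟨i, rfl⟩ | ⟨i, rfl⟩ := bas_or_fib J
  exacts [h.1 i, h.2 i]

lemma sum_bundle {A : Type*} [AddCommMonoid A] (F : (E ⊕ E) ⊕ (O ⊕ O) → A) :
    ∑ J, F J = ∑ i, F (bas i) + ∑ i, F (fib i) := by
  simp only [Fintype.sum_sum_type]
  exact add_add_add_comm _ _ _ _

lemma bas_injective : Function.Injective (bas : E ⊕ O → _) := by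
  rintro (e | o) (e' | o') h <;> simp_all [bas]

lemma fib_injective : Function.Injective (fib : E ⊕ O → _) := by
  rintro (e | o) (e' | o') h <;> simp_all [fib]

lemma bas_ne_fib (i j : E ⊕ O) : bas i ≠ fib j := by
  rcases i with e | o <;> rcases j with e' | o' <;> simp [bas, fib]

lemma pd_fib_coord_fib (i j : E ⊕ O) (z : E ⊕ E → ℝ) :
    pd (fib i) (coord (P := P) (fib j)) z = if j = i then 1 else 0 := by
  rw [pd_coord]
  simp only [fib_injective.eq_iff]

lemma pd_bas_coord_fib (i j : E ⊕ O) (z : E ⊕ E → ℝ) :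
    pd (bas i) (coord (P := P) (fib j)) z = 0 := by
  rw [pd_coord, if_neg (bas_ne_fib i j).symm]

lemma pd_coord_bas (I : (E ⊕ E) ⊕ (O ⊕ O)) (j : E ⊕ O) (z : E ⊕ E → ℝ) :
    pd I (coord (P := P) (bas j)) z = if bas j = I then 1 else 0 :=
  pd_coord _ _ _

lemma isSFunOn_coord_fib (W : Set (E ⊕ E → ℝ)) (i : E ⊕ O) :
    IsSFunOn W (par i) (coord (P := P) (fib i)) :=
  (isSFunOn_coord W (fib i)).of_eq (par_fib i)

/-! #### The symplectic form and Hamiltonian vectorfields -/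

lemma liouville_bas (i : E ⊕ O) :
    liouville (P := P) (bas i) = sgn (par i) • coord (fib i) := bundleTuple_bas _ _ i

lemma liouville_fib (i : E ⊕ O) : liouville (P := P) (E := E) (O := O) (fib i) = 0 :=
  bundleTuple_fib _ _ i

lemma pd_liouville_bas (I : (E ⊕ E) ⊕ (O ⊕ O)) (j : E ⊕ O) (z : E ⊕ E → ℝ) :
    pd I (liouville (P := P) (bas j)) z = if fib j = I then algebraMap ℝ _ (sgn (par j)) else 0 := by
  rw [liouville_bas, pd_smul I _ ((isSFunOn_coord Set.univ _).differentiableAt isOpen_univ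
    (Set.mem_univ z)), pd_coord, smul_ite, smul_zero, Algebra.algebraMap_eq_smul_one]

lemma pd_liouville_fib (I : (E ⊕ E) ⊕ (O ⊕ O)) (j : E ⊕ O) (z : E ⊕ E → ℝ) :
    pd I (liouville (P := P) (fib j)) z = 0 := by
  rw [liouville_fib]
  cases I with
  | inl e =>
    have : (0 : SFun P (E ⊕ E) (O ⊕ O)) = fun _ => 0 := rfl
    rw [pd_inl, this, fderiv_const_apply]
    rfl
  | inr o => exact map_zero _

lemma symplecticForm_apply (I J : (E ⊕ E) ⊕ (O ⊕ O)) (z : E ⊕ E → ℝ) :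
    symplecticForm (P := P) I J z =
      pd I (liouville J) z - sgn (par I * par J) • pd J (liouville I) z := rfl

/-- The coordinates `(x^i, a_i)` are Darboux coordinates: the only nonzero coefficients of `ω` pair
`x^k` with `a_k`. This lemma and `sum_symplecticForm_bas` thus isolate single components of a
vectorfield, which is how the equation `ω(·, Y) = dH` is solved for `Y`. -/
lemma sum_symplecticForm_fib (Y : (E ⊕ E) ⊕ (O ⊕ O) → Gr P (O ⊕ O)) (k : E ⊕ O)
    (z : E ⊕ E → ℝ) :
    ∑ J, sgn (par (fib k) * par J) • (Y J * symplecticForm (fib k) J z) = Y (bas k) := by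
  rw [sum_bundle]
  simp only [symplecticForm_apply, pd_liouville_bas, pd_liouville_fib, smul_zero, sub_zero,
    mul_zero, Finset.sum_const_zero, add_zero, fib_injective.eq_iff, par_fib, par_bas]
  rw [Finset.sum_eq_single k]
  · rw [if_pos rfl, Algebra.algebraMap_eq_smul_one, mul_smul_comm, mul_one]
    have h : ∀ a : ZMod 2, a * a + a = 0 := by decide
    rw [sgn_smul_sgn_smul (h _), sgn_zero, one_smul]
  · intro j _ hj
    rw [if_neg hj, mul_zero, smul_zero]
  · simp

lemma sum_symplecticForm_bas (Y : (E ⊕ E) ⊕ (O ⊕ O) → Gr P (O ⊕ O)) (k : E ⊕ O)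
    (z : E ⊕ E → ℝ) :
    ∑ J, sgn (par (bas k) * par J) • (Y J * symplecticForm (bas k) J z) =
      -(sgn (par k) • Y (fib k)) := by
  rw [sum_bundle]
  simp only [symplecticForm_apply, pd_liouville_bas, pd_liouville_fib, smul_zero, sub_zero,
    fib_injective.eq_iff, par_fib, par_bas, if_neg (bas_ne_fib _ _).symm, mul_zero,
    Finset.sum_const_zero, zero_add, zero_sub]
  rw [Finset.sum_eq_single k]
  · rw [if_pos rfl, mul_neg, smul_neg, Algebra.algebraMap_eq_smul_one, mul_smul_comm, mul_smul_comm,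
      mul_one, sgn_smul_sgn_smul_self]
  · intro j _ hj
    rw [if_neg (Ne.symm hj), smul_zero, neg_zero, mul_zero, smul_zero]
  · simp

end BundleCharts

/-! ### Smoothness and pullback of bilinear and quadratic expressions -/

section Smooth

variable {P : Type*} [Ring P] [Algebra ℝ P] [SmallSuperalgebra P]
variable {E O E' O' : Type*} [Fintype E] [DecidableEq E] [Fintype O] [DecidableEq O]
  [Fintype E'] [DecidableEq E'] [Fintype O'] [DecidableEq O']
variable {U : Set (E → ℝ)} {f h : SFun P E O}

lemma smooth_mul (hf : ContDiffOn ℝ ∞ f U) (hh : ContDiffOn ℝ ∞ h U) :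
    ContDiffOn ℝ ∞ (f * h) U := ContDiffOn.gr_mul hf hh

lemma smooth_sum {ι : Type*} {s : Finset ι} {F : ι → SFun P E O}
    (hF : ∀ i, ContDiffOn ℝ ∞ (F i) U) : ContDiffOn ℝ ∞ (∑ i ∈ s, F i) U := by
  have := ContDiffOn.sum (s := s) fun i _ => hF i
  convert this using 1
  ext x
  simp

lemma bodyMap_congr_left {Φ Ψ : E' ⊕ O' → SFun P E O} {x : E → ℝ} (h : ∀ j, Φ j x = Ψ j x) :
    bodyMap Φ x = bodyMap Ψ x := by
  ext e
  rw [bodyMap, bodyMap, h]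

lemma pull_congr_left {Φ Ψ : E' ⊕ O' → SFun P E O} {x : E → ℝ} (h : ∀ j, Φ j x = Ψ j x)
    (f : SFun P E' O') : pull Φ f x = pull Ψ f x := by
  unfold pull
  simp only [bodyMap_congr_left h, h]

lemma pull_quadratic {Φ : E' ⊕ O' → SFun P E O} {x : E → ℝ} {V : Set (E' → ℝ)}
    (hΦ : ∀ j, Φ j x ∈ Gr.par (par j)) (hV : IsOpen V) (hx : bodyMap Φ x ∈ V) {ι : Type*}
    [Fintype ι] {ζ : ι → SFun P E' O'} {F : ι → ι → SFun P E' O'}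
    (hζ : ∀ i, ContDiffOn ℝ ∞ (ζ i) V) (hF : ∀ i j, ContDiffOn ℝ ∞ (F i j) V) (r : ℝ)
    (c : ι → ι → ℝ) :
    pull Φ (r • ∑ i, ∑ j, c i j • (ζ i * ζ j * F i j)) x =
      r • ∑ i, ∑ j, c i j • (pull Φ (ζ i) x * pull Φ (ζ j) x * pull Φ (F i j) x) := by
  have h2 : ∀ i j, ContDiffOn ℝ ∞ (ζ i * ζ j) V := fun i j => smooth_mul (hζ i) (hζ j)
  have h3 : ∀ i j, ContDiffOn ℝ ∞ (ζ i * ζ j * F i j) V := fun i j => smooth_mul (h2 i j) (hF i j)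
  have h4 : ∀ i j, ContDiffOn ℝ ∞ (c i j • (ζ i * ζ j * F i j)) V := fun i j =>
    contDiffOn_const.smul (h3 i j)
  have h5 : ∀ i, ContDiffOn ℝ ∞ (∑ j, c i j • (ζ i * ζ j * F i j)) V := fun i => smooth_sum (h4 i)
  rw [pull_smul hΦ hV (smooth_sum h5) hx, pull_sum hΦ hV (fun i _ => h5 i) hx]
  congr 1
  refine Finset.sum_congr rfl fun i _ => ?_
  rw [pull_sum hΦ hV (fun j _ => h4 i j) hx]
  refine Finset.sum_congr rfl fun j _ => ?_
  rw [pull_smul hΦ hV (h3 i j) hx, pull_mul hΦ hV (h2 i j) (hF i j) hx,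
    pull_mul hΦ hV (hζ i) (hζ j) hx]

lemma pull_bilinear {Φ : E' ⊕ O' → SFun P E O} {x : E → ℝ} {V : Set (E' → ℝ)}
    (hΦ : ∀ j, Φ j x ∈ Gr.par (par j)) (hV : IsOpen V) (hx : bodyMap Φ x ∈ V) {ι : Type*}
    [Fintype ι] {F G : ι → SFun P E' O'} (hF : ∀ i, ContDiffOn ℝ ∞ (F i) V)
    (hG : ∀ i, ContDiffOn ℝ ∞ (G i) V) (c : ι → ℝ) :
    pull Φ (∑ i, c i • (F i * G i)) x = ∑ i, c i • (pull Φ (F i) x * pull Φ (G i) x) := by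
  rw [pull_sum (F := fun i => c i • (F i * G i)) hΦ hV
    (fun i _ => contDiffOn_const.smul (smooth_mul (hF i) (hG i))) hx]
  refine Finset.sum_congr rfl fun i _ => ?_
  rw [← pull_mul hΦ hV (hF i) (hG i) hx, ← pull_smul hΦ hV (smooth_mul (hF i) (hG i)) hx]

end Smooth

/-! ### The Lagrangian -/

section Mechanics

variable {P : Type*} [Ring P] [Algebra ℝ P] [SmallSuperalgebra P]
variable {E O : Type*} [Fintype E] [DecidableEq E] [Fintype O] [DecidableEq O]
variable {M : SuperAtlas P E O} (g : RiemannianSupermetric M) {a : M.Chart}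
  {V : M.Fun} {z : E ⊕ E → ℝ}

namespace RiemannianSupermetric

lemma inv_isSFunOn (k l : E ⊕ O) : IsSFunOn (M.dom a a) (par k + par l) (g.inv a k l) :=
  (g.nondeg a).choose_spec.1 k l

lemma coeff_mul_inv {x : E → ℝ} (hx : x ∈ M.dom a a) (i k : E ⊕ O) :
    ∑ j, g.coeff a i j x * g.inv a k j x = if i = k then 1 else 0 :=
  (g.nondeg a).choose_spec.2.1 x hx i k

lemma inv_mul_coeff {x : E → ℝ} (hx : x ∈ M.dom a a) (j k : E ⊕ O) :
    ∑ i, g.inv a i j x * g.coeff a i k x = if j = k then 1 else 0 :=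
  (g.nondeg a).choose_spec.2.2 x hx j k

lemma pullProj_symm (hz : projL E z ∈ M.dom a a) (i j : E ⊕ O) :
    pullProj (g.coeff a j i) z = sgn (par i * par j) • pullProj (g.coeff a i j) z := by
  rw [pullProj_apply, pullProj_apply, g.symm a _ hz i j, map_smul]

end RiemannianSupermetric

lemma kinetic_isSFunOn : IsSFunOn (projL E ⁻¹' M.dom a a) 0 (kinetic g a) :=
  (IsSFunOn.sum fun i _ => IsSFunOn.sum fun j _ => isSFunOn_quadratic
    (G := fun i j => pullProj (g.coeff a i j)) (isSFunOn_coord_fib _)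
    (fun i j => (g.smooth a i j).pullProj) i j).smul _

lemma lagrangian_isSFunOn (hV : IsSFunOn (M.dom a a) 0 (V a)) :
    IsSFunOn (projL E ⁻¹' M.dom a a) 0 (lagrangian g V a) :=
  (kinetic_isSFunOn g).sub hV.pullProj

lemma pd_lagrangian (hU : IsOpen (M.dom a a)) (hV : IsSFunOn (M.dom a a) 0 (V a))
    (hz : projL E z ∈ M.dom a a) (I : (E ⊕ E) ⊕ (O ⊕ O)) :
    pd I (lagrangian g V a) z = ∑ i, pd I (coord (fib i)) z *
        ∑ j, coord (fib j) z * pullProj (g.coeff a j i) z +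
      (1 / 2 : ℝ) • ∑ i, ∑ j, sgn (par I * (par i + par j)) •
        (coord (fib i) z * coord (fib j) z * pd I (pullProj (g.coeff a j i)) z) -
      pd I (pullProj (V a)) z := by
  have hW := isOpen_projL_preimage hU
  rw [← pd_quadratic (G := fun i j => pullProj (g.coeff a i j)) hW hz (isSFunOn_coord_fib _)
    (fun i j => (g.smooth a i j).pullProj) (g.pullProj_symm hz) I]
  exact pd_sub I ((kinetic_isSFunOn g).differentiableAt hW hz)
    (hV.pullProj.differentiableAt hW hz)

lemma pd_fib_lagrangian (hU : IsOpen (M.dom a a)) (hV : IsSFunOn (M.dom a a) 0 (V a))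
    (hz : projL E z ∈ M.dom a a) (k : E ⊕ O) :
    pd (fib k) (lagrangian g V a) z = ∑ i, coord (fib i) z * pullProj (g.coeff a i k) z := by
  rw [pd_lagrangian g hU hV hz, pd_fib_pullProj (hV.differentiableAt hU hz)]
  have h : ∀ i j, pd (fib k) (pullProj (g.coeff a j i)) z = 0 := fun i j =>
    pd_fib_pullProj ((g.smooth a j i).differentiableAt hU hz) k
  simp only [h, pd_fib_coord_fib, mul_zero, smul_zero, Finset.sum_const_zero, add_zero, sub_zero,
    ite_mul, one_mul, zero_mul, Finset.sum_ite_eq', Finset.mem_univ, if_true]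

lemma pd_bas_lagrangian (hU : IsOpen (M.dom a a)) (hV : IsSFunOn (M.dom a a) 0 (V a))
    (hz : projL E z ∈ M.dom a a) (k : E ⊕ O) :
    pd (bas k) (lagrangian g V a) z =
      (1 / 2 : ℝ) • ∑ i, ∑ j, sgn (par k * (par i + par j)) •
        (coord (fib i) z * coord (fib j) z * pullProj (pd k (g.coeff a j i)) z) -
      pullProj (pd k (V a)) z := by
  rw [pd_lagrangian g hU hV hz, pd_bas_pullProj (hV.differentiableAt hU hz)]
  have h : ∀ i j, pd (bas k) (pullProj (g.coeff a j i)) z = pullProj (pd k (g.coeff a j i)) z :=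
    fun i j => pd_bas_pullProj ((g.smooth a j i).differentiableAt hU hz) k
  simp only [h, pd_bas_coord_fib, zero_mul, Finset.sum_const_zero, zero_add, par_bas]

/-- The derivative of the potential in terms of its gradient. -/
lemma IsSuperGradient.pullProj_pd {X : M.Field} (hX : IsSuperGradient g V X)
    (hz : projL E z ∈ M.dom a a) (k : E ⊕ O) :
    pullProj (pd k (V a)) z = ∑ l, pullProj (X a l) z * pullProj (g.coeff a l k) z := by
  simp only [pullProj_apply]
  rw [hX.eq a _ hz k, map_sum]
  refine Finset.sum_congr rfl fun l _ => ?_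
  rw [← map_mul, g.symm a _ hz k l, mul_smul_comm]

/-- The base derivatives of the Lagrangian in terms of the Levi-Civita connection. -/
lemma pd_bas_lagrangian_eq {C : AffineConnection M} (hC : IsLeviCivita g C) {X : M.Field}
    (hX : IsSuperGradient g V X) (hU : IsOpen (M.dom a a))
    (hV : IsSFunOn (M.dom a a) 0 (V a)) (hz : projL E z ∈ M.dom a a) (k : E ⊕ O) :
    pd (bas k) (lagrangian g V a) z =
      ∑ i, ∑ j, coord (fib j) z * coord (fib i) z * pullProj (pd i (g.coeff a j k)) z -
      ∑ l, (∑ i, ∑ j, coord (fib j) z * coord (fib i) z * pullProj (C.Γ a i j l) z +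
        pullProj (X a l) z) * pullProj (g.coeff a l k) z := by
  rw [pd_bas_lagrangian g hU hV hz, hX.pullProj_pd g hz,
    half_sum_metric_derivative (p := par) (ξ := fun i => coord (fib i) z)
      (g := fun i j => pullProj (g.coeff a i j) z)
      (dg := fun i j k => pullProj (pd i (g.coeff a j k)) z)
      (Γ := fun i j k => pullProj (C.Γ a i j k) z)
      (fun i => (isSFunOn_coord_fib Set.univ i).2 z (Set.mem_univ z)) (g.pullProj_symm hz)
      (fun i j k => ?_) (fun i j r => ?_) k]
  · simp only [add_mul, Finset.sum_add_distrib]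
    rw [sub_sub]
  · simp only [pullProj_apply]
    rw [hC.torsionfree a _ hz i j k, map_smul]
  · simp only [pullProj_apply]
    rw [hC.compatible a _ hz i j r]
    simp only [map_add, map_sum, map_smul, map_mul]

/-! ### The Legendre map -/

lemma legendre_bas (i : E ⊕ O) : legendre g a (bas i) = coord (bas i) := bundleTuple_bas _ _ i

lemma legendre_fib (i : E ⊕ O) : legendre g a (fib i) =
    ∑ j, sgn (par i + par j) • (pullProj (g.coeff a i j) * coord (fib j)) := bundleTuple_fib _ _ i

lemma legendreInv_bas (i : E ⊕ O) : legendreInv g a (bas i) = coord (bas i) :=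
  bundleTuple_bas _ _ i

lemma legendreInv_fib (l : E ⊕ O) : legendreInv g a (fib l) =
    ∑ k, sgn (par k + par l) • (pullProj (g.inv a k l) * coord (fib k)) := bundleTuple_fib _ _ l

lemma legendre_isSFunOn (J : (E ⊕ E) ⊕ (O ⊕ O)) :
    IsSFunOn (projL E ⁻¹' M.dom a a) (par J) (legendre g a J) := by
  obtain ⟨i, rfl⟩ | ⟨i, rfl⟩ := bas_or_fib J
  · rw [legendre_bas]
    exact isSFunOn_coord _ _
  · rw [legendre_fib, par_fib]
    refine IsSFunOn.sum fun j _ => (((g.smooth a i j).pullProj.mul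
      (isSFunOn_coord_fib _ j)).of_eq ?_).smul _
    rw [add_assoc, CharTwo.add_self_eq_zero, add_zero]

lemma legendreInv_isSFunOn (J : (E ⊕ E) ⊕ (O ⊕ O)) :
    IsSFunOn (projL E ⁻¹' M.dom a a) (par J) (legendreInv g a J) := by
  obtain ⟨i, rfl⟩ | ⟨i, rfl⟩ := bas_or_fib J
  · rw [legendreInv_bas]
    exact isSFunOn_coord _ _
  · rw [legendreInv_fib, par_fib]
    refine IsSFunOn.sum fun j _ => (((g.inv_isSFunOn j i).pullProj.mul
      (isSFunOn_coord_fib _ j)).of_eq ?_).smul _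
    rw [add_comm (par j), add_assoc, CharTwo.add_self_eq_zero, add_zero]

lemma legendreInv_fib_isSFunOn (i : E ⊕ O) :
    IsSFunOn (projL E ⁻¹' M.dom a a) (par i) (legendreInv g a (fib i)) :=
  (legendreInv_isSFunOn g (fib i)).of_eq (par_fib i)

/-- Up to the sign `(-1)^|k|` the Legendre map is the fibre derivative of the Lagrangian; this links
Hamilton's equations with those of Euler and Lagrange. -/
lemma legendre_fib_apply (hU : IsOpen (M.dom a a)) (hV : IsSFunOn (M.dom a a) 0 (V a))
    (hz : projL E z ∈ M.dom a a) (k : E ⊕ O) :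
    legendre g a (fib k) z = sgn (par k) • pd (fib k) (lagrangian g V a) z := by
  rw [pd_fib_lagrangian g hU hV hz, ← lower_comm (p := par) (ξ := fun i => coord (fib i) z)
    (g := fun i j => pullProj (g.coeff a i j) z)
    (fun i => (isSFunOn_coord_fib Set.univ i).2 z (Set.mem_univ z))
    (fun i j => (g.smooth a i j).pullProj.2 z hz) (g.pullProj_symm hz), legendre_fib,
    Finset.sum_apply]
  rfl

/-! ### The Hamilton function -/

lemma projL_bodyMap {E' O' : Type*} [Fintype E'] [DecidableEq E'] [Fintype O'] [DecidableEq O']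
    (Ψ : (E ⊕ E) ⊕ (O ⊕ O) → SFun P E' O') (x : E' → ℝ) :
    projL E (bodyMap Ψ x) = bodyMap (fun i : E ⊕ O => Ψ (bas i)) x := rfl

lemma bodyMap_coord_bas (z : E ⊕ E → ℝ) :
    bodyMap (fun i : E ⊕ O => coord (P := P) (bas i)) z = projL E z := by
  ext e
  exact Gr.body_algebraMap _

lemma bodyMap_legendreInv (z : E ⊕ E → ℝ) : projL E (bodyMap (legendreInv g a) z) = projL E z := by
  rw [projL_bodyMap]
  simp only [legendreInv_bas, bodyMap_coord_bas]

lemma pull_legendreInv_kinetic (hU : IsOpen (M.dom a a)) (hz : projL E z ∈ M.dom a a) :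
    pull (legendreInv g a) (kinetic g a) z = ((1 / 2 : ℝ) • ∑ i, ∑ j,
      legendreInv g a (fib i) * legendreInv g a (fib j) * pullProj (g.coeff a j i)) z := by
  have hΦ : ∀ J, legendreInv g a J z ∈ Gr.par (par J) := fun J => (legendreInv_isSFunOn g J).2 z hz
  have hx : projL E (bodyMap (legendreInv g a) z) ∈ M.dom a a := by rwa [bodyMap_legendreInv]
  have h := pull_quadratic hΦ (isOpen_projL_preimage hU) hx (ζ := fun i => coord (fib i))
    (F := fun i j => pullProj (g.coeff a j i)) (fun i => (isSFunOn_coord_fib _ i).1)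
    (fun i j => (g.smooth a j i).pullProj.1) (1 / 2) (fun _ _ => 1)
  simp only [one_smul] at h
  refine h.trans ?_
  simp only [pull_coord hΦ, pull_pullProj hΦ hU (g.smooth a _ _).1 hx, legendreInv_bas]
  rw [Pi.smul_apply, Finset.sum_apply]
  simp only [Finset.sum_apply]
  rfl

lemma sum_legendreInv_mul_coeff (hz : projL E z ∈ M.dom a a) (i : E ⊕ O) :
    ∑ j, legendreInv g a (fib j) z * pullProj (g.coeff a j i) z =
      sgn (par i) • coord (fib i) z :=
  lower_raise (p := par) (g := fun i j => pullProj (g.coeff a i j) z)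
    (h := fun k l => pullProj (g.inv a k l) z) (a := fun i => coord (fib i) z)
    (η := fun l => legendreInv g a (fib l) z)
    (fun i j => (g.smooth a i j).pullProj.2 z hz) (g.pullProj_symm hz)
    (fun i k => by
      simp only [pullProj_apply]
      simp only [← map_mul, ← map_sum]
      rw [g.coeff_mul_inv hz]
      split_ifs
      exacts [map_one _, map_zero _])
    (fun l => (legendreInv_fib_isSFunOn g l).2 z hz)
    (fun l => by rw [legendreInv_fib, Finset.sum_apply]; rfl) i

/-- Lowering the index of one of the two velocities returns the momentum, so the kinetic energy also
equals half the signed pairing of velocity and momentum, without any explicit metric. -/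
lemma kinetic_legendreInv_eq (hz : projL E z ∈ M.dom a a) :
    ((1 / 2 : ℝ) • ∑ i, ∑ j,
      legendreInv g a (fib i) * legendreInv g a (fib j) * pullProj (g.coeff a j i)) z =
    ((1 / 2 : ℝ) • ∑ i, (legendreInv g a (fib i) * (sgn (par i) • coord (fib i)) :
      SFun P (E ⊕ E) (O ⊕ O)) : SFun P (E ⊕ E) (O ⊕ O)) z := by
  simp only [Pi.smul_apply, Finset.sum_apply, Pi.mul_apply, mul_assoc, ← Finset.mul_sum,
    sum_legendreInv_mul_coeff g hz]

/-- The derivatives of the kinetic energy on the cotangent bundle, in two ways. -/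
lemma pd_pull_legendreInv_kinetic (hU : IsOpen (M.dom a a)) (hz : projL E z ∈ M.dom a a)
    (I : (E ⊕ E) ⊕ (O ⊕ O)) :
    pd I (pull (legendreInv g a) (kinetic g a)) z =
      ∑ i, sgn (par I * par i) • (legendreInv g a (fib i) z *
        sgn (par i) • pd I (coord (fib i)) z) -
      (1 / 2 : ℝ) • ∑ i, ∑ j, sgn (par I * (par i + par j)) • (legendreInv g a (fib i) z *
        legendreInv g a (fib j) z * pd I (pullProj (g.coeff a j i)) z) := by
  have hW := isOpen_projL_preimage hU
  have h1 := pd_congr_of_isOpen I hW (fun w hw => pull_legendreInv_kinetic g hU hw) hz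
  have h2 := pd_congr_of_isOpen I hW (fun w hw => kinetic_legendreInv_eq g hw) hz
  have h3 := pd_quadratic (G := fun i j => pullProj (g.coeff a i j)) hW hz
    (legendreInv_fib_isSFunOn g) (fun i j => (g.smooth a i j).pullProj) (g.pullProj_symm hz) I
  simp only [sum_legendreInv_mul_coeff g hz] at h3
  have hs : ∀ i : E ⊕ O, IsSFunOn (projL E ⁻¹' M.dom a a) (par i)
      (sgn (par i) • coord (P := P) (fib i)) := fun i => (isSFunOn_coord_fib _ i).smul _
  have hp : ∀ i, DifferentiableAt ℝ (legendreInv g a (fib i) * (sgn (par i) • coord (fib i)) :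
      SFun P (E ⊕ E) (O ⊕ O)) z :=
    fun i => ((legendreInv_fib_isSFunOn g i).mul (hs i)).differentiableAt hW hz
  have h4 : pd I ((1 / 2 : ℝ) • ∑ i, (legendreInv g a (fib i) * (sgn (par i) • coord (fib i)) :
      SFun P (E ⊕ E) (O ⊕ O))) z =
      (1 / 2 : ℝ) • (∑ i, pd I (legendreInv g a (fib i)) z * sgn (par i) • coord (fib i) z +
        ∑ i, sgn (par I * par i) • (legendreInv g a (fib i) z *
          sgn (par i) • pd I (coord (fib i)) z)) := by
    rw [pd_smul I, pd_sum I fun i _ => hp i, ← Finset.sum_add_distrib]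
    · congr 1
      refine Finset.sum_congr rfl fun i _ => ?_
      rw [IsSFunOn.pd_mul hW hz (legendreInv_fib_isSFunOn g i) ((hs i).differentiableAt hW hz),
        pd_smul I _ ((isSFunOn_coord_fib _ i).differentiableAt hW hz)]
      rfl
    · exact DifferentiableAt.sum fun i _ => hp i
  rw [h1]
  rw [h2, h4] at h3
  rw [h2, h4]
  set D := ∑ i, pd I (legendreInv g a (fib i)) z * sgn (par i) • coord (fib i) z
  set Q := (1 / 2 : ℝ) • ∑ i, ∑ j, sgn (par I * (par i + par j)) • (legendreInv g a (fib i) z *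
        legendreInv g a (fib j) z * pd I (pullProj (g.coeff a j i)) z)
  set S := ∑ i, sgn (par I * par i) • (legendreInv g a (fib i) z *
        sgn (par i) • pd I (coord (fib i)) z)
  have h5 : D + S = (2 : ℝ) • D + (2 : ℝ) • Q := by
    rw [← smul_add, ← h3, smul_smul]
    norm_num
  have h6 : S = D + (2 : ℝ) • Q := by
    rw [two_smul ℝ D, add_assoc] at h5
    exact add_left_cancel h5
  rw [h3, h6, two_smul]
  abel

lemma pd_hamiltonian (hU : IsOpen (M.dom a a)) (hV : IsSFunOn (M.dom a a) 0 (V a))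
    (hz : projL E z ∈ M.dom a a) (I : (E ⊕ E) ⊕ (O ⊕ O)) :
    pd I (hamiltonian g V a) z = pd I (pull (legendreInv g a) (kinetic g a)) z +
      pd I (pullProj (V a)) z := by
  have hW := isOpen_projL_preimage hU
  have hk : IsSFunOn (projL E ⁻¹' M.dom a a) 0 (pull (legendreInv g a) (kinetic g a)) :=
    IsSFunOn.congr ((IsSFunOn.sum fun i _ => IsSFunOn.sum fun j _ => isSFunOn_quadratic
      (G := fun i j => pullProj (g.coeff a i j)) (legendreInv_fib_isSFunOn g)
      (fun i j => (g.smooth a i j).pullProj) i j).smul _)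
      fun w hw => pull_legendreInv_kinetic g hU hw
  exact pd_add I (hk.differentiableAt hW hz) (hV.pullProj.differentiableAt hW hz)

/-- The metric is constant along the fibres, so `Q` drops out and `S` reduces to the velocity
belonging to the momentum: the first half of Hamilton's equations. -/
lemma pd_fib_hamiltonian (hU : IsOpen (M.dom a a)) (hV : IsSFunOn (M.dom a a) 0 (V a))
    (hz : projL E z ∈ M.dom a a) (k : E ⊕ O) :
    pd (fib k) (hamiltonian g V a) z = legendreInv g a (fib k) z := by
  rw [pd_hamiltonian g hU hV hz, pd_pull_legendreInv_kinetic g hU hz,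
    pd_fib_pullProj (hV.differentiableAt hU hz)]
  have h : ∀ i j, pd (fib k) (pullProj (g.coeff a j i)) z = 0 := fun i j =>
    pd_fib_pullProj ((g.smooth a j i).differentiableAt hU hz) k
  simp only [h, pd_fib_coord_fib, mul_zero, smul_zero, Finset.sum_const_zero, add_zero, sub_zero,
    par_fib]
  rw [Finset.sum_eq_single k]
  · rw [if_pos rfl, mul_smul_comm, mul_one]
    have h : ∀ a : ZMod 2, a * a + a = 0 := by decide
    rw [sgn_smul_sgn_smul (h _), sgn_zero, one_smul]
  · intro j _ hj
    rw [if_neg hj, smul_zero, mul_zero, smul_zero]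
  · simp

/-- Fibre coordinates have no base derivative, so only `-Q` and the potential remain. This is minus
the base derivative of the Lagrangian, expressed through momenta. -/
lemma pd_bas_hamiltonian (hU : IsOpen (M.dom a a)) (hV : IsSFunOn (M.dom a a) 0 (V a))
    (hz : projL E z ∈ M.dom a a) (k : E ⊕ O) :
    pd (bas k) (hamiltonian g V a) z = pullProj (pd k (V a)) z -
      (1 / 2 : ℝ) • ∑ i, ∑ j, sgn (par k * (par i + par j)) • (legendreInv g a (fib i) z *
        legendreInv g a (fib j) z * pullProj (pd k (g.coeff a j i)) z) := by
  rw [pd_hamiltonian g hU hV hz, pd_pull_legendreInv_kinetic g hU hz,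
    pd_bas_pullProj (hV.differentiableAt hU hz)]
  have h : ∀ i j, pd (bas k) (pullProj (g.coeff a j i)) z = pullProj (pd k (g.coeff a j i)) z :=
    fun i j => pd_bas_pullProj ((g.smooth a j i).differentiableAt hU hz) k
  simp only [h, pd_bas_coord_fib, smul_zero, mul_zero, Finset.sum_const_zero, zero_sub, par_bas]
  abel

variable {Y : (cotangent M).Field}

lemma IsHamiltonianField.bas_eq (hY : IsHamiltonianField (hamiltonian g V) Y)
    (hU : IsOpen (M.dom a a)) (hV : IsSFunOn (M.dom a a) 0 (V a))
    (hz : projL E z ∈ M.dom a a) (k : E ⊕ O) :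
    Y a (bas k) z = legendreInv g a (fib k) z := by
  rw [← pd_fib_hamiltonian g hU hV hz, ← hY.eq a z hz (fib k),
    sum_symplecticForm_fib (fun J => Y a J z)]

lemma IsHamiltonianField.fib_eq (hY : IsHamiltonianField (hamiltonian g V) Y)
    (hU : IsOpen (M.dom a a)) (hV : IsSFunOn (M.dom a a) 0 (V a))
    (hz : projL E z ∈ M.dom a a) (k : E ⊕ O) :
    Y a (fib k) z = sgn (par k) • ((1 / 2 : ℝ) • ∑ i, ∑ j, sgn (par k * (par i + par j)) •
      (legendreInv g a (fib i) z * legendreInv g a (fib j) z *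
        pullProj (pd k (g.coeff a j i)) z) - pullProj (pd k (V a)) z) := by
  rw [← neg_sub (pullProj (pd k (V a)) z), ← pd_bas_hamiltonian g hU hV hz, ← hY.eq a z hz (bas k),
    sum_symplecticForm_bas (fun J => Y a J z), neg_neg, sgn_smul_sgn_smul_self]

/-- The pullback of the Hamiltonian vectorfield along a morphism whose fibre components arise from
`v` through the Legendre map. -/
lemma IsHamiltonianField.pull_eq (hY : IsHamiltonianField (hamiltonian g V) Y)
    (hU : IsOpen (M.dom a a)) (hV : IsSFunOn (M.dom a a) 0 (V a))
    {E' O' : Type*} [Fintype E'] [DecidableEq E'] [Fintype O'] [DecidableEq O']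
    {Ψ : (E ⊕ E) ⊕ (O ⊕ O) → SFun P E' O'} {b : E ⊕ O → SFun P E' O'} {x : E' → ℝ}
    (hΨ : ∀ J, Ψ J x ∈ Gr.par (par J)) (hb : ∀ i, Ψ (bas i) x = b i x)
    (hx : bodyMap b x ∈ M.dom a a) {v : E ⊕ O → Gr P O'}
    (hv : ∀ i, Ψ (fib i) x = ∑ j, sgn (par i + par j) • (pull b (g.coeff a i j) x * v j))
    (k : E ⊕ O) :
    pull Ψ (Y a (bas k)) x = v k ∧
      pull Ψ (Y a (fib k)) x = sgn (par k) • ((1 / 2 : ℝ) • ∑ i, ∑ j,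
        sgn (par k * (par i + par j)) • (v i * v j * pull b (pd k (g.coeff a j i)) x) -
          pull b (pd k (V a)) x) := by
  have hW := isOpen_projL_preimage hU
  have hx' : projL E (bodyMap Ψ x) ∈ M.dom a a := by
    rwa [projL_bodyMap, bodyMap_congr_left hb]
  have hpp : ∀ f : SFun P E O, ContDiffOn ℝ ∞ f (M.dom a a) →
      pull Ψ (pullProj f) x = pull b f x := fun f hf => by
    rw [pull_pullProj hΨ hU hf hx', pull_congr_left hb]
  have hbΨ : ∀ j, b j x ∈ Gr.par (par j) := fun j => by
    rw [← hb, ← par_bas]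
    exact hΨ (bas j)
  -- Raising the index of a lowered velocity gives it back, by the pulled back relation between
  -- `g.inv` and `g.coeff`.
  have hη : ∀ k, pull Ψ (legendreInv g a (fib k)) x = v k := fun k => by
    rw [legendreInv_fib, pull_bilinear hΨ hW hx' (fun m => (g.inv_isSFunOn m k).pullProj.1)
      (fun m => (isSFunOn_coord_fib _ m).1)]
    simp only [pull_coord hΨ, hpp _ (g.inv_isSFunOn _ _).1, hv]
    exact raise_lower (p := par) (g := fun i j => pull b (g.coeff a i j) x)
      (h := fun i j => pull b (g.inv a i j) x) (ξ := v)
      (fun j k => pull_sum_mul_eq_ite hbΨ hU hx (fun i => (g.inv_isSFunOn i j).1)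
        (fun i => (g.smooth a i k).1) fun y hy => g.inv_mul_coeff hy j k) k
  refine ⟨?_, ?_⟩
  · rw [pull_congr hΨ hW (legendreInv_fib_isSFunOn g k).1 hx'
      fun w hw => hY.bas_eq g hU hV hw k, hη]
  · have hq : ∀ i j, ContDiffOn ℝ ∞ (pullProj (pd k (g.coeff a j i))) (projL E ⁻¹' M.dom a a) :=
      fun i j => ((g.smooth a j i).pd hU k).pullProj.1
    have hV' : ContDiffOn ℝ ∞ (pullProj (pd k (V a))) (projL E ⁻¹' M.dom a a) :=
      (hV.pd hU k).pullProj.1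
    have hquad : ContDiffOn ℝ ∞ ((1 / 2 : ℝ) • ∑ i, ∑ j, sgn (par k * (par i + par j)) •
        (legendreInv g a (fib i) * legendreInv g a (fib j) * pullProj (pd k (g.coeff a j i))))
        (projL E ⁻¹' M.dom a a) :=
      contDiffOn_const.smul <| smooth_sum fun i => smooth_sum fun j => contDiffOn_const.smul <|
        smooth_mul (smooth_mul (legendreInv_fib_isSFunOn g i).1 (legendreInv_fib_isSFunOn g j).1)
          (hq i j)
    set F : SFun P (E ⊕ E) (O ⊕ O) := (1 / 2 : ℝ) • (∑ i, ∑ j, sgn (par k * (par i + par j)) •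
      (legendreInv g a (fib i) * legendreInv g a (fib j) * pullProj (pd k (g.coeff a j i))))
      with hF
    have hdiff : ContDiffOn ℝ ∞ (F - pullProj (pd k (V a))) (projL E ⁻¹' M.dom a a) :=
      hquad.sub hV'
    have hsmul : ContDiffOn ℝ ∞ (sgn (par k) • (F - pullProj (pd k (V a))))
        (projL E ⁻¹' M.dom a a) := contDiffOn_const.smul hdiff
    rw [pull_congr hΨ hW hsmul hx'
      fun w hw => (hY.fib_eq g hU hV hw k).trans (by simp [hF]),
      pull_smul hΨ hW hdiff hx', pull_sub hΨ hW hquad hV' hx', hF,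
      pull_quadratic hΨ hW hx' (fun i => (legendreInv_fib_isSFunOn g i).1) hq,
      hpp _ (hV.pd hU k).1]
    simp only [hη, hpp _ ((g.smooth a _ _).pd hU k).1]

end Mechanics

/-! ### Second derivatives of the Lagrangian; Newton's and Hamilton's fields are related -/

section SecondDerivatives

variable {P : Type*} [Ring P] [Algebra ℝ P] [SmallSuperalgebra P]
variable {E O : Type*} [Fintype E] [DecidableEq E] [Fintype O] [DecidableEq O]
variable {M : SuperAtlas P E O} (g : RiemannianSupermetric M) {a : M.Chart}
  {V : M.Fun} {z : E ⊕ E → ℝ}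

lemma pd_pd_fib_lagrangian (hU : IsOpen (M.dom a a)) (hV : IsSFunOn (M.dom a a) 0 (V a))
    (hz : projL E z ∈ M.dom a a) (I : (E ⊕ E) ⊕ (O ⊕ O)) (k : E ⊕ O) :
    pd I (pd (fib k) (lagrangian g V a)) z =
      ∑ i, (pd I (coord (fib i)) z * pullProj (g.coeff a i k) z +
        sgn (par I * par i) • (coord (fib i) z * pd I (pullProj (g.coeff a i k)) z)) := by
  have hW := isOpen_projL_preimage hU
  have h : ∀ i, IsSFunOn (projL E ⁻¹' M.dom a a) _
      (coord (fib i) * pullProj (g.coeff a i k)) := fun i =>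
    (isSFunOn_coord_fib _ i).mul (g.smooth a i k).pullProj
  rw [pd_congr_of_isOpen (g := ∑ i, coord (fib i) * pullProj (g.coeff a i k)) I hW
    (fun w hw => (pd_fib_lagrangian g hU hV hw k).trans (by simp only [Finset.sum_apply]; rfl)) hz,
    pd_sum I fun i _ => (h i).differentiableAt hW hz]
  exact Finset.sum_congr rfl fun i _ => IsSFunOn.pd_mul hW hz (isSFunOn_coord_fib _ i)
    ((g.smooth a i k).pullProj.differentiableAt hW hz) I

lemma pd_bas_pd_fib_lagrangian (hU : IsOpen (M.dom a a)) (hV : IsSFunOn (M.dom a a) 0 (V a))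
    (hz : projL E z ∈ M.dom a a) (m k : E ⊕ O) :
    pd (bas m) (pd (fib k) (lagrangian g V a)) z =
      ∑ i, sgn (par m * par i) • (coord (fib i) z * pullProj (pd m (g.coeff a i k)) z) := by
  rw [pd_pd_fib_lagrangian g hU hV hz]
  simp only [pd_bas_coord_fib, zero_mul, zero_add, par_bas,
    pd_bas_pullProj ((g.smooth a _ _).differentiableAt hU hz)]

lemma pd_fib_pd_fib_lagrangian (hU : IsOpen (M.dom a a)) (hV : IsSFunOn (M.dom a a) 0 (V a))
    (hz : projL E z ∈ M.dom a a) (m k : E ⊕ O) :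
    pd (fib m) (pd (fib k) (lagrangian g V a)) z = pullProj (g.coeff a m k) z := by
  rw [pd_pd_fib_lagrangian g hU hV hz]
  simp only [pd_fib_coord_fib, pd_fib_pullProj ((g.smooth a _ _).differentiableAt hU hz),
    mul_zero, smul_zero, add_zero, ite_mul, one_mul, zero_mul, Finset.sum_ite_eq',
    Finset.mem_univ, if_true]

/-- The sum that arises on differentiating the momenta along the velocity. -/
lemma sum_mul_sum_comm {O' : Type*} [Fintype O'] {v : E ⊕ O → Gr P O'}
    (hv : ∀ i, v i ∈ Gr.par (par i)) (dg : E ⊕ O → E ⊕ O → Gr P O') :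
    ∑ m, v m * ∑ i, sgn (par m * par i) • (v i * dg m i) =
      ∑ i, ∑ j, v j * v i * dg i j := by
  refine Finset.sum_congr rfl fun m _ => ?_
  rw [Finset.mul_sum]
  refine Finset.sum_congr rfl fun i _ => ?_
  rw [mul_smul_comm, ← mul_assoc, Gr.supercomm (hv m) (hv i), smul_mul_assoc,
    sgn_smul_sgn_smul_self]

lemma coord_fib_mem (z : E ⊕ E → ℝ) (i : E ⊕ O) :
    coord (P := P) (fib i) z ∈ Gr.par (par i) :=
  (isSFunOn_coord_fib Set.univ i).2 z (Set.mem_univ z)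

variable (C : AffineConnection M) (X : M.Field)

/-- The components of the vectorfield of Newton's equation on a chart of the tangent bundle. -/
def newtonField (a : M.Chart) : (E ⊕ E) ⊕ (O ⊕ O) → SFun P (E ⊕ E) (O ⊕ O) :=
  bundleTuple (fun i => coord (fib i))
    (fun k => -(∑ i, ∑ j, coord (fib j) * coord (fib i) * pullProj (C.Γ a i j k)) -
      pullProj (X a k))

lemma newtonField_eq : geodesicGenerator C - verticalLift X = newtonField C X := by
  funext a J
  obtain (_ | _) | (_ | _) := J
  -- The vertical lift has no base components.
  exacts [sub_zero (G := SFun P (E ⊕ E) (O ⊕ O)) _, rfl,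
    sub_zero (G := SFun P (E ⊕ E) (O ⊕ O)) _, rfl]

lemma newtonField_bas (i : E ⊕ O) : newtonField C X a (bas i) = coord (fib i) :=
  bundleTuple_bas _ _ i

lemma newtonField_fib (k : E ⊕ O) : newtonField C X a (fib k) =
    -(∑ i, ∑ j, coord (fib j) * coord (fib i) * pullProj (C.Γ a i j k)) - pullProj (X a k) :=
  bundleTuple_fib _ _ k

/-- On the base both sides are the velocity. On the fibre, the Newton field is applied to the
momentum `±∂_{ξ^k} L` and has to give `±∂_{x^k} L`; this is the Euler–Lagrange equation with the
total time derivative replaced by the Newton field. -/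
lemma sum_newtonField_mul_pd_legendre {C X} (hC : IsLeviCivita g C) (hX : IsSuperGradient g V X)
    (hU : IsOpen (M.dom a a)) (hV : IsSFunOn (M.dom a a) 0 (V a))
    {Y : (cotangent M).Field} (hY : IsHamiltonianField (hamiltonian g V) Y)
    (hz : projL E z ∈ M.dom a a) : ∀ J, ∑ I, newtonField C X a I z * pd I (legendre g a J) z =
      pull (legendre g a) (Y a J) z := by
  have hW := isOpen_projL_preimage hU
  have hpull : ∀ k, _ := hY.pull_eq g hU hV (Ψ := legendre g a)
    (b := fun i => coord (bas i)) (x := z) (v := fun i => coord (fib i) z)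
    (fun J => (legendre_isSFunOn g J).2 z hz) (fun i => by rw [legendre_bas])
    (by rwa [bodyMap_coord_bas])
    (fun i => by rw [legendre_fib, Finset.sum_apply]; rfl)
  rw [forall_bundle]
  refine ⟨fun j => ?_, fun k => ?_⟩
  · rw [(hpull j).1, legendre_bas, sum_bundle]
    simp only [pd_coord_bas, newtonField_bas, newtonField_fib]
    simp only [bas_injective.eq_iff, bas_ne_fib, if_false, mul_ite, mul_one, mul_zero,
      Finset.sum_ite_eq, Finset.mem_univ, if_true, Finset.sum_const_zero, add_zero]
  · have h1 : ∀ I, pd I (legendre g a (fib k)) z =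
        sgn (par k) • pd I (pd (fib k) (lagrangian g V a)) z := fun I => by
      rw [pd_congr_of_isOpen (g := sgn (par k) • pd (fib k) (lagrangian g V a)) I hW
        (fun w hw => legendre_fib_apply g hU hV hw k) hz]
      exact pd_smul I _ (((lagrangian_isSFunOn g hV).pd hW (fib k)).differentiableAt hW hz)
    have h2 : pull (legendre g a) (Y a (fib k)) z =
        sgn (par k) • pd (bas k) (lagrangian g V a) z := by
      rw [pd_bas_lagrangian g hU hV hz]
      exact (hpull k).2
    rw [h2, sum_bundle]
    simp only [h1, mul_smul_comm, ← Finset.smul_sum, ← smul_add]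
    congr 1
    simp only [pd_bas_pd_fib_lagrangian g hU hV hz,
      pd_fib_pd_fib_lagrangian g hU hV hz, newtonField_bas]
    -- The metric derivatives cancel against those in `pd_bas_lagrangian_eq`; what is left is the
    -- fibre component of the Newton field contracted with the metric.
    rw [sum_mul_sum_comm (coord_fib_mem z) fun m i => pullProj (pd m (g.coeff a i k)) z,
      pd_bas_lagrangian_eq g hC hX hU hV hz, sub_eq_add_neg, ← Finset.sum_neg_distrib]
    congr 1
    refine Finset.sum_congr rfl fun l _ => ?_
    rw [← neg_mul, newtonField_fib, Pi.sub_apply, Pi.neg_apply, Finset.sum_apply, neg_add,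
      ← sub_eq_add_neg]
    simp only [Finset.sum_apply, Pi.mul_apply]

/-- The vectorfields of Newton and of Hamilton are related under the Legendre map. -/
theorem related_legendre {C X} (hC : IsLeviCivita g C) (hX : IsSuperGradient g V X)
    (hU : ∀ a, IsOpen (M.dom a a)) (hV : ∀ a, IsSFunOn (M.dom a a) 0 (V a))
    {Y : (cotangent M).Field} (hY : IsHamiltonianField (hamiltonian g V) Y) :
    Related (N := tangent M) (N' := cotangent M) id (legendre g)
      (geodesicGenerator C - verticalLift X) Y := by
  rw [newtonField_eq]
  exact fun a _ hz => sum_newtonField_mul_pd_legendre g hC hX (hU a) (hV a) hY hz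

end SecondDerivatives

/-! ### Newton, Euler–Lagrange and Hamilton equations along a lifted curve -/

section Curves

variable {P : Type*} [Ring P] [Algebra ℝ P] [SmallSuperalgebra P]
variable {E O : Type*} [Fintype E] [DecidableEq E] [Fintype O] [DecidableEq O]

/-- The local coordinates of the lift of the curve with local coordinates `c`. -/
def lift (c : E ⊕ O → SFun P (Fin 1) (Fin 0)) : (E ⊕ E) ⊕ (O ⊕ O) → SFun P (Fin 1) (Fin 0) :=
  bundleTuple c fun i => dt (c i)

lemma lift_bas (c : E ⊕ O → SFun P (Fin 1) (Fin 0)) (i : E ⊕ O) : lift c (bas i) = c i :=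
  bundleTuple_bas _ _ i

lemma lift_fib (c : E ⊕ O → SFun P (Fin 1) (Fin 0)) (i : E ⊕ O) : lift c (fib i) = dt (c i) :=
  bundleTuple_fib _ _ i

variable {M : SuperAtlas P E O} {a : M.Chart} {c : E ⊕ O → SFun P (Fin 1) (Fin 0)}
  {W : Set (Fin 1 → ℝ)} {t : Fin 1 → ℝ}

lemma dt_isSFunOn (hW : IsOpen W) (hc : IsSMorOn W (M.dom a a) c) (i : E ⊕ O) :
    IsSFunOn W (par i) (dt (c i)) :=
  ((hc.1 i).pd hW (.inl 0)).of_eq (zero_add _)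

lemma lift_isSFunOn (hW : IsOpen W) (hc : IsSMorOn W (M.dom a a) c) (J : (E ⊕ E) ⊕ (O ⊕ O)) :
    IsSFunOn W (par J) (lift c J) := by
  obtain ⟨i, rfl⟩ | ⟨i, rfl⟩ := bas_or_fib J
  · rw [lift_bas, par_bas]
    exact hc.1 i
  · rw [lift_fib, par_fib]
    exact dt_isSFunOn hW hc i

lemma lift_mem (hW : IsOpen W) (hc : IsSMorOn W (M.dom a a) c) (ht : t ∈ W)
    (J : (E ⊕ E) ⊕ (O ⊕ O)) : lift c J t ∈ Gr.par (par J) :=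
  (lift_isSFunOn hW hc J).2 t ht

lemma projL_bodyMap_lift : projL E (bodyMap (lift c) t) = bodyMap c t := by
  rw [projL_bodyMap]
  simp only [lift_bas]

lemma projL_bodyMap_lift_mem (hc : IsSMorOn W (M.dom a a) c) (ht : t ∈ W) :
    projL E (bodyMap (lift c) t) ∈ M.dom a a := by
  rw [projL_bodyMap_lift]
  exact hc.2 ht

lemma pull_lift_pullProj (hW : IsOpen W) (hc : IsSMorOn W (M.dom a a) c) (ht : t ∈ W)
    (hU : IsOpen (M.dom a a)) {f : SFun P E O} (hf : ContDiffOn ℝ ∞ f (M.dom a a)) :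
    pull (lift c) (pullProj f) t = pull c f t := by
  rw [pull_pullProj (lift_mem hW hc ht) hU hf (projL_bodyMap_lift_mem hc ht)]
  simp only [lift_bas]

lemma pull_lift_coord_fib (hW : IsOpen W) (hc : IsSMorOn W (M.dom a a) c) (ht : t ∈ W)
    (i : E ⊕ O) : pull (lift c) (coord (fib i)) t = dt (c i) t := by
  rw [pull_coord (lift_mem hW hc ht), lift_fib]

lemma pull_lift_quadratic (hW : IsOpen W) (hc : IsSMorOn W (M.dom a a) c) (ht : t ∈ W)
    (hU : IsOpen (M.dom a a)) {F : E ⊕ O → E ⊕ O → SFun P E O}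
    (hF : ∀ i j, ContDiffOn ℝ ∞ (pullProj (F i j)) (projL E ⁻¹' M.dom a a))
    (hF' : ∀ i j, ContDiffOn ℝ ∞ (F i j) (M.dom a a)) :
    pull (lift c) (∑ i, ∑ j, coord (fib j) * coord (fib i) * pullProj (F i j)) t =
      ∑ i, ∑ j, dt (c j) t * dt (c i) t * pull c (F i j) t := by
  have h := pull_quadratic (lift_mem hW hc ht) (isOpen_projL_preimage hU)
    (projL_bodyMap_lift_mem hc ht) (ζ := fun i => coord (fib i))
    (F := fun j i => pullProj (F i j)) (fun i => (isSFunOn_coord_fib _ i).1)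
    (fun j i => hF i j) 1 (fun _ _ => 1)
  simp only [one_smul, pull_lift_coord_fib hW hc ht,
    pull_lift_pullProj hW hc ht hU (hF' _ _)] at h
  rw [Finset.sum_comm, h, Finset.sum_comm]

variable {g : RiemannianSupermetric M} {V : M.Fun}

/-- The derivative of the momenta along a curve. -/
lemma dt_pull_lift_pd_fib_lagrangian (hW : IsOpen W) (hc : IsSMorOn W (M.dom a a) c) (ht : t ∈ W)
    (hU : IsOpen (M.dom a a)) (hV : IsSFunOn (M.dom a a) 0 (V a)) (k : E ⊕ O) :
    dt (pull (lift c) (pd (fib k) (lagrangian g V a))) t =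
      ∑ i, ∑ j, dt (c j) t * dt (c i) t * pull c (pd i (g.coeff a j k)) t +
        ∑ l, dt (dt (c l)) t * pull c (g.coeff a l k) t := by
  have hO := isOpen_projL_preimage hU
  have hx := projL_bodyMap_lift_mem hc ht
  have hΦ := lift_mem hW hc ht
  have h1 : ∀ m, pull (lift c) (pd (bas m) (pd (fib k) (lagrangian g V a))) t =
      ∑ i, sgn (par m * par i) • (dt (c i) t * pull c (pd m (g.coeff a i k)) t) := fun m => by
    have hs := fun i => ((g.smooth a i k).pd hU m).pullProj.1
    have hq : ContDiffOn ℝ ∞ (∑ i, sgn (par m * par i) •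
        (coord (fib i) * pullProj (pd m (g.coeff a i k)))) (projL E ⁻¹' M.dom a a) :=
      smooth_sum fun i => contDiffOn_const.smul (smooth_mul (isSFunOn_coord_fib _ i).1 (hs i))
    rw [pull_congr hΦ hO hq hx fun w hw => (pd_bas_pd_fib_lagrangian g hU hV hw m k).trans
        (by simp only [Finset.sum_apply]; rfl),
      pull_bilinear hΦ hO hx (fun i => (isSFunOn_coord_fib _ i).1) hs]
    simp only [pull_lift_coord_fib hW hc ht,
      pull_lift_pullProj hW hc ht hU ((g.smooth a _ _).pd hU _).1]
  have h2 : ∀ m, pull (lift c) (pd (fib m) (pd (fib k) (lagrangian g V a))) t =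
      pull c (g.coeff a m k) t := fun m => by
    rw [pull_congr hΦ hO (g.smooth a m k).pullProj.1 hx
      fun w hw => pd_fib_pd_fib_lagrangian g hU hV hw m k,
      pull_lift_pullProj hW hc ht hU (g.smooth a m k).1]
  rw [(dt_pull hW (lift_isSFunOn hW hc) ht hO ((lagrangian_isSFunOn g hV).pd hO (fib k)).1 hx).2,
    sum_bundle]
  simp only [h1, h2, lift_bas, lift_fib]
  rw [sum_mul_sum_comm (fun i => (dt_isSFunOn hW hc i).2 t ht)
    fun m i => pull c (pd m (g.coeff a i k)) t]

/-- This form, with explicit metric derivatives, is the one to compare with the Hamiltonian field;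
`pull_lift_pd_bas_lagrangian_eq` is the version for Newton's equation. -/
lemma pull_lift_pd_bas_lagrangian (hW : IsOpen W) (hc : IsSMorOn W (M.dom a a) c) (ht : t ∈ W)
    (hU : IsOpen (M.dom a a)) (hV : IsSFunOn (M.dom a a) 0 (V a)) (k : E ⊕ O) :
    pull (lift c) (pd (bas k) (lagrangian g V a)) t =
      (1 / 2 : ℝ) • ∑ i, ∑ j, sgn (par k * (par i + par j)) •
        (dt (c i) t * dt (c j) t * pull c (pd k (g.coeff a j i)) t) - pull c (pd k (V a)) t := by
  have hO := isOpen_projL_preimage hU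
  have hx := projL_bodyMap_lift_mem hc ht
  have hΦ := lift_mem hW hc ht
  have hξ : ∀ i : E ⊕ O, ContDiffOn ℝ ∞ (coord (P := P) (fib i)) (projL E ⁻¹' M.dom a a) :=
    fun i => (isSFunOn_coord_fib _ i).1
  have hs := fun i j => ((g.smooth a j i).pd hU k).pullProj.1
  have hV' := (hV.pd hU k).pullProj.1
  set F : SFun P (E ⊕ E) (O ⊕ O) := (1 / 2 : ℝ) • (∑ i, ∑ j, sgn (par k * (par i + par j)) •
    (coord (fib i) * coord (fib j) * pullProj (pd k (g.coeff a j i)))) with hF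
  have hF' : ContDiffOn ℝ ∞ F (projL E ⁻¹' M.dom a a) :=
    contDiffOn_const.smul <| smooth_sum fun i => smooth_sum fun j => contDiffOn_const.smul <|
      smooth_mul (smooth_mul (hξ i) (hξ j)) (hs i j)
  have hd : ContDiffOn ℝ ∞ (F - pullProj (pd k (V a))) (projL E ⁻¹' M.dom a a) := hF'.sub hV'
  rw [pull_congr hΦ hO hd hx fun w hw => (pd_bas_lagrangian g hU hV hw k).trans
      (by simp only [hF, Pi.sub_apply, Pi.smul_apply, Finset.sum_apply, Pi.mul_apply]),
    pull_sub hΦ hO hF' hV' hx, hF, pull_quadratic hΦ hO hx hξ hs]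
  simp only [pull_lift_coord_fib hW hc ht,
    pull_lift_pullProj hW hc ht hU ((g.smooth a _ _).pd hU _).1,
    pull_lift_pullProj hW hc ht hU (hV.pd hU _).1]

/-- The components of `∇_ċ ċ + X` along the curve with local coordinates `c`. -/
def newtonDefect (C : AffineConnection M) (X : M.Field) (a : M.Chart)
    (c : E ⊕ O → SFun P (Fin 1) (Fin 0)) (t : Fin 1 → ℝ) (l : E ⊕ O) : Gr P (Fin 0) :=
  dt (dt (c l)) t + ∑ i, ∑ j, dt (c j) t * dt (c i) t * pull c (C.Γ a i j l) t +
    pull c (X a l) t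

variable {C : AffineConnection M} {X : M.Field}

lemma pull_lift_newtonField_bas (hW : IsOpen W) (hc : IsSMorOn W (M.dom a a) c) (ht : t ∈ W)
    (k : E ⊕ O) : pull (lift c) (newtonField C X a (bas k)) t = dt (c k) t := by
  rw [newtonField_bas, pull_lift_coord_fib hW hc ht]

lemma pull_lift_newtonField_fib (hW : IsOpen W) (hc : IsSMorOn W (M.dom a a) c) (ht : t ∈ W)
    (hU : IsOpen (M.dom a a)) (hX : ∀ l, IsSFunOn (M.dom a a) (par l) (X a l)) (k : E ⊕ O) :
    pull (lift c) (newtonField C X a (fib k)) t =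
      -(∑ i, ∑ j, dt (c j) t * dt (c i) t * pull c (C.Γ a i j k) t) - pull c (X a k) t := by
  have hO := isOpen_projL_preimage hU
  have hx := projL_bodyMap_lift_mem hc ht
  have hΦ := lift_mem hW hc ht
  have hs := fun i j => (C.smooth a i j k).pullProj.1
  have hq : ContDiffOn ℝ ∞ (∑ i, ∑ j, coord (fib j) * coord (fib i) * pullProj (C.Γ a i j k))
      (projL E ⁻¹' M.dom a a) := smooth_sum fun i => smooth_sum fun j =>
    smooth_mul (smooth_mul (isSFunOn_coord_fib _ j).1 (isSFunOn_coord_fib _ i).1) (hs i j)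
  rw [newtonField_fib, pull_sub (f := -_) hΦ hO hq.neg (hX k).pullProj.1 hx,
    pull_neg hΦ hO hq hx,
    pull_lift_quadratic hW hc ht hU hs fun i j => (C.smooth a i j k).1,
    pull_lift_pullProj hW hc ht hU (hX k).1]

lemma pull_lift_pd_bas_lagrangian_eq (hC : IsLeviCivita g C) (hX : IsSuperGradient g V X)
    (hW : IsOpen W) (hc : IsSMorOn W (M.dom a a) c) (ht : t ∈ W)
    (hU : IsOpen (M.dom a a)) (hV : IsSFunOn (M.dom a a) 0 (V a)) (k : E ⊕ O) :
    pull (lift c) (pd (bas k) (lagrangian g V a)) t =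
      ∑ i, ∑ j, dt (c j) t * dt (c i) t * pull c (pd i (g.coeff a j k)) t +
        ∑ l, pull (lift c) (newtonField C X a (fib l)) t * pull c (g.coeff a l k) t := by
  have hO := isOpen_projL_preimage hU
  have hx := projL_bodyMap_lift_mem hc ht
  have hΦ := lift_mem hW hc ht
  have hξ : ∀ i : E ⊕ O, ContDiffOn ℝ ∞ (coord (P := P) (fib i)) (projL E ⁻¹' M.dom a a) :=
    fun i => (isSFunOn_coord_fib _ i).1
  have hs := fun i j => ((g.smooth a j k).pd hU i).pullProj.1
  have hN : ∀ l, ContDiffOn ℝ ∞ (newtonField C X a (fib l)) (projL E ⁻¹' M.dom a a) := fun l => by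
    rw [newtonField_fib]
    have h : ContDiffOn ℝ ∞ (∑ i, ∑ j, coord (fib j) * coord (fib i) * pullProj (C.Γ a i j l))
        (projL E ⁻¹' M.dom a a) := smooth_sum fun i => smooth_sum fun j =>
      smooth_mul (smooth_mul (hξ j) (hξ i)) (C.smooth a i j l).pullProj.1
    exact h.neg.sub (hX.even.1 a l).pullProj.1
  set F : SFun P (E ⊕ E) (O ⊕ O) :=
    ∑ i, ∑ j, coord (fib j) * coord (fib i) * pullProj (pd i (g.coeff a j k)) with hF
  set G : SFun P (E ⊕ E) (O ⊕ O) :=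
    ∑ l, (1 : ℝ) • (newtonField C X a (fib l) * pullProj (g.coeff a l k)) with hG
  have hF' : ContDiffOn ℝ ∞ F (projL E ⁻¹' M.dom a a) :=
    smooth_sum fun i => smooth_sum fun j => smooth_mul (smooth_mul (hξ j) (hξ i)) (hs i j)
  have hG' : ContDiffOn ℝ ∞ G (projL E ⁻¹' M.dom a a) :=
    smooth_sum fun l => contDiffOn_const.smul (smooth_mul (hN l) (g.smooth a l k).pullProj.1)
  have hsum : ContDiffOn ℝ ∞ (F + G) (projL E ⁻¹' M.dom a a) := hF'.add hG'
  rw [pull_congr hΦ hO hsum hx fun w hw => (pd_bas_lagrangian_eq g hC hX hU hV hw k).trans ?_,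
    pull_add hΦ hO hF' hG' hx, hF,
    pull_lift_quadratic hW hc ht hU hs fun i j => ((g.smooth a j k).pd hU i).1, hG,
    pull_bilinear hΦ hO hx hN fun l => (g.smooth a l k).pullProj.1]
  · simp only [one_smul, pull_lift_pullProj hW hc ht hU (g.smooth a _ _).1]
  · simp only [hF, hG, newtonField_fib, one_smul, Pi.add_apply, Pi.sub_apply, Pi.neg_apply,
      Finset.sum_apply, Pi.mul_apply]
    rw [sub_eq_add_neg, ← Finset.sum_neg_distrib]
    simp only [← neg_mul, neg_add, sub_eq_add_neg]

/-- The Euler-Lagrange expression in terms of Newton's equation. -/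
lemma eulerLagrange_sub_eq (hC : IsLeviCivita g C) (hX : IsSuperGradient g V X)
    (hW : IsOpen W) (hc : IsSMorOn W (M.dom a a) c) (ht : t ∈ W)
    (hU : IsOpen (M.dom a a)) (hV : IsSFunOn (M.dom a a) 0 (V a)) (k : E ⊕ O) :
    dt (pull (lift c) (pd (fib k) (lagrangian g V a))) t -
        pull (lift c) (pd (bas k) (lagrangian g V a)) t =
      ∑ l, newtonDefect C X a c t l * pull c (g.coeff a l k) t := by
  rw [dt_pull_lift_pd_fib_lagrangian hW hc ht hU hV,
    pull_lift_pd_bas_lagrangian_eq hC hX hW hc ht hU hV, add_sub_add_left_eq_sub,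
    ← Finset.sum_sub_distrib]
  refine Finset.sum_congr rfl fun l _ => ?_
  rw [← sub_mul, pull_lift_newtonField_fib hW hc ht hU (hX.even.1 a), newtonDefect]
  congr 1
  abel

/-- The equations state that the Newton defect, contracted with the metric along the curve,
vanishes; the pulled back metric is still invertible. -/
lemma forall_eulerLagrange_iff (hC : IsLeviCivita g C) (hX : IsSuperGradient g V X)
    (hW : IsOpen W) (hc : IsSMorOn W (M.dom a a) c) (ht : t ∈ W)
    (hU : IsOpen (M.dom a a)) (hV : IsSFunOn (M.dom a a) 0 (V a)) :
    (∀ k, dt (pull (lift c) (pd (fib k) (lagrangian g V a))) t =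
        pull (lift c) (pd (bas k) (lagrangian g V a)) t) ↔
      ∀ k, newtonDefect C X a c t k = 0 := by
  refine ⟨fun h => ?_, fun h k => ?_⟩
  · refine eq_zero_of_forall_sum_mul_eq_zero (g := fun i j => pull c (g.coeff a i j) t)
      (h := fun i j => pull c (g.inv a i j) t) (fun i k => ?_) fun k => ?_
    · exact pull_sum_mul_eq_ite (fun j => (hc.1 j).2 t ht) hU (hc.2 ht)
        (fun j => (g.smooth a i j).1) (fun j => (g.inv_isSFunOn k j).1)
        fun y hy => g.coeff_mul_inv hy i k
    · rw [← eulerLagrange_sub_eq hC hX hW hc ht hU hV, h, sub_self]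
  · rw [← sub_eq_zero, eulerLagrange_sub_eq hC hX hW hc ht hU hV]
    simp only [h, zero_mul, Finset.sum_const_zero]

/-- The base equations hold for every lift, since its fibre components are the velocities by
construction. -/
lemma forall_integralCurve_newtonField_iff (hX : ∀ l, IsSFunOn (M.dom a a) (par l) (X a l))
    (hW : IsOpen W) (hc : IsSMorOn W (M.dom a a) c) (ht : t ∈ W) (hU : IsOpen (M.dom a a)) :
    (∀ J, dt (lift c J) t = pull (lift c) (newtonField C X a J) t) ↔
      ∀ k, newtonDefect C X a c t k = 0 := by
  rw [forall_bundle]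
  simp only [lift_bas, lift_fib, pull_lift_newtonField_bas hW hc ht, implies_true,
    true_and]
  refine forall_congr' fun k => ?_
  rw [pull_lift_newtonField_fib hW hc ht hU hX, newtonDefect, add_assoc, add_eq_zero_iff_eq_neg,
    neg_add, sub_eq_add_neg]

lemma pull_lift_legendre_fib (hW : IsOpen W) (hc : IsSMorOn W (M.dom a a) c) (ht : t ∈ W)
    (hU : IsOpen (M.dom a a)) (k : E ⊕ O) :
    pull (lift c) (legendre g a (fib k)) t =
      ∑ j, sgn (par k + par j) • (pull c (g.coeff a k j) t * dt (c j) t) := by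
  rw [legendre_fib, pull_bilinear (lift_mem hW hc ht) (isOpen_projL_preimage hU)
    (projL_bodyMap_lift_mem hc ht) (fun j => (g.smooth a k j).pullProj.1)
    fun j => (isSFunOn_coord_fib _ j).1]
  simp only [pull_lift_coord_fib hW hc ht, pull_lift_pullProj hW hc ht hU (g.smooth a _ _).1]

lemma dt_pull_lift_legendre_fib (hW : IsOpen W) (hc : IsSMorOn W (M.dom a a) c) (ht : t ∈ W)
    (hU : IsOpen (M.dom a a)) (hV : IsSFunOn (M.dom a a) 0 (V a)) (k : E ⊕ O) :
    dt (pull (lift c) (legendre g a (fib k))) t =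
      sgn (par k) • dt (pull (lift c) (pd (fib k) (lagrangian g V a))) t := by
  have hO := isOpen_projL_preimage hU
  have hp := ((lagrangian_isSFunOn g hV).pd hO (fib k)).1
  have hsmul : ContDiffOn ℝ ∞ (sgn (par k) • pd (fib k) (lagrangian g V a))
    (projL E ⁻¹' M.dom a a) := contDiffOn_const.smul hp
  -- The identification of the momenta is needed at all times in the open set `W`, not only at `t`,
  -- since it is differentiated.
  rw [dt, pd_congr_of_isOpen (g := sgn (par k) • pull (lift c) (pd (fib k) (lagrangian g V a)))
    (.inl 0) hW (fun s hs => ?_) ht]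
  · exact pd_smul _ _ (dt_pull hW (lift_isSFunOn hW hc) ht hO hp (projL_bodyMap_lift_mem hc ht)).1
  · have hx := projL_bodyMap_lift_mem hc hs
    rw [pull_congr (lift_mem hW hc hs) hO hsmul hx
      fun w hw => legendre_fib_apply g hU hV hw k, pull_smul (lift_mem hW hc hs) hO hp hx]
    rfl

/-- By `IsHamiltonianField.pull_eq` the base equations again hold automatically, and the fibre
equations are the Euler–Lagrange equations multiplied by the invertible sign `(-1)^|k|`. -/
lemma forall_integralCurve_hamiltonianField_iff {Y : (cotangent M).Field}
    (hY : IsHamiltonianField (hamiltonian g V) Y)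
    (hW : IsOpen W) (hc : IsSMorOn W (M.dom a a) c) (ht : t ∈ W) (hU : IsOpen (M.dom a a))
    (hV : IsSFunOn (M.dom a a) 0 (V a)) :
    (∀ J, dt (pull (lift c) (legendre g a J)) t =
        pull (fun J => pull (lift c) (legendre g a J)) (Y a J) t) ↔
      ∀ k, dt (pull (lift c) (pd (fib k) (lagrangian g V a))) t =
        pull (lift c) (pd (bas k) (lagrangian g V a)) t := by
  have hO := isOpen_projL_preimage hU
  have hb : ∀ i, ∀ s ∈ W, pull (lift c) (legendre g a (bas i)) s = c i s := fun i s hs => by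
    rw [legendre_bas, pull_coord (lift_mem hW hc hs), lift_bas]
  have h := fun k => hY.pull_eq g hU hV (Ψ := fun J => pull (lift c) (legendre g a J)) (b := c)
    (x := t) (v := fun i => dt (c i) t)
    (fun J => pull_mem (lift_mem hW hc ht) hO (legendre_isSFunOn g J)
      (projL_bodyMap_lift_mem hc ht))
    (fun i => hb i t ht) (hc.2 ht) (pull_lift_legendre_fib hW hc ht hU) k
  rw [forall_bundle]
  simp only [(h _).1, (h _).2, dt_pull_lift_legendre_fib hW hc ht hU hV,
    ← pull_lift_pd_bas_lagrangian hW hc ht hU hV, (sgn_smul_injective _).eq_iff]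
  exact and_iff_right fun i => pd_congr_of_isOpen _ hW (hb i) ht

variable {γ : CurveData M} {I : Set ℝ}

theorem isSuperIntegralCurve_newton_iff (hX : IsSuperGradient g V X)
    (hU : ∀ a, IsOpen (M.dom a a)) (hγ : IsPCurve M I γ) :
    IsSuperIntegralCurve (geodesicGenerator C - verticalLift X) γ.dot ↔ NewtonEquation C X γ := by
  rw [newtonField_eq]
  -- The coordinates of `γ.dot` are definitionally `lift (γ.tup a)`, so the equivalence at a single
  -- time applies as it stands.
  refine forall_congr' fun a => forall₂_congr fun t ht =>
    (forall_integralCurve_newtonField_iff (hX.even.1 a) (hγ.isOpen_pre a) (hγ.mor a) ht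
      (hU a)).trans (forall_congr' fun k => add_eq_zero_iff_eq_neg)

theorem newtonEquation_iff_eulerLagrange (hC : IsLeviCivita g C) (hX : IsSuperGradient g V X)
    (hU : ∀ a, IsOpen (M.dom a a)) (hV : ∀ a, IsSFunOn (M.dom a a) 0 (V a))
    (hγ : IsPCurve M I γ) : NewtonEquation C X γ ↔ EulerLagrange (lagrangian g V) γ := by
  refine forall_congr' fun a => forall₂_congr fun t ht => Iff.trans
    (forall_congr' fun k => add_eq_zero_iff_eq_neg.symm)
    (forall_eulerLagrange_iff hC hX (hγ.isOpen_pre a) (hγ.mor a) ht (hU a) (hV a)).symm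

theorem eulerLagrange_iff_isSuperIntegralCurve {Y : (cotangent M).Field}
    (hY : IsHamiltonianField (hamiltonian g V) Y)
    (hU : ∀ a, IsOpen (M.dom a a)) (hV : ∀ a, IsSFunOn (M.dom a a) 0 (V a))
    (hγ : IsPCurve M I γ) :
    EulerLagrange (lagrangian g V) γ ↔ IsSuperIntegralCurve Y (γ.dot.legendre g) :=
  forall_congr' fun a => forall₂_congr fun _ ht => (forall_integralCurve_hamiltonianField_iff hY
    (hγ.isOpen_pre a) (hγ.mor a) ht (hU a) (hV a)).symm

end Curves

end PSuper

end

theorem theorem5p1 {P : Type*} [Ring P] [Algebra ℝ P] [SmallSuperalgebra P] {m n : ℕ}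
    (M : PSupermanifold P (Fin m) (Fin n))
    (g : RiemannianSupermetric M.toSuperAtlas)
    (C : AffineConnection M.toSuperAtlas) (hC : IsLeviCivita g C)
    (V : M.toSuperAtlas.Fun) (hV : IsSuperFunction M.toSuperAtlas 0 V)
    (X : M.toSuperAtlas.Field) (hX : IsSuperGradient g V X)
    (Y : (cotangent M.toSuperAtlas).Field) (hY : IsHamiltonianField (hamiltonian g V) Y) :
    (∀ (I : Set ℝ) (γ : CurveData M.toSuperAtlas), IsOpen I → I.OrdConnected →
      IsPCurve M.toSuperAtlas I γ →
        (IsSuperIntegralCurve (geodesicGenerator C - verticalLift X) γ.dot ↔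
          EulerLagrange (lagrangian g V) γ)) ∧
    Related (N := tangent M.toSuperAtlas) (N' := cotangent M.toSuperAtlas) id (legendre g)
      (geodesicGenerator C - verticalLift X) Y ∧
    (∀ (I : Set ℝ) (γ : CurveData M.toSuperAtlas), IsOpen I → I.OrdConnected →
      IsPCurve M.toSuperAtlas I γ →
        (NewtonEquation C X γ ↔ EulerLagrange (lagrangian g V) γ) ∧
        (EulerLagrange (lagrangian g V) γ ↔ IsSuperIntegralCurve Y (γ.dot.legendre g))) := by
  have hU := fun a => M.isOpen_dom a a
  exact ⟨fun I γ _ _ hγ => (isSuperIntegralCurve_newton_iff hX hU hγ).trans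
      (newtonEquation_iff_eulerLagrange hC hX hU hV.1 hγ),
    related_legendre g hC hX hU hV.1 hY,
    fun I γ _ _ hγ => ⟨newtonEquation_iff_eulerLagrange hC hX hU hV.1 hγ,
      eulerLagrange_iff_isSuperIntegralCurve hY hU hV.1 hγ⟩⟩
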